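/- **Setting.** Let $\Phi$ be an irreducible reduced crystallographic root system (of any finite type $A$–$G$) with a base of simple roots $\alpha_i$ ($i\in I$), simple coroots $h_i$, Cartan matrix $\mathsf c_{i,j}=\langle h_i,\alpha_j\rangle$, positive roots $\Phi^+$, simple reflections $s_i$, fundamental weights $\varpi_i$, and longest Weyl group element $w_0$. Let $(\cdot,\cdot)$ be the Weyl-invariant form with $(\alpha,\alpha)=2$ for short roots, $d_i=(\alpha_i,\alpha_i)/2$, and write $d(i,j)=1$ if $\mathsf c_{i,j}<0$. A Dynkin quiver $Q$ is the Dynkin diagram with a height function $\xi:I\to\mathbb Z$ such that $|\xi_i-\xi_j|=1$ whenever $d(i,j)=1$. A vertex $i$ is a source of $\xi$ if $\xi_i>\xi_j$ for all $j$ with $d(i,j)=1$, and then $s_i\xi$ is $\xi$ with $\xi_i$ replaced by $\xi_i-2$. A word $(i_1,\dots,i_l)$ is $Q$-adapted if $i_k$ is a source of $s_{i_{k-1}}\cdots s_{i_1}\xi$ for all $k$. Let $\tau_Q$ be the Coxeter element having a $Q$-adapted reduced expression. **The map $\phi_Q$.** Let $\widehat\triangle_0=\{(i,p)\in I\times\mathbb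 Z: p-\xi_i\in2\mathbb Z\}$ and let $\phi_Q:\widehat\triangle_0\to\Phi^+\times\mathbb Z$ be given by $\phi_Q(i,\xi_i)=((1-\tau_Q)\varpi_i,0)$ and, if $\phi_Q(i,p)=(\beta,u)$, by $\phi_Q(i,p\pm2)=(\tau_Q^{\mp1}\beta,u)$ if $\tau_Q^{\mp1}\beta\in\Phi^+$ and $(-\tau_Q^{\mp1}\beta,u\pm1)$ otherwise. Put $(\Gamma_Q)_0=\phi_Q^{-1}(\Phi^+\times\{0\})$. **The torus $\mathcal X_q$.** Let $\underline{\mathsf C}(t)$ be the matrix over $\mathbb Q(t)$ with diagonal entries $t+t^{-1}$ and off-diagonal entries $\mathsf c_{i,j}$, let $\underline{\mathsf B}(t)=\underline{\mathsf C}(t)\,\mathrm{diag}(d_i)^{-1}$, and let $\sum_u\widetilde{\mathsf b}_{i,j}(u)t^u$ be the Laurent expansion at $t=0$ of the $(i,j)$ entry of $\underline{\mathsf B}(t)^{-1}$. Put $\widetilde\eta_{i,j}(u)=\widetilde{\mathsf b}_{i,j}(u)+\widetilde{\mathsf b}_{i,j}(-u)$ and $\underline{\mathcal N}(i,p;j,s)=\widetilde\eta_{i,j}(p-s-1)-\widetilde\eta_{i,j}(p-s+1)$.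 Then $\mathcal X_q$ is the $\mathbb Z[q^{\pm1/2}]$-algebra with generators $\widetilde X_{i,p}^{\pm1}$, $(i,p)\in\widehat\triangle_0$, and relations $\widetilde X_{i,p}\widetilde X_{i,p}^{-1}=\widetilde X_{i,p}^{-1}\widetilde X_{i,p}=1$ and $\widetilde X_{i,p}\widetilde X_{j,s}=q^{\underline{\mathcal N}(i,p;j,s)}\widetilde X_{j,s}\widetilde X_{i,p}$. Let $\mathcal X_{q,Q}\subseteq\mathcal X_q$ be the subalgebra generated by $\widetilde X_{i,p}^{\pm1}$, $(i,p)\in(\Gamma_Q)_0$. Let $\overline{(\cdot)}$ be the $\mathbb Z$-algebra anti-involution of $\mathcal X_q$ with $q^{1/2}\mapsto q^{-1/2}$ and $\widetilde X_{i,p}\mapsto q^{d_i}\widetilde X_{i,p}$. For $(i,p)\in\widehat\triangle_0$ let $\widetilde m^{(i)}[p,\xi_i]=q^{r}\prod_{p\le t\le\xi_i,\ t\equiv p\ (2)}\widetilde X_{i,t}$, with $r\in\frac12\mathbb Z$ chosen such that this element is fixed by $\overline{(\cdot)}$. **The torus $\mathcal T_{\nu,[Q]}$.** Let $[Q]$ be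 the commutation class of the $Q$-adapted reduced expressions $s_{i_1}\cdots s_{i_\ell}$ of $w_0$. Such an expression orders $\Phi^+$ as $\beta_1<\cdots<\beta_\ell$, $\beta_k=s_{i_1}\cdots s_{i_{k-1}}\alpha_{i_k}$. For $\alpha=\beta_k$ put $\mathrm{res}(\alpha)=i_k$ and $\lambda_\alpha=s_{i_1}\cdots s_{i_k}\varpi_{i_k}$. Write $\alpha\preceq_{[Q]}\beta$ if $\alpha\le\beta$ in the order of every expression in the class. Let $\Lambda=\Lambda^{[Q]}$ be the skew-symmetric $\Phi^+\times\Phi^+$-matrix with $\Lambda_{\alpha\beta}=(\varpi_i-\lambda_\alpha,\varpi_j+\lambda_\beta)$ for $\beta\not\prec_{[Q]}\alpha$, where $i=\mathrm{res}(\alpha)$, $j=\mathrm{res}(\beta)$. Then $\mathcal T_{\nu,[Q]}$ is the $\mathbb Z[\nu^{\pm1/2}]$-algebra with generators $Y_\alpha^{\pm1}$ ($\alpha\in\Phi^+$) and relations $Y_\alpha Y_\alpha^{-1}=Y_\alpha^{-1}Y_\alpha=1$, $Y_\alpha Y_\beta=\nu^{\Lambda_{\alpha\beta}}Y_\beta Y_\alpha$.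 **Theorem.** For every Dynkin quiver $Q$, $Q$-adapted reduced expressions of $w_0$ exist, for each $\alpha\in\Phi^+$ there is exactly one $(i,p)\in\widehat\triangle_0$ with $\phi_Q(i,p)=(\alpha,0)$, and there is an algebra isomorphism $\Psi_Q:\mathcal T_{\nu,[Q]}\to\mathcal X_{q,Q}$ with $$\nu^{\pm1/2}\mapsto q^{\pm1/2},\qquad Y_\alpha\mapsto\widetilde m^{(i)}[p,\xi_i]\quad\text{for all }\alpha\in\Phi^+,\text{ where }\phi_Q(i,p)=(\alpha,0).$$ -/

import Mathlib

noncomputable section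

namespace DynkinTorus

open MulOpposite

/-! ## Quantum tori -/

/-- The coefficient ring `ℤ[q^{±1/2}]`: the Laurent polynomial variable `T 1` is `q^{1/2}`. -/
abbrev Coeff : Type := LaurentPolynomial ℤ

/-- The power `q^x = (q^{1/2})^{2x}`; it is only meant for `x ∈ ½ℤ`, and `qpow x` is then
genuinely the `2x`-th power of `q^{1/2}`. -/
def qpow (x : ℚ) : Coeff := LaurentPolynomial.T ⌊2 * x⌋

section Torus

variable {S : Type*}

/-- Free generators: `Sum.inl a` stands for `X_a` and `Sum.inr a` for `X_a⁻¹`. -/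
inductive TorusRel (e : S → S → ℚ) :
    FreeAlgebra Coeff (S ⊕ S) → FreeAlgebra Coeff (S ⊕ S) → Prop
  | mul_inv (a : S) : TorusRel e
      (FreeAlgebra.ι Coeff (Sum.inl a) * FreeAlgebra.ι Coeff (Sum.inr a)) 1
  | inv_mul (a : S) : TorusRel e
      (FreeAlgebra.ι Coeff (Sum.inr a) * FreeAlgebra.ι Coeff (Sum.inl a)) 1
  | comm (a b : S) : TorusRel e
      (FreeAlgebra.ι Coeff (Sum.inl a) * FreeAlgebra.ι Coeff (Sum.inl b))
      (qpow (e a b) • (FreeAlgebra.ι Coeff (Sum.inl b) * FreeAlgebra.ι Coeff (Sum.inl a)))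

/-- The `ℤ[q^{±1/2}]`-algebra with generators `X_a^{±1}` (`a ∈ S`) and relations
`X_a X_a⁻¹ = X_a⁻¹ X_a = 1`, `X_a X_b = q^{e a b} X_b X_a`. -/
abbrev QuantumTorus (e : S → S → ℚ) : Type _ := RingQuot (TorusRel e)

variable (e : S → S → ℚ)

/-- The generator `X_a`. -/
def gen (a : S) : QuantumTorus e :=
  RingQuot.mkAlgHom Coeff (TorusRel e) (FreeAlgebra.ι Coeff (Sum.inl a))

/-- The generator `X_a⁻¹`. -/
def genInv (a : S) : QuantumTorus e :=
  RingQuot.mkAlgHom Coeff (TorusRel e) (FreeAlgebra.ι Coeff (Sum.inr a))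

theorem gen_mul_genInv (a : S) : gen e a * genInv e a = 1 := by
  rw [gen, genInv, ← map_mul, RingQuot.mkAlgHom_rel Coeff (TorusRel.mul_inv (e := e) a), map_one]

theorem genInv_mul_gen (a : S) : genInv e a * gen e a = 1 := by
  rw [gen, genInv, ← map_mul, RingQuot.mkAlgHom_rel Coeff (TorusRel.inv_mul (e := e) a), map_one]

theorem gen_mul_gen (a b : S) : gen e a * gen e b = qpow (e a b) • (gen e b * gen e a) := by
  rw [gen, gen, ← map_mul, RingQuot.mkAlgHom_rel Coeff (TorusRel.comm (e := e) a b), map_smul,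
    map_mul]

/-- The opposite ring, as a `ℤ[q^{±1/2}]`-algebra through `q^{1/2} ↦ q^{-1/2}`. -/
def TwistedOp (A : Type*) : Type _ := Aᵐᵒᵖ

instance (A : Type*) [Ring A] : Ring (TwistedOp A) := inferInstanceAs (Ring Aᵐᵒᵖ)

instance (A : Type*) [Ring A] [Algebra Coeff A] : Algebra Coeff (TwistedOp A) :=
  RingHom.toAlgebra' (S := TwistedOp A)
    ((algebraMap Coeff Aᵐᵒᵖ).comp (LaurentPolynomial.invert (R := ℤ)).toRingEquiv.toRingHom)
    (fun c x => Algebra.commutes (R := Coeff) (A := Aᵐᵒᵖ) (LaurentPolynomial.invert c) x)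

/-- The element of the twisted opposite algebra given by `x`. -/
def TwistedOp.mk {A : Type*} (x : A) : TwistedOp A := op x

/-- The element of `A` underlying an element of the twisted opposite algebra. -/
def TwistedOp.get {A : Type*} (x : TwistedOp A) : A := unop (show Aᵐᵒᵖ from x)

theorem TwistedOp.mk_mul {A : Type*} [Ring A] (x y : A) :
    TwistedOp.mk x * TwistedOp.mk y = TwistedOp.mk (y * x) := rfl

theorem TwistedOp.smul_mk {A : Type*} [Ring A] [Algebra Coeff A] (c : Coeff) (x : A) :
    c • TwistedOp.mk x = TwistedOp.mk (LaurentPolynomial.invert c • x) := by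
  rw [Algebra.smul_def, Algebra.smul_def, Algebra.commutes]
  rfl

theorem qpow_mul_invert (x : ℚ) : qpow x * LaurentPolynomial.invert (qpow x) = 1 := by
  rw [qpow, LaurentPolynomial.invert_T, ← LaurentPolynomial.T_add, add_neg_cancel,
    LaurentPolynomial.T_zero]

/-- The images of the generators `X_a`, `X_a⁻¹` under the bar map. -/
def barGen (d : S → ℚ) : S ⊕ S → TwistedOp (QuantumTorus e)
  | Sum.inl a => TwistedOp.mk (qpow (d a) • gen e a)
  | Sum.inr a => TwistedOp.mk (LaurentPolynomial.invert (qpow (d a)) • genInv e a)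

/-- The anti-homomorphism `q^{1/2} ↦ q^{-1/2}`, `X_a ↦ q^{d a} X_a` (hence
`X_a⁻¹ ↦ q^{-d a} X_a⁻¹`), as a homomorphism to the opposite algebra. -/
def barHom (d : S → ℚ) : QuantumTorus e →ₐ[Coeff] TwistedOp (QuantumTorus e) :=
  RingQuot.liftAlgHom Coeff ⟨FreeAlgebra.lift Coeff (barGen e d), by
    intro x y h
    induction h with
    | mul_inv a =>
      simp only [map_mul, FreeAlgebra.lift_ι_apply, map_one, barGen]
      rw [TwistedOp.mk_mul, smul_mul_smul_comm, genInv_mul_gen, mul_comm, qpow_mul_invert,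
        one_smul]
      rfl
    | inv_mul a =>
      simp only [map_mul, FreeAlgebra.lift_ι_apply, map_one, barGen]
      rw [TwistedOp.mk_mul, smul_mul_smul_comm, gen_mul_genInv, qpow_mul_invert, one_smul]
      rfl
    | comm a b =>
      simp only [map_mul, map_smul, FreeAlgebra.lift_ι_apply, barGen]
      rw [TwistedOp.mk_mul, TwistedOp.mk_mul, TwistedOp.smul_mk, smul_mul_smul_comm,
        smul_mul_smul_comm, gen_mul_gen e a b, smul_smul, smul_smul]
      congr 2
      linear_combination (-(qpow (d a) * qpow (d b))) * qpow_mul_invert (e a b)⟩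

/-- The bar map of the torus, as a map to itself. -/
def bar (d : S → ℚ) (x : QuantumTorus e) : QuantumTorus e :=
  TwistedOp.get (barHom e d x)

theorem bar_add (d : S → ℚ) (x y : QuantumTorus e) :
    bar e d (x + y) = bar e d x + bar e d y :=
  congrArg TwistedOp.get (map_add (barHom e d) x y)

theorem bar_mul (d : S → ℚ) (x y : QuantumTorus e) :
    bar e d (x * y) = bar e d y * bar e d x :=
  congrArg TwistedOp.get (map_mul (barHom e d) x y)

theorem bar_smul (d : S → ℚ) (c : Coeff) (x : QuantumTorus e) :
    bar e d (c • x) = LaurentPolynomial.invert c • bar e d x :=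
  congrArg TwistedOp.get ((map_smul (barHom e d) c x).trans
    (TwistedOp.smul_mk c (bar e d x)))

theorem bar_one (d : S → ℚ) : bar e d 1 = 1 :=
  congrArg TwistedOp.get (map_one (barHom e d))

theorem bar_gen (d : S → ℚ) (a : S) : bar e d (gen e a) = qpow (d a) • gen e a := by
  rw [bar, barHom, gen, RingQuot.liftAlgHom_mkAlgHom_apply, FreeAlgebra.lift_ι_apply]
  rfl

end Torus

/-! ## Finite Cartan data

A finite Cartan datum (with connected Dynkin diagram) is a reduced irreducible crystallographic
root system `P` over `ℚ` in `M = 𝔥*`, with coroots in `N = 𝔥`, together with a base `b`; the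
vertex set of the Dynkin diagram is `b.support`, and the Cartan matrix is
`c_{i,j} = ⟨h_i, α_j⟩ = P.pairing j i`. -/

section Cartan

variable {ι M N : Type*} [AddCommGroup M] [Module ℚ M] [AddCommGroup N] [Module ℚ N]
variable {P : RootPairing ι ℚ M N} (b : P.Base)

/-- The edges of the Dynkin diagram: `d(i,j) = 1`, that is, `c_{i,j} < 0`. -/
def Adjacent (i j : b.support) : Prop := P.pairing j i < 0

/-- The set of positive roots `Φ⁺`. -/
def posRoots : Set M := P.root '' {k | b.IsPos k}

/-- The simple reflection `s_i`, acting on `𝔥*`. -/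
def simpleReflection (i : b.support) : M ≃ₗ[ℚ] M := P.reflection i

/-- The element `s_{i_1} ⋯ s_{i_l}` of the Weyl group given by the word `(i_1, …, i_l)`. -/
def wordProd (w : List b.support) : M ≃ₗ[ℚ] M := (w.map (simpleReflection b)).prod

/-- The word is a reduced expression. -/
def IsReducedWord (w : List b.support) : Prop :=
  ∀ w' : List b.support, wordProd b w' = wordProd b w → w.length ≤ w'.length

/-- The word is a reduced expression of the longest element `w₀` of the Weyl group. -/
def IsLongestWord (w : List b.support) : Prop :=
  IsReducedWord b w ∧ ∀ w' : List b.support, IsReducedWord b w' → w'.length ≤ w.length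

/-- One commutation move `s_i s_j = s_j s_i` with `d(i,j) > 1`, that is, `c_{i,j} = 0`. -/
def CommMove (w w' : List b.support) : Prop :=
  ∃ (u v : List b.support) (i j : b.support), P.pairing j i = 0 ∧
    w = u ++ i :: j :: v ∧ w' = u ++ j :: i :: v

/-- Commutation equivalence of words. -/
def CommEquiv (w w' : List b.support) : Prop := Relation.EqvGen (CommMove b) w w'

/-- The root `β_k = s_{i_1} ⋯ s_{i_{k-1}} (α_{i_k})` (with `k` counted from `0` here). -/
def wordRoot (w : List b.support) (k : Fin w.length) : M :=
  wordProd b (w.take k.val) (P.root (w.get k))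

/-- The convex partial order `α ≼_{[w]} β`: `α` is not after `β` in the order on roots
of any word in the commutation class of `w`. -/
def ConvexLE (w : List b.support) (α β : M) : Prop :=
  ∀ w' : List b.support, CommEquiv b w w' →
    ∃ k l : Fin w'.length, wordRoot b w' k = α ∧ wordRoot b w' l = β ∧ k ≤ l

/-- The strict convex partial order `α ≺_{[w]} β`. -/
def ConvexLT (w : List b.support) (α β : M) : Prop := ConvexLE b w α β ∧ α ≠ β

/-- The fundamental weight `ϖ_i`, the element of `𝔥*` with `⟨h_j, ϖ_i⟩ = δ_{ij}`. -/
def fundWeight [P.IsRootSystem] (i : b.support) : M :=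
  P.toPerfPair.symm (b.toCoweightBasis.coord i)

open Classical in
theorem fundWeight_coroot [P.IsRootSystem] (i j : b.support) :
    P.toLinearMap (fundWeight b i) (P.coroot j) = if j = i then 1 else 0 := by
  have h := LinearMap.apply_symm_toPerfPair_self (p := P.toLinearMap) (b.toCoweightBasis.coord i)
  rw [fundWeight, h, ← b.toCoweightBasis_apply j, Module.Basis.coord_apply,
    Module.Basis.repr_self, Finsupp.single_apply]

/-- For `α = β_k` (with `w = (i_1, …, i_ℓ)`, `i = i_k`), the weight `ϖ_i`, where `i` is the
residue of `α`. (For a reduced expression of `w₀`, every positive root is `β_k` for a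
unique `k`.) -/
def resWeight [P.IsRootSystem] (w : List b.support) (α : M) : M :=
  open Classical in
  if h : ∃ k : Fin w.length, wordRoot b w k = α then fundWeight b (w.get h.choose) else 0

/-- For `α = β_k`, the weight `λ_α = s_{i_1} ⋯ s_{i_k} ϖ_{i_k}`. -/
def lamWeight [P.IsRootSystem] (w : List b.support) (α : M) : M :=
  open Classical in
  if h : ∃ k : Fin w.length, wordRoot b w k = α then
    wordProd b (w.take (h.choose.val + 1)) (fundWeight b (w.get h.choose))
  else 0

variable [Fintype ι]

/-- The smallest value of the canonical invariant form `∑_k ⟨h_k, x⟩ ⟨h_k, y⟩` on the roots. -/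
def minRootNorm (P : RootPairing ι ℚ M N) [Nonempty ι] : ℚ :=
  Finset.univ.inf' Finset.univ_nonempty fun k => P.RootForm (P.root k) (P.root k)

/-- The Weyl group invariant form on `𝔥*`, normalized so that `(α, α) = 2` for short roots. -/
def form (P : RootPairing ι ℚ M N) [Nonempty ι] (x y : M) : ℚ :=
  2 / minRootNorm P * P.RootForm x y

/-- The number `d_i = (α_i, α_i) / 2`. -/
def halfNorm [Nonempty ι] (i : b.support) : ℚ := form P (P.root i) (P.root i) / 2

/-- The skew-symmetric matrix `Λ^{[w]}`, given by
`Λ_{αβ} = (ϖ_i - λ_α, ϖ_j + λ_β)` if not `β ≺ α`, where `i`, `j` are the residues of `α`, `β`,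
and hence by `Λ_{αβ} = - Λ_{βα}` if `β ≺ α`. -/
def lambdaMatrix [Nonempty ι] [P.IsRootSystem] (w : List b.support) (α β : posRoots b) : ℚ :=
  open Classical in
  if ConvexLT b w β α then
    - form P (resWeight b w β - lamWeight b w β) (resWeight b w α + lamWeight b w α)
  else form P (resWeight b w α - lamWeight b w α) (resWeight b w β + lamWeight b w β)

/-- The quantum torus `𝒯_{ν,[w]}`, with generators `Y_α^{±1}` for `α ∈ Φ⁺`; here the variable of
the coefficient ring is `ν^{1/2}`. -/
abbrev TorusT [Nonempty ι] [P.IsRootSystem] (w : List b.support) : Type _ :=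
  QuantumTorus (lambdaMatrix b w)

/-- The `t`-quantized Cartan matrix: the `(q,t)`-Cartan matrix at `q = 1`. -/
def tCartan : Matrix b.support b.support (RatFunc ℚ) :=
  open Classical in
  fun i j => if i = j then RatFunc.X + RatFunc.X⁻¹ else RatFunc.C (P.pairing j i)

/-- The symmetrization `B(t) = C(t) D⁻¹`, with `D = diag(d_i)`. -/
def tSymm [Nonempty ι] : Matrix b.support b.support (RatFunc ℚ) :=
  open Classical in
  tCartan b * (Matrix.diagonal fun i => RatFunc.C (halfNorm b i))⁻¹

/-- The coefficient of `t^u` in the Laurent expansion at `t = 0` of the `(i,j)` entry of the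
inverse of `B(t)`. -/
def bTilde [Nonempty ι] (i j : b.support) (u : ℤ) : ℚ :=
  open Classical in
  (((tSymm b)⁻¹ i j : RatFunc ℚ) : LaurentSeries ℚ).coeff u

/-- The even function `b̃_{i,j}(u) + b̃_{i,j}(-u)`. -/
def etaTilde [Nonempty ι] (i j : b.support) (u : ℤ) : ℚ := bTilde b i j u + bTilde b i j (-u)

end Cartan

/-! ## Dynkin quivers -/

section Quiver

variable {ι M N : Type*} [AddCommGroup M] [Module ℚ M] [AddCommGroup N] [Module ℚ N]
variable {P : RootPairing ι ℚ M N}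

/-- A Dynkin quiver on the Dynkin diagram of `b`: the diagram with a height function `ξ`
(there is an arrow `i → j` if `d(i,j) = 1` and `ξ_i = ξ_j + 1`). -/
structure DynkinQuiver (b : P.Base) where
  /-- The height function `ξ`. -/
  height : b.support → ℤ
  abs_sub_eq_one : ∀ i j, Adjacent b i j → |height i - height j| = 1

variable {b : P.Base}

/-- The vertex `i` is a source for the height function `ξ`. -/
def IsSource (ξ : b.support → ℤ) (i : b.support) : Prop := ∀ j, Adjacent b i j → ξ j < ξ i

/-- The height function `s_i ξ`. -/
def reflectHeight (ξ : b.support → ℤ) (i : b.support) : b.support → ℤ :=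
  open Classical in fun j => if j = i then ξ j - 2 else ξ j

/-- The word `(i_1, …, i_l)` is adapted: `i_k` is a source of `s_{i_{k-1}} ⋯ s_{i_1} ξ`. -/
def IsAdapted : (b.support → ℤ) → List b.support → Prop
  | _, [] => True
  | ξ, i :: w => IsSource ξ i ∧ IsAdapted (reflectHeight ξ i) w

namespace DynkinQuiver

variable (Q : DynkinQuiver b)

/-- The word is a `Q`-adapted reduced expression of a Coxeter element. -/
def IsCoxeterWord (w : List b.support) : Prop :=
  w.Nodup ∧ (∀ i, i ∈ w) ∧ IsAdapted Q.height w

theorem isAdapted_of_pairwise (w : List b.support) (η : b.support → ℤ) (hw : w.Nodup)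
    (hs : w.Pairwise fun i j => Q.height j ≤ Q.height i)
    (h1 : ∀ j ∈ w, η j = Q.height j) (h2 : ∀ j, j ∉ w → η j = Q.height j - 2) :
    IsAdapted η w := by
  induction w generalizing η with
  | nil => trivial
  | cons i w ih =>
    rw [List.nodup_cons] at hw
    rw [List.pairwise_cons] at hs
    refine ⟨fun j hj => ?_, ih _ hw.2 hs.2 (fun j hj => ?_) (fun j hj => ?_)⟩
    · have habs := Q.abs_sub_eq_one i j hj
      have hi := h1 i (by simp)
      have hne : Q.height i ≠ Q.height j := by
        intro h
        simp [h] at habs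
      have hle := le_of_abs_le habs.le
      have hge := neg_le_of_abs_le habs.le
      by_cases hjw : j ∈ i :: w
      · have hj' := h1 j hjw
        rcases List.mem_cons.1 hjw with h | h
        · exact absurd (by rw [h]) hne
        · have := hs.1 j h
          omega
      · have := h2 j hjw
        omega
    · have hji : j ≠ i := fun h => hw.1 (h ▸ hj)
      simp only [reflectHeight, hji, if_false]
      exact h1 j (List.mem_cons_of_mem _ hj)
    · by_cases hji : j = i
      · subst hji
        simp only [reflectHeight, if_true]
        rw [h1 j (by simp)]
      · simp only [reflectHeight, hji, if_false]
        exact h2 j (by simp [hji, hj])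

theorem exists_isCoxeterWord : ∃ w, Q.IsCoxeterWord w := by
  classical
  let r : b.support → b.support → Prop := fun i j => Q.height j ≤ Q.height i
  have : Std.Total r := ⟨fun i j => le_total (Q.height j) (Q.height i)⟩
  have : IsTrans b.support r := ⟨fun i j k h h' => le_trans h' h⟩
  have hperm := List.perm_insertionSort r (Finset.univ : Finset b.support).toList
  have hmem : ∀ i, i ∈ (Finset.univ : Finset b.support).toList.insertionSort r := fun i =>
    hperm.mem_iff.2 (by simp)
  have hnd := hperm.nodup_iff.2 (Finset.nodup_toList _)
  exact ⟨_, hnd, hmem, Q.isAdapted_of_pairwise _ _ hnd (List.pairwise_insertionSort r _)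
    (fun _ _ => rfl) (fun j hj => absurd (hmem j) hj)⟩

/-- The Coxeter element `τ_Q` with a `Q`-adapted reduced expression. -/
def coxeter : M ≃ₗ[ℚ] M := wordProd b Q.exists_isCoxeterWord.choose

/-- `w` is a representative of `[Q]`, i.e. a `Q`-adapted reduced expression of `w₀`. -/
def IsLongestAdapted (w : List b.support) : Prop := IsLongestWord b w ∧ IsAdapted Q.height w

/-- The vertices `(i,p)` of the repetition quiver: `p - ξ_i` is even. -/
def Vertex : Type _ := {v : b.support × ℤ // Even (v.2 - Q.height v.1)}

/-- The vector `γ_i^Q = (1 - τ_Q) ϖ_i`. -/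
def gamma [P.IsRootSystem] (i : b.support) : M := fundWeight b i - Q.coxeter (fundWeight b i)

/-- From the label `(β,u)` of `(i,p)` to the label of `(i,p+2)`. -/
def stepUp (x : M × ℤ) : M × ℤ :=
  open Classical in
  if Q.coxeter.symm x.1 ∈ posRoots b then (Q.coxeter.symm x.1, x.2)
  else (-Q.coxeter.symm x.1, x.2 + 1)

/-- From the label `(β,u)` of `(i,p)` to the label of `(i,p-2)`. -/
def stepDown (x : M × ℤ) : M × ℤ :=
  open Classical in
  if Q.coxeter x.1 ∈ posRoots b then (Q.coxeter x.1, x.2) else (-Q.coxeter x.1, x.2 - 1)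

/-- The map `φ_Q` from the vertices of the repetition quiver to `Φ⁺ × ℤ ⊆ 𝔥* × ℤ`, determined by
`φ_Q(i,ξ_i) = (γ_i^Q,0)` and the two step rules. -/
def phi [P.IsRootSystem] (v : Q.Vertex) : M × ℤ :=
  if Q.height v.1.1 ≤ v.1.2 then
    Q.stepUp^[((v.1.2 - Q.height v.1.1) / 2).toNat] (Q.gamma v.1.1, 0)
  else Q.stepDown^[((Q.height v.1.1 - v.1.2) / 2).toNat] (Q.gamma v.1.1, 0)

/-- The vertices of the quiver `Γ_Q`: the preimage of `Φ⁺ × {0}` under `φ_Q`. -/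
def gammaVertices [P.IsRootSystem] : Set Q.Vertex :=
  {v | (Q.phi v).1 ∈ posRoots b ∧ (Q.phi v).2 = 0}

variable [Fintype ι] [Nonempty ι]

/-- The exponent of the `q`-commutation relation between `X_{i,p}` and `X_{j,s}`. -/
def commExp (v v' : Q.Vertex) : ℚ :=
  etaTilde b v.1.1 v'.1.1 (v.1.2 - v'.1.2 - 1) - etaTilde b v.1.1 v'.1.1 (v.1.2 - v'.1.2 + 1)

/-- The quantum torus `𝒳_q`, with generators `X_{i,p}^{±1}`; the variable of
the coefficient ring is `q^{1/2}`. -/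
abbrev TorusX : Type _ := QuantumTorus Q.commExp

/-- The anti-involution `q^{1/2} ↦ q^{-1/2}`, `X_{i,p} ↦ q^{d_i} X_{i,p}` of `𝒳_q`. -/
def barX (x : Q.TorusX) : Q.TorusX := bar Q.commExp (fun v => halfNorm b v.1.1) x

/-- The vertex `(i,p+2k)`. -/
def shift {Q : DynkinQuiver b} (v : Q.Vertex) (k : ℕ) : Q.Vertex :=
  ⟨(v.1.1, v.1.2 + 2 * k), by
    have h := v.2
    simp only [Int.even_sub, Int.even_add, even_two_mul, iff_true] at h ⊢
    exact h⟩

/-- The product of the generators `X_{i,t}` over `t = p, p + 2, …`, `t ≤ ξ_i`, where `v = (i,p)`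
(the empty product if `p > ξ_i`). -/
def monomial (v : Q.Vertex) : Q.TorusX :=
  ((List.range ((Q.height v.1.1 - v.1.2) / 2 + 1).toNat).map
    fun k => gen Q.commExp (shift v k)).prod

/-- `m` is the bar-invariant monomial `m̃^{(i)}[p,ξ_i]`, where `v = (i,p)`: the bar-invariant element
among the `q^r ∏ X_{i,t}` with `r ∈ ½ℤ` (here `q^r = T n` with `n = 2r`). -/
def IsBarMonomial (v : Q.Vertex) (m : Q.TorusX) : Prop :=
  (∃ n : ℤ, m = (LaurentPolynomial.T n : Coeff) • Q.monomial v) ∧ Q.barX m = m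

/-- The quantum subtorus `𝒳_{q,Q}` of `𝒳_q`, generated by `X_{i,p}^{±1}` for `(i,p)` in `Γ_Q`. -/
def subtorus [P.IsRootSystem] : Subalgebra Coeff Q.TorusX :=
  Algebra.adjoin Coeff
    (gen Q.commExp '' Q.gammaVertices ∪ genInv Q.commExp '' Q.gammaVertices)

end DynkinQuiver

end Quiver

end DynkinTorus

end

noncomputable section

namespace DynkinTorus

open MulOpposite

/-! ## Positive roots and reduced words -/

section Words

variable {ι M N : Type*} [AddCommGroup M] [Module ℚ M] [AddCommGroup N] [Module ℚ N]
variable {P : RootPairing ι ℚ M N} (b : P.Base)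

/-! Each vertex `(i,p)` of the repetition quiver carries the weight τ_Q^{(ξ_i-p)/2} ϖ_i (`weightAt`)
and the root `rootAt`, the difference of two consecutive weights. Splitting τ_Q at its unique letter
`i` writes ϖ_i + τ_Q ϖ_i as a sum over the neighbours of `i`, and translating by powers of τ_Q gives
a mesh relation for weights and for roots. By it, s_{i_1}⋯s_{i_k} ϖ_j along an adapted word is the
weight at `j` at its current height (`wordProd_fundWeight`). So β_k is the root at the vertex where
the k-th letter is reflected, λ is the weight one step lower, and φ_Q sends exactly this vertex to
(β_k, 0) (`phi_eq_iff`).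

The coefficients b̃ satisfy the same mesh relation with a source term at u = 0, and their odd
extension `bOdd` satisfies it everywhere. Uniqueness of solutions gives (ϖ_i, root at (j,p)) =
`bOdd`(ξ_i - p + 1) (`form_fundWeight_rootAt`). The commutation exponents of 𝒳_q are differences of
values of η̃, so summing them over two rows telescopes. The bound `bTilde_support` turns the even
function η̃ into the odd one in the relevant range, and the result is (ϖ_i - λ_α, ϖ_j + λ_β)
(`rowExp_letterVertex`, `lambdaMatrix_eq_rowExp`). Hence the row monomials satisfy the relations of
the Y_α. Their degrees are triangular in the generators, which gives injectivity through the regular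
representation (`torusLift_injective`). The quotient of two consecutive row monomials is a generator
up to a scalar, so they generate the subtorus.

An adapted word for w_0 also comes from `bOdd`. Two consecutive slices are the coefficients of a
root, so they have constant sign. The sign cannot stay nonnegative forever, because τ_Q has finite
orbits on the roots and no nonzero fixed vector. Just before the first sign change there is a zero
slice, at h, and before that a simple root. This yields a diagram involution σ with `bOdd` i j (h+u)
= -`bOdd` i (σ j) u (`exists_star`). Lowering the heights from ξ_j to ξ_{σ j} - h through sources
gives a word with positive roots that sends α_j to -α_{σ j}. -/

theorem root_mem_posRoots_iff (k : ι) : P.root k ∈ posRoots b ↔ b.IsPos k := by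
  simp [posRoots, P.root.injective.eq_iff]

theorem mem_range_of_mem_posRoots {x : M} (hx : x ∈ posRoots b) : x ∈ Set.range P.root := by
  obtain ⟨k, -, rfl⟩ := hx
  exact ⟨k, rfl⟩

theorem neg_root_mem_posRoots_iff (k : ι) : -P.root k ∈ posRoots b ↔ ¬ b.IsPos k := by
  let := P.indexNeg
  rw [← RootPairing.Base.IsPos.neg_iff_not, ← root_mem_posRoots_iff]
  simp

theorem mem_posRoots_or_neg_mem {x : M} (hx : x ∈ Set.range P.root) :
    x ∈ posRoots b ∨ -x ∈ posRoots b := by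
  obtain ⟨k, rfl⟩ := hx
  rw [root_mem_posRoots_iff, neg_root_mem_posRoots_iff]
  exact em _

theorem neg_notMem_posRoots {x : M} (hx : x ∈ posRoots b) : -x ∉ posRoots b := by
  obtain ⟨k, hk, rfl⟩ := hx
  rw [neg_root_mem_posRoots_iff]
  exact not_not_intro hk

theorem simpleRoot_mem_posRoots (i : b.support) : P.root i ∈ posRoots b :=
  ⟨i, b.isPos_of_mem_support i.2, rfl⟩

theorem simpleReflection_apply (i : b.support) (x : M) :
    simpleReflection b i x = x - P.toLinearMap x (P.coroot i) • P.root i := rfl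

theorem simpleReflection_involutive (i : b.support) (x : M) :
    simpleReflection b i (simpleReflection b i x) = x := P.reflection_same i x

theorem simpleReflection_mul_self (i : b.support) :
    simpleReflection b i * simpleReflection b i = 1 :=
  LinearEquiv.ext (simpleReflection_involutive b i)

theorem simpleReflection_inv (i : b.support) :
    (simpleReflection b i)⁻¹ = simpleReflection b i := rfl

theorem simpleReflection_self (i : b.support) :
    simpleReflection b i (P.root i) = -P.root i := P.reflection_apply_self i

@[simp] theorem wordProd_nil : wordProd b [] = 1 := rfl

theorem wordProd_cons (i : b.support) (w : List b.support) :
    wordProd b (i :: w) = simpleReflection b i * wordProd b w := by simp [wordProd]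

theorem wordProd_append (u v : List b.support) :
    wordProd b (u ++ v) = wordProd b u * wordProd b v := by simp [wordProd]

theorem wordProd_concat (u : List b.support) (i : b.support) :
    wordProd b (u ++ [i]) = wordProd b u * simpleReflection b i := by simp [wordProd]

theorem wordProd_mem_range (w : List b.support) {x : M} (hx : x ∈ Set.range P.root) :
    wordProd b w x ∈ Set.range P.root := by
  induction w generalizing x with
  | nil => exact hx
  | cons i w ih => rw [wordProd_cons]; exact P.mapsTo_reflection_root i (ih hx)

theorem wordProd_inv (w : List b.support) : (wordProd b w)⁻¹ = wordProd b w.reverse := by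
  induction w with
  | nil => simp
  | cons i w ih =>
    rw [wordProd_cons, mul_inv_rev, ih, List.reverse_cons, wordProd_concat, simpleReflection_inv]

/-- The vector `x` is one of the roots `s_{i_1} ⋯ s_{i_{k-1}} (α_{i_k})` of the word. -/
def IsWordRoot (w : List b.support) (x : M) : Prop :=
  ∃ (u : List b.support) (i : b.support) (v : List b.support),
    w = u ++ i :: v ∧ wordProd b u (P.root i) = x

theorem wordRoot_of_eq_append (u : List b.support) (i : b.support) (v : List b.support)
    (k : Fin (u ++ i :: v).length) (hk : k.val = u.length) :
    wordRoot b (u ++ i :: v) k = wordProd b u (P.root i) := by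
  simp [wordRoot, hk]

theorem exists_wordRoot_eq_iff (w : List b.support) (x : M) :
    (∃ k, wordRoot b w k = x) ↔ IsWordRoot b w x := by
  constructor
  · rintro ⟨k, rfl⟩
    refine ⟨w.take k, w.get k, w.drop (k + 1), ?_, rfl⟩
    simp
  · rintro ⟨u, i, v, rfl, rfl⟩
    exact ⟨⟨u.length, by simp⟩, wordRoot_of_eq_append b u i v _ rfl⟩

theorem isWordRoot_concat (w : List b.support) (j : b.support) (x : M) :
    IsWordRoot b (w ++ [j]) x ↔ x = wordProd b w (P.root j) ∨ IsWordRoot b w x := by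
  constructor
  · rintro ⟨u, i, v, h, rfl⟩
    rcases List.eq_nil_or_concat' v with rfl | ⟨v, l, rfl⟩
    · obtain ⟨rfl, h⟩ := List.append_inj' h rfl
      obtain rfl : j = i := by simpa using h
      exact Or.inl rfl
    · rw [← List.cons_append, ← List.append_assoc] at h
      obtain ⟨rfl, -⟩ := List.append_inj' h rfl
      exact Or.inr ⟨u, i, v, rfl, rfl⟩
  · rintro (rfl | ⟨u, i, v, rfl, rfl⟩)
    · exact ⟨w, j, [], rfl, rfl⟩
    · exact ⟨u, i, v ++ [j], by simp, rfl⟩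

/-- All the roots of the word are positive. -/
def IsPosWord (w : List b.support) : Prop := ∀ x, IsWordRoot b w x → x ∈ posRoots b

theorem isPosWord_nil : IsPosWord b [] := by
  rintro x ⟨u, i, v, h, -⟩
  simp at h

theorem isPosWord_concat (w : List b.support) (j : b.support) :
    IsPosWord b (w ++ [j]) ↔ wordProd b w (P.root j) ∈ posRoots b ∧ IsPosWord b w := by
  simp only [IsPosWord, isWordRoot_concat]
  constructor
  · exact fun h => ⟨h _ (Or.inl rfl), fun x hx => h x (Or.inr hx)⟩
  · rintro ⟨h, h'⟩ x (rfl | hx)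
    · exact h
    · exact h' x hx

/-- The positive roots sent to negative ones by `g⁻¹`. -/
def invSet (g : M ≃ₗ[ℚ] M) : Set M := {x | x ∈ posRoots b ∧ -g⁻¹ x ∈ posRoots b}

theorem posRoots_finite [Finite ι] : (posRoots b).Finite := (Set.toFinite _).image _

theorem invSet_finite [Finite ι] (g : M ≃ₗ[ℚ] M) : (invSet b g).Finite :=
  (posRoots_finite b).subset fun _ hx => hx.1

theorem invSet_one : invSet b 1 = ∅ := by
  ext x
  simp only [invSet, Set.mem_ofPred_eq, Set.mem_empty_iff_false, iff_false, not_and]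
  exact fun hx => neg_notMem_posRoots b hx

/-- The inverse carries this vector back to a simple root, which is positive. This is what makes the
inversion set grow by exactly one when a letter is appended. -/
theorem wordRoot_notMem_invSet (w : List b.support) (i : b.support) :
    wordProd b w (P.root i) ∉ invSet b (wordProd b w) := by
  rintro ⟨-, h⟩
  rw [← LinearEquiv.mul_apply, inv_mul_cancel] at h
  exact neg_notMem_posRoots b (simpleRoot_mem_posRoots b i) h

/-- A simple reflection conjugated to another one. -/
theorem wordProd_conj (w : List b.support) (i j : b.support)
    (h : wordProd b w (P.root i) = P.root j) :
    wordProd b w * simpleReflection b i = simpleReflection b j * wordProd b w := by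
  -- Proved for all roots, because the intermediate images of a simple root need not be simple.
  have hk (w : List b.support) (k : ι) : ∃ l, wordProd b w (P.root k) = P.root l ∧
      wordProd b w * P.reflection k = P.reflection l * wordProd b w := by
    induction w with
    | nil => exact ⟨k, rfl, by simp⟩
    | cons m w ih =>
      obtain ⟨l, hl, hl'⟩ := ih
      refine ⟨P.reflectionPerm m l, ?_, ?_⟩
      · rw [wordProd_cons, LinearEquiv.mul_apply, hl, P.root_reflectionPerm]
        rfl
      · rw [wordProd_cons, mul_assoc, hl', P.reflection_reflectionPerm]
        ext x
        simp [simpleReflection]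
  obtain ⟨l, hl, hl'⟩ := hk w i
  obtain rfl : l = j := P.root.injective (hl.symm.trans h)
  exact hl'

theorem ne_zero_of_mem_range {x : M} (hx : x ∈ Set.range P.root) : x ≠ 0 := by
  obtain ⟨k, rfl⟩ := hx
  exact P.ne_zero k

/-! ### Coordinates in the basis of simple roots. -/

section Coord

variable [P.IsRootSystem]

/-- The coefficient of a simple root. -/
def simpleCoord (i : b.support) : M →ₗ[ℚ] ℚ := b.toWeightBasis.coord i

open Classical in
theorem simpleCoord_root (i j : b.support) :
    simpleCoord b i (P.root j) = if j = i then 1 else 0 := by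
  rw [simpleCoord, ← b.toWeightBasis_apply j, Module.Basis.coord_apply, Module.Basis.repr_self,
    Finsupp.single_apply]

theorem sum_simpleCoord_smul (x : M) : ∑ i, simpleCoord b i x • P.root i = x := by
  have h := b.toWeightBasis.sum_repr x
  simp only [b.toWeightBasis_apply] at h
  exact h

theorem ext_simpleCoord {x y : M} (h : ∀ i, simpleCoord b i x = simpleCoord b i y) : x = y := by
  rw [← sum_simpleCoord_smul b x, ← sum_simpleCoord_smul b y]
  exact Finset.sum_congr rfl fun i _ => by rw [h]

theorem exists_nat_simpleCoord {x : M} (hx : x ∈ posRoots b) (i : b.support) :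
    ∃ n : ℕ, simpleCoord b i x = n := by
  classical
  obtain ⟨k, hk, rfl⟩ := hx
  have hpos : 0 < b.height k := hk
  obtain ⟨f, hf, h | h⟩ := b.exists_root_eq_sum_nat_or_neg k
  · refine ⟨f i, ?_⟩
    rw [h, b.support.sum_subtype (p := (· ∈ b.support)) (by simp) (F := inferInstance), map_sum,
      Finset.sum_eq_single i]
    · simp [simpleCoord_root]
    · intro j _ hj
      simp [simpleCoord_root, hj]
    · simp
  -- A nonpositive expansion would make the height of a positive root nonpositive.
  · have h' : P.root k = ∑ j ∈ b.support, (-(f j : ℤ)) • P.root j := by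
      rw [h]; simp
    rw [RootPairing.Base.height_eq_sum h'] at hpos
    have : ∑ j ∈ b.support, (-(f j : ℤ)) ≤ 0 := Finset.sum_nonpos fun j _ => by simp
    omega

theorem simpleCoord_nonneg {x : M} (hx : x ∈ posRoots b) (i : b.support) :
    0 ≤ simpleCoord b i x := by
  obtain ⟨n, hn⟩ := exists_nat_simpleCoord b hx i
  rw [hn]
  exact n.cast_nonneg

/-- If instead `-x` were positive, every coordinate would be both ≥ 0 and ≤ 0, forcing `x = 0`. -/
theorem mem_posRoots_of_simpleCoord_nonneg {x : M} (hx : x ∈ Set.range P.root)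
    (h : ∀ i, 0 ≤ simpleCoord b i x) : x ∈ posRoots b := by
  rcases mem_posRoots_or_neg_mem b hx with h' | h'
  · exact h'
  · refine absurd (ext_simpleCoord b fun i => ?_) (ne_zero_of_mem_range hx)
    have := simpleCoord_nonneg b h' i
    rw [map_neg] at this
    rw [map_zero]
    linarith [h i]

theorem mem_posRoots_of_simpleCoord_pos {x : M} (hx : x ∈ Set.range P.root) (i : b.support)
    (h : 0 < simpleCoord b i x) : x ∈ posRoots b := by
  refine (mem_posRoots_or_neg_mem b hx).resolve_right fun h' => ?_
  have := simpleCoord_nonneg b h' i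
  rw [map_neg] at this
  linarith

/-- A map of the Weyl group sending the simple roots to negative roots sends all positive roots
to negative roots. -/
theorem neg_wordProd_mem_posRoots (w : List b.support)
    (h : ∀ i : b.support, -wordProd b w (P.root i) ∈ posRoots b) {x : M} (hx : x ∈ posRoots b) :
    -wordProd b w x ∈ posRoots b := by
  refine mem_posRoots_of_simpleCoord_nonneg b ?_ fun i => ?_
  · rw [← map_neg]
    obtain ⟨k, hk⟩ := mem_range_of_mem_posRoots b hx
    exact wordProd_mem_range b w (P.neg_mem_range_root_iff.2 ⟨k, hk⟩)
  · rw [← sum_simpleCoord_smul b x, map_sum, ← Finset.sum_neg_distrib, map_sum]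
    refine Finset.sum_nonneg fun j _ => ?_
    rw [map_smul, ← smul_neg, map_smul, smul_eq_mul]
    exact mul_nonneg (simpleCoord_nonneg b hx j) (simpleCoord_nonneg b (h j) i)

theorem invSet_eq_posRoots (w : List b.support)
    (h : ∀ i : b.support, -wordProd b w (P.root i) ∈ posRoots b) :
    invSet b (wordProd b w) = posRoots b := by
  refine Set.Subset.antisymm (fun x hx => hx.1) fun x hx => ⟨hx, ?_⟩
  have hr : (wordProd b w)⁻¹ x ∈ Set.range P.root := by
    rw [wordProd_inv]
    exact wordProd_mem_range b _ (mem_range_of_mem_posRoots b hx)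
  refine (mem_posRoots_or_neg_mem b hr).resolve_left fun h' => ?_
  have := neg_wordProd_mem_posRoots b w h h'
  rw [← LinearEquiv.mul_apply, mul_inv_cancel] at this
  exact neg_notMem_posRoots b hx this

end Coord

/-! ### Inversion sets, reduced words and longest words. -/

variable [Finite ι] [P.IsCrystallographic] [P.IsReduced]

theorem simpleReflection_mem_posRoots (i : b.support) {x : M} (hx : x ∈ posRoots b)
    (hxi : x ≠ P.root i) : simpleReflection b i x ∈ posRoots b := by
  obtain ⟨k, hk, rfl⟩ := hx
  have hki : k ≠ i := fun h => hxi (by rw [h])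
  exact ⟨P.reflectionPerm i k, RootPairing.Base.IsPos.reflectionPerm hk i.2 hki,
    P.root_reflectionPerm i k⟩

/-- Since `s_i` permutes the positive roots other than `α_i`, only the root `w α_i` can become a new
inversion. -/
theorem invSet_mul_subset (w : List b.support) (i : b.support) :
    invSet b (wordProd b w * simpleReflection b i) ⊆
      insert (wordProd b w (P.root i)) (invSet b (wordProd b w)) := by
  rintro x ⟨hx, hx'⟩
  rw [mul_inv_rev, LinearEquiv.mul_apply, simpleReflection_inv] at hx'
  set y := (wordProd b w)⁻¹ x with hy
  have hxy : x = wordProd b w y := by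
    rw [hy, ← LinearEquiv.mul_apply, mul_inv_cancel]; rfl
  have hyr : y ∈ Set.range P.root := by
    rw [hy, wordProd_inv]
    exact wordProd_mem_range b _ (mem_range_of_mem_posRoots b hx)
  rcases mem_posRoots_or_neg_mem b hyr with h | h
  · left
    by_contra hne
    refine neg_notMem_posRoots b (simpleReflection_mem_posRoots b i h ?_) hx'
    rintro h
    exact hne (by rw [hxy, h])
  · exact Or.inr ⟨hx, h⟩

theorem invSet_mul (w : List b.support) (i : b.support)
    (hi : wordProd b w (P.root i) ∈ posRoots b) :
    invSet b (wordProd b w * simpleReflection b i) =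
      insert (wordProd b w (P.root i)) (invSet b (wordProd b w)) := by
  refine (invSet_mul_subset b w i).antisymm ?_
  have key (y : M) : (wordProd b w * simpleReflection b i)⁻¹ (wordProd b w y)
      = simpleReflection b i y := by
    rw [mul_inv_rev, LinearEquiv.mul_apply, simpleReflection_inv, ← LinearEquiv.mul_apply _⁻¹,
      inv_mul_cancel]
    rfl
  rintro x (rfl | ⟨hx, hx'⟩)
  · refine ⟨hi, ?_⟩
    rw [key, simpleReflection_self, neg_neg]
    exact simpleRoot_mem_posRoots b i
  · refine ⟨hx, ?_⟩
    have hxy : x = wordProd b w ((wordProd b w)⁻¹ x) := by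
      rw [← LinearEquiv.mul_apply, mul_inv_cancel]; rfl
    rw [hxy, key, ← map_neg]
    refine simpleReflection_mem_posRoots b i hx' fun h => ?_
    have : x = -wordProd b w (P.root i) := by rw [hxy, ← h]; simp
    exact neg_notMem_posRoots b hi (this ▸ hx)

theorem ncard_invSet_le (w : List b.support) :
    (invSet b (wordProd b w)).ncard ≤ w.length := by
  induction w using List.reverseRecOn with
  | nil => simp [invSet_one]
  | append_singleton w i ih =>
    rw [wordProd_concat]
    calc _ ≤ _ := Set.ncard_le_ncard (invSet_mul_subset b w i) ((invSet_finite b _).insert _)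
      _ ≤ _ := Set.ncard_insert_le _ _
      _ ≤ _ := by simpa using ih

theorem IsPosWord.mem_invSet_iff {w : List b.support} (hw : IsPosWord b w) (x : M) :
    x ∈ invSet b (wordProd b w) ↔ IsWordRoot b w x := by
  induction w using List.reverseRecOn with
  | nil =>
    simp only [wordProd_nil, invSet_one, Set.mem_empty_iff_false, false_iff]
    rintro ⟨u, i, v, h, -⟩
    simp at h
  | append_singleton w i ih =>
    rw [isPosWord_concat] at hw
    rw [wordProd_concat, invSet_mul b w i hw.1, Set.mem_insert_iff, ih hw.2, isWordRoot_concat]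

theorem IsPosWord.ncard_invSet {w : List b.support} (hw : IsPosWord b w) :
    (invSet b (wordProd b w)).ncard = w.length := by
  induction w using List.reverseRecOn with
  | nil => simp [invSet_one]
  | append_singleton w i ih =>
    rw [isPosWord_concat] at hw
    rw [wordProd_concat, invSet_mul b w i hw.1,
      Set.ncard_insert_of_notMem (wordRoot_notMem_invSet b w i) (invSet_finite b _), ih hw.2]
    simp

theorem IsPosWord.isReducedWord {w : List b.support} (hw : IsPosWord b w) :
    IsReducedWord b w := by
  intro w' h
  rw [← hw.ncard_invSet, ← h]
  exact ncard_invSet_le b w'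

/-- The deletion condition: a word with a non-positive root can be shortened by two letters without
changing its product. -/
theorem IsReducedWord.isPosWord {w : List b.support} (hw : IsReducedWord b w) :
    IsPosWord b w := by
  by_contra hneg
  have key : ∀ w : List b.support, ¬ IsPosWord b w →
      ∃ w', wordProd b w' = wordProd b w ∧ w'.length < w.length := by
    intro w
    induction w using List.reverseRecOn with
    | nil => exact fun h => absurd (isPosWord_nil b) h
    | append_singleton w i ih =>
      intro h
      by_cases hpos : IsPosWord b w
      · have hi : wordProd b w (P.root i) ∉ posRoots b := fun h' =>
          h ((isPosWord_concat b w i).2 ⟨h', hpos⟩)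
        have hi' := (mem_posRoots_or_neg_mem b
          (wordProd_mem_range b w ⟨(i : ι), rfl⟩)).resolve_left hi
        -- The prefix `w` has positive roots but `w α_i` is negative. Then `-w α_i` is an inversion
        -- of `w`, hence one of its roots `u α_j` with `w = u j v`. It follows that `v α_i = α_j`
        -- and `s_j v s_i = v`, so the letters `j` and `i` can both be deleted.
        have hmem : -wordProd b w (P.root i) ∈ invSet b (wordProd b w) := by
          refine ⟨hi', ?_⟩
          rw [map_neg, neg_neg, ← LinearEquiv.mul_apply, inv_mul_cancel]
          exact simpleRoot_mem_posRoots b i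
        obtain ⟨u, j, v, rfl, hj⟩ := (hpos.mem_invSet_iff b _).1 hmem
        have hv : wordProd b v (P.root i) = P.root j := by
          rw [wordProd_append, wordProd_cons, LinearEquiv.mul_apply, LinearEquiv.mul_apply,
            ← map_neg, (wordProd b u).injective.eq_iff, ← map_neg] at hj
          have := congrArg (simpleReflection b j) hj
          rw [simpleReflection_self, simpleReflection_involutive, neg_inj] at this
          exact this.symm
        refine ⟨u ++ v, ?_, by simp⟩
        rw [wordProd_concat, wordProd_append, wordProd_append, wordProd_cons, mul_assoc, mul_assoc,
          wordProd_conj b v i j hv, ← mul_assoc (simpleReflection b j), simpleReflection_mul_self,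
          one_mul]
      · obtain ⟨w', h1, h2⟩ := ih hpos
        refine ⟨w' ++ [i], by rw [wordProd_concat, wordProd_concat, h1], by simpa using h2⟩
  obtain ⟨w', h1, h2⟩ := key w hneg
  exact absurd (hw w' h1) (by omega)

/-- By counting: the roots of the word form the inversion set, which has as many elements as the
word has letters. -/
theorem IsPosWord.wordRoot_injective {w : List b.support} (hw : IsPosWord b w) :
    Function.Injective (wordRoot b w) := by
  have h : (wordRoot b w '' Set.univ).ncard = (Set.univ : Set (Fin w.length)).ncard := by
    rw [Set.ncard_univ, Nat.card_fin]
    refine Eq.trans ?_ hw.ncard_invSet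
    congr 1
    ext x
    rw [hw.mem_invSet_iff, ← exists_wordRoot_eq_iff]
    simp
  exact Set.injOn_univ.1 (Set.injOn_of_ncard_image_eq h)

theorem IsLongestWord.isPosWord {w : List b.support} (hw : IsLongestWord b w) :
    IsPosWord b w := hw.1.isPosWord

/-- Otherwise appending `i` would give a longer word with positive roots, which is reduced. -/
theorem IsLongestWord.neg_simpleRoot {w : List b.support} (hw : IsLongestWord b w)
    (i : b.support) : -wordProd b w (P.root i) ∈ posRoots b := by
  refine (mem_posRoots_or_neg_mem b (wordProd_mem_range b w ⟨(i : ι), rfl⟩)).resolve_left fun h => ?_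
  have h' : IsPosWord b (w ++ [i]) := (isPosWord_concat b w i).2 ⟨h, hw.isPosWord⟩
  have := hw.2 _ (h'.isReducedWord)
  simp at this

section Longest

variable [P.IsRootSystem]

theorem IsLongestWord.isWordRoot_iff {w : List b.support} (hw : IsLongestWord b w) (x : M) :
    IsWordRoot b w x ↔ x ∈ posRoots b := by
  rw [← hw.isPosWord.mem_invSet_iff, invSet_eq_posRoots b w hw.neg_simpleRoot]

theorem IsPosWord.isLongestWord {w : List b.support} (hw : IsPosWord b w)
    (h : ∀ i : b.support, -wordProd b w (P.root i) ∈ posRoots b) : IsLongestWord b w := by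
  refine ⟨hw.isReducedWord, fun w' hw' => ?_⟩
  rw [← hw.ncard_invSet, ← hw'.isPosWord.ncard_invSet, invSet_eq_posRoots b w h]
  exact Set.ncard_le_ncard (fun x hx => hx.1) (posRoots_finite b)

end Longest

end Words

/-! ## Height functions and adapted words -/

section Heights

variable {ι M N : Type*} [AddCommGroup M] [Module ℚ M] [AddCommGroup N] [Module ℚ N]
variable {P : RootPairing ι ℚ M N} (b : P.Base)

/-- The non-negative off-diagonal entry `-⟨h_k, α_i⟩` of the Cartan matrix (`0` for `k = i`). -/
def meshCoeff (i k : b.support) : ℚ :=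
  open Classical in if k = i then 0 else -P.pairing i k

theorem fundWeight_coroot_self [P.IsRootSystem] (i : b.support) :
    P.toLinearMap (fundWeight b i) (P.coroot i) = 1 := by simp [fundWeight_coroot]

/-- The simple coroots form a basis of `N`, and the pairing is perfect. -/
theorem ext_coroot [P.IsRootSystem] {x y : M}
    (h : ∀ j : b.support, P.toLinearMap x (P.coroot j) = P.toLinearMap y (P.coroot j)) :
    x = y := by
  apply P.toPerfPair.injective
  refine b.toCoweightBasis.ext fun j => ?_
  rw [b.toCoweightBasis_apply]
  exact h j

theorem root_eq_fundWeight [P.IsRootSystem] (i : b.support) :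
    P.root i = (2 : ℚ) • fundWeight b i - ∑ k, meshCoeff b i k • fundWeight b k := by
  classical
  refine ext_coroot b fun j => ?_
  rw [P.root_coroot_eq_pairing, map_sub, map_smul, map_sum, LinearMap.sub_apply,
    LinearMap.smul_apply, LinearMap.sum_apply, Finset.sum_eq_single j]
  · rw [map_smul, LinearMap.smul_apply, fundWeight_coroot_self, fundWeight_coroot, meshCoeff]
    split_ifs with h
    · rw [h]; simp
    · simp
  · intro k _ hk
    rw [map_smul, LinearMap.smul_apply, fundWeight_coroot, if_neg hk.symm, smul_zero]
  · simp

open Classical in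
theorem simpleReflection_fundWeight [P.IsRootSystem] (i j : b.support) :
    simpleReflection b i (fundWeight b j) = fundWeight b j - if i = j then P.root i else 0 := by
  rw [simpleReflection_apply, fundWeight_coroot]
  split_ifs <;> simp

theorem wordProd_fundWeight_of_notMem [P.IsRootSystem] {w : List b.support} {j : b.support}
    (h : j ∉ w) : wordProd b w (fundWeight b j) = fundWeight b j := by
  induction w with
  | nil => rfl
  | cons i w ih =>
    rw [List.mem_cons, not_or] at h
    rw [wordProd_cons, LinearEquiv.mul_apply, ih h.2, simpleReflection_fundWeight,
      if_neg (Ne.symm h.1), sub_zero]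

theorem simpleCoord_wordProd_of_notMem [P.IsRootSystem] {w : List b.support} {j : b.support}
    (h : j ∉ w) (x : M) : simpleCoord b j (wordProd b w x) = simpleCoord b j x := by
  induction w with
  | nil => rfl
  | cons i w ih =>
    rw [List.mem_cons, not_or] at h
    rw [wordProd_cons, LinearEquiv.mul_apply, simpleReflection_apply, map_sub, map_smul,
      simpleCoord_root, if_neg (Ne.symm h.1), smul_zero, sub_zero, ih h.2]

variable {b}

/-- A function on the vertices taking adjacent values at adjacent vertices. -/
def IsHeight (ξ : b.support → ℤ) : Prop := ∀ i j, Adjacent b i j → |ξ i - ξ j| = 1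

theorem IsHeight.cases {ξ : b.support → ℤ} (hξ : IsHeight ξ) {i j : b.support}
    (h : Adjacent b i j) : ξ j = ξ i + 1 ∨ ξ j = ξ i - 1 := by
  have := hξ i j h
  rcases abs_eq (zero_le_one) |>.1 this with h | h <;> omega

theorem DynkinQuiver.isHeight (Q : DynkinQuiver b) : IsHeight Q.height := Q.abs_sub_eq_one

/-- The height function obtained after reflecting at the letters of a word. -/
def heightAfter (ξ : b.support → ℤ) (w : List b.support) : b.support → ℤ :=
  w.foldl reflectHeight ξ

@[simp] theorem heightAfter_nil (ξ : b.support → ℤ) : heightAfter ξ [] = ξ := rfl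

theorem heightAfter_cons (ξ : b.support → ℤ) (i : b.support) (w : List b.support) :
    heightAfter ξ (i :: w) = heightAfter (reflectHeight ξ i) w := rfl

theorem heightAfter_append (ξ : b.support → ℤ) (u v : List b.support) :
    heightAfter ξ (u ++ v) = heightAfter (heightAfter ξ u) v := List.foldl_append

theorem heightAfter_concat (ξ : b.support → ℤ) (u : List b.support) (i : b.support) :
    heightAfter ξ (u ++ [i]) = reflectHeight (heightAfter ξ u) i := by
  rw [heightAfter_append]; rfl

theorem reflectHeight_self (ξ : b.support → ℤ) (i : b.support) :
    reflectHeight ξ i i = ξ i - 2 := by simp [reflectHeight]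

theorem reflectHeight_of_ne (ξ : b.support → ℤ) {i j : b.support} (h : j ≠ i) :
    reflectHeight ξ i j = ξ j := by simp [reflectHeight, h]

open Classical in
theorem heightAfter_apply (ξ : b.support → ℤ) (w : List b.support) (j : b.support) :
    heightAfter ξ w j = ξ j - 2 * w.count j := by
  induction w generalizing ξ with
  | nil => simp
  | cons i w ih =>
    rw [heightAfter_cons, ih, List.count_cons]
    by_cases h : j = i
    · subst h
      rw [reflectHeight_self]
      simp
      ring
    · rw [reflectHeight_of_ne _ h]
      simp [Ne.symm h]

theorem heightAfter_le (ξ : b.support → ℤ) (w : List b.support) (j : b.support) :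
    heightAfter ξ w j ≤ ξ j := by
  classical
  rw [heightAfter_apply]; omega

theorem heightAfter_of_notMem (ξ : b.support → ℤ) {w : List b.support} {j : b.support}
    (h : j ∉ w) : heightAfter ξ w j = ξ j := by
  classical
  rw [heightAfter_apply, List.count_eq_zero_of_not_mem h]; simp

theorem isAdapted_append (ξ : b.support → ℤ) (u v : List b.support) :
    IsAdapted ξ (u ++ v) ↔ IsAdapted ξ u ∧ IsAdapted (heightAfter ξ u) v := by
  induction u generalizing ξ with
  | nil => simp [IsAdapted]
  | cons i u ih => simp [IsAdapted, ih, heightAfter_cons, and_assoc]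

theorem adjacent_ne {i j : b.support} (h : Adjacent b i j) : i ≠ j := by
  rintro rfl
  have : P.pairing i i < 0 := h
  rw [P.pairing_same] at this
  norm_num at this

section Finite

variable [Finite ι] [P.IsCrystallographic]

theorem adjacent_symm {i j : b.support} (h : Adjacent b i j) : Adjacent b j i := by
  have := P.pairingIn_lt_zero_iff ℤ (i := j) (j := i)
  unfold Adjacent at h ⊢
  rw [← P.algebraMap_pairingIn ℤ] at h ⊢
  simp only [algebraMap_int_eq, eq_intCast, Int.cast_lt_zero] at h ⊢
  exact this.1 h

theorem pairing_nonpos_of_ne {i j : b.support} (h : i ≠ j) : P.pairing i j ≤ 0 := by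
  have := b.pairingIn_le_zero_of_ne (fun e => h (Subtype.ext e)) i.2 j.2
  rw [← P.algebraMap_pairingIn ℤ]
  simpa using this

theorem meshCoeff_nonneg (i k : b.support) : 0 ≤ meshCoeff b i k := by
  unfold meshCoeff
  split_ifs with h
  · exact le_rfl
  · exact neg_nonneg.2 (pairing_nonpos_of_ne (Ne.symm h))

theorem meshCoeff_pos_iff (i k : b.support) : 0 < meshCoeff b i k ↔ Adjacent b i k := by
  constructor
  · intro h
    refine adjacent_symm ?_
    unfold meshCoeff at h
    split_ifs at h with h'
    · exact absurd h (lt_irrefl _)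
    · exact neg_pos.1 h
  · intro h
    have := adjacent_symm h
    rw [meshCoeff, if_neg (adjacent_ne this)]
    exact neg_pos.2 this

theorem meshCoeff_eq_zero {i k : b.support} (h : ¬ Adjacent b i k) : meshCoeff b i k = 0 := by
  rw [← meshCoeff_pos_iff] at h
  exact le_antisymm (not_lt.1 h) (meshCoeff_nonneg i k)

/-- Two sums over the neighbours agree if the neighbours' terms agree. -/
theorem sum_meshCoeff_congr {V : Type*} [AddCommGroup V] [Module ℚ V] (i : b.support)
    {f g : b.support → V} (h : ∀ k, Adjacent b i k → f k = g k) :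
    ∑ k, meshCoeff b i k • f k = ∑ k, meshCoeff b i k • g k := by
  refine Finset.sum_congr rfl fun k _ => ?_
  by_cases hk : Adjacent b i k
  · rw [h k hk]
  · rw [meshCoeff_eq_zero hk, zero_smul, zero_smul]

/-- All neighbours of a source lie exactly one below it, so after lowering it by two they lie
exactly one above. -/
theorem IsHeight.reflectHeight {ξ : b.support → ℤ} (hξ : IsHeight ξ) {i : b.support}
    (hi : IsSource ξ i) : IsHeight (reflectHeight ξ i) := by
  intro j k hjk
  by_cases hj : j = i
  · subst hj
    rw [reflectHeight_self, reflectHeight_of_ne _ (adjacent_ne hjk).symm]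
    have h1 := hi k hjk
    have h2 := hξ.cases hjk
    have : ξ j - 2 - ξ k = -1 := by omega
    rw [this]; rfl
  · rw [reflectHeight_of_ne _ hj]
    by_cases hk : k = i
    · subst hk
      rw [reflectHeight_self]
      have h1 := hi j (adjacent_symm hjk)
      have h2 := hξ.cases hjk
      have : ξ j - (ξ k - 2) = 1 := by omega
      rw [this]; rfl
    · rw [reflectHeight_of_ne _ hk]
      exact hξ j k hjk

theorem IsHeight.heightAfter {ξ : b.support → ℤ} (hξ : IsHeight ξ) {w : List b.support}
    (hw : IsAdapted ξ w) : IsHeight (heightAfter ξ w) := by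
  induction w generalizing ξ with
  | nil => exact hξ
  | cons i w ih => exact ih (hξ.reflectHeight hw.1) hw.2

end Finite

end Heights

/-! ## Weights and roots of the repetition quiver -/

namespace DynkinQuiver

variable {ι M N : Type*} [AddCommGroup M] [Module ℚ M] [AddCommGroup N] [Module ℚ N]
variable {P : RootPairing ι ℚ M N} {b : P.Base} (Q : DynkinQuiver b)

theorem even_heightAfter_sub (w : List b.support) (j : b.support) :
    Even (heightAfter Q.height w j - Q.height j) := by
  classical
  rw [heightAfter_apply]
  exact ⟨-(w.count j : ℤ), by ring⟩

theorem exists_coxeter_eq (j : b.support) : ∃ u v : List b.support, j ∉ u ∧ j ∉ v ∧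
    IsAdapted Q.height (u ++ j :: v) ∧ Q.coxeter = wordProd b (u ++ j :: v) := by
  obtain ⟨hnd, hmem, had⟩ := Q.exists_isCoxeterWord.choose_spec
  rw [coxeter]
  set w := Q.exists_isCoxeterWord.choose
  obtain ⟨u, v, hw⟩ := List.append_of_mem (hmem j)
  rw [hw] at hnd had ⊢
  exact ⟨u, v, fun h => (List.disjoint_of_nodup_append hnd) h (by simp),
    (List.nodup_cons.1 (List.nodup_append.1 hnd).2.1).1, had, rfl⟩

theorem coxeter_zpow_mem_range (n : ℤ) {x : M} (hx : x ∈ Set.range P.root) :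
    (Q.coxeter ^ n) x ∈ Set.range P.root := by
  induction n generalizing x with
  | zero => exact hx
  | succ n ih =>
    rw [zpow_add_one, LinearEquiv.mul_apply]
    exact ih (wordProd_mem_range b _ hx)
  | pred n ih =>
    rw [zpow_sub_one, LinearEquiv.mul_apply]
    refine ih ?_
    rw [coxeter, wordProd_inv]
    exact wordProd_mem_range b _ hx

variable [P.IsRootSystem]

/-- The weight `τ_Q^{(ξ_j - p)/2} ϖ_j`. -/
def weightAt (j : b.support) (p : ℤ) : M :=
  (Q.coxeter ^ ((Q.height j - p) / 2)) (fundWeight b j)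

/-- The root `τ_Q^{(ξ_j - p)/2} γ_j` at the vertex `(j,p)`. -/
def rootAt (j : b.support) (p : ℤ) : M := Q.weightAt j p - Q.weightAt j (p - 2)

theorem weightAt_height (j : b.support) : Q.weightAt j (Q.height j) = fundWeight b j := by
  simp [weightAt]

/-- No parity condition on `p` is needed: a shift by an even number commutes with the floor in the
exponent. -/
theorem coxeter_zpow_weightAt (n : ℤ) (j : b.support) (p : ℤ) :
    (Q.coxeter ^ n) (Q.weightAt j p) = Q.weightAt j (p - 2 * n) := by
  rw [weightAt, weightAt, ← LinearEquiv.mul_apply, ← zpow_add]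
  congr 3
  omega

theorem coxeter_weightAt (j : b.support) (p : ℤ) :
    Q.coxeter (Q.weightAt j p) = Q.weightAt j (p - 2) := by
  simpa using Q.coxeter_zpow_weightAt 1 j p

theorem coxeter_zpow_rootAt (n : ℤ) (j : b.support) (p : ℤ) :
    (Q.coxeter ^ n) (Q.rootAt j p) = Q.rootAt j (p - 2 * n) := by
  rw [rootAt, rootAt, map_sub, coxeter_zpow_weightAt, coxeter_zpow_weightAt]
  congr 2
  ring

theorem coxeter_rootAt (j : b.support) (p : ℤ) :
    Q.coxeter (Q.rootAt j p) = Q.rootAt j (p - 2) := by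
  simpa using Q.coxeter_zpow_rootAt 1 j p

theorem rootAt_height (j : b.support) : Q.rootAt j (Q.height j) = Q.gamma j := by
  rw [rootAt, ← coxeter_weightAt, weightAt_height]
  rfl

theorem rootAt_eq_zpow_gamma (j : b.support) {p : ℤ} (hp : Even (p - Q.height j)) :
    Q.rootAt j p = (Q.coxeter ^ ((Q.height j - p) / 2)) (Q.gamma j) := by
  obtain ⟨m, hm⟩ := hp
  rw [← rootAt_height, coxeter_zpow_rootAt]
  congr 1
  omega

variable [Finite ι] [P.IsCrystallographic]

/-- Write τ_Q = u s_i v with `i` in neither `u` nor `v`. Then ϖ_i = u ϖ_i and τ_Q ϖ_i = u(ϖ_i -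
α_i), and 2ϖ_i - α_i is a sum over the neighbours. For a neighbour `k`, u ϖ_k is τ_Q ϖ_k if `k` lies
in `u`, and ϖ_k otherwise. Adaptedness puts exactly the higher neighbours in `u`. -/
theorem fundWeight_add_coxeter (i : b.support) :
    fundWeight b i + Q.coxeter (fundWeight b i) =
      ∑ k, meshCoeff b i k • if Q.height k = Q.height i + 1 then Q.coxeter (fundWeight b k)
        else fundWeight b k := by
  obtain ⟨hnd, hmem, had⟩ := Q.exists_isCoxeterWord.choose_spec
  rw [coxeter]
  set w := Q.exists_isCoxeterWord.choose
  obtain ⟨u, v, hw⟩ := List.append_of_mem (hmem i)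
  rw [hw] at hnd had ⊢
  have hiu : i ∉ u := fun h => (List.disjoint_of_nodup_append hnd) h (by simp)
  have hiv : i ∉ v := (List.nodup_cons.1 (List.nodup_append.1 hnd).2.1).1
  have h1 : wordProd b (u ++ i :: v) (fundWeight b i) =
      wordProd b u (fundWeight b i - P.root i) := by
    rw [wordProd_append, wordProd_cons, LinearEquiv.mul_apply, LinearEquiv.mul_apply,
      wordProd_fundWeight_of_notMem b hiv, simpleReflection_fundWeight, if_pos rfl]
  have h2 : fundWeight b i = wordProd b u (fundWeight b i) :=
    (wordProd_fundWeight_of_notMem b hiu).symm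
  rw [h1]
  nth_rewrite 1 [h2]
  rw [← map_add]
  have h3 : fundWeight b i + (fundWeight b i - P.root i) =
      ∑ k, meshCoeff b i k • fundWeight b k := by
    rw [root_eq_fundWeight]
    module
  rw [h3, map_sum]
  simp only [map_smul]
  refine sum_meshCoeff_congr i fun k hk => ?_
  rw [isAdapted_append] at had
  have hsrc := had.2.1 k hk
  rw [heightAfter_of_notMem _ hiu] at hsrc
  split_ifs with hki
  · have hku : k ∈ u := by
      by_contra h
      rw [heightAfter_of_notMem _ h] at hsrc
      omega
    rw [wordProd_append, LinearEquiv.mul_apply]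
    congr 1
    rw [wordProd_fundWeight_of_notMem]
    exact fun h => (List.disjoint_of_nodup_append hnd) hku h
  · refine wordProd_fundWeight_of_notMem b fun hku => ?_
    -- A lower neighbour occurring in `u` would have to be a source above `i` at that moment,
    -- although its height can only have decreased while that of `i` is unchanged.
    obtain ⟨u₁, u₂, rfl⟩ := List.append_of_mem hku
    rw [isAdapted_append] at had
    have hs := had.1.2.1 i (adjacent_symm hk)
    have hn1 : i ∉ u₁ := fun h => hiu (by simp [h])
    have := heightAfter_le Q.height u₁ k
    rw [heightAfter_of_notMem _ hn1] at hs
    have := Q.isHeight.cases hk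
    omega

/-- The mesh relation for weights. -/
theorem weightAt_mesh (i : b.support) (p : ℤ) (hp : Odd (p - Q.height i)) :
    Q.weightAt i (p + 1) + Q.weightAt i (p - 1) = ∑ k, meshCoeff b i k • Q.weightAt k p := by
  obtain ⟨m, hm⟩ := hp
  -- As p + 1 = ξ_i + 2(m + 1), this power of τ_Q moves the relation at ξ_i to the mesh with upper
  -- end p + 1.
  have h := congrArg (Q.coxeter ^ (-(m + 1))) (Q.fundWeight_add_coxeter i)
  rw [map_add, map_sum, ← weightAt_height, coxeter_weightAt, coxeter_zpow_weightAt,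
    coxeter_zpow_weightAt] at h
  have e1 : Q.height i - 2 * -(m + 1) = p + 1 := by omega
  have e2 : Q.height i - 2 - 2 * -(m + 1) = p - 1 := by omega
  rw [e1, e2] at h
  rw [h]
  simp only [map_smul]
  refine sum_meshCoeff_congr i fun k hk => ?_
  rcases Q.isHeight.cases hk with h | h
  · rw [if_pos h, ← weightAt_height, coxeter_weightAt, coxeter_zpow_weightAt]
    congr 1
    omega
  · rw [if_neg (by omega), ← weightAt_height, coxeter_zpow_weightAt]
    congr 1
    omega

/-- The mesh relation for roots. -/
theorem rootAt_mesh (i : b.support) (p : ℤ) (hp : Odd (p - Q.height i)) :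
    Q.rootAt i (p + 1) + Q.rootAt i (p - 1) = ∑ k, meshCoeff b i k • Q.rootAt k p := by
  have h1 := Q.weightAt_mesh i p hp
  have h2 := Q.weightAt_mesh i (p - 2) (by
    obtain ⟨m, hm⟩ := hp
    exact ⟨m - 1, by omega⟩)
  simp only [rootAt, smul_sub, Finset.sum_sub_distrib]
  rw [← h1, ← h2]
  have e1 : p + 1 - 2 = p - 2 + 1 := by ring
  have e2 : p - 1 - 2 = p - 2 - 1 := by ring
  rw [e1, e2]
  abel

/-- Induction on the last letter. Reflecting at a source `i` of current height p replaces ϖ_i by a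
sum over neighbours minus ϖ_i. The neighbours of a source all have height p - 1, so the mesh
relation identifies the image with the weight at (i, p - 2). -/
theorem wordProd_fundWeight {w : List b.support} (hw : IsAdapted Q.height w) (j : b.support) :
    wordProd b w (fundWeight b j) = Q.weightAt j (heightAfter Q.height w j) := by
  induction w using List.reverseRecOn generalizing j with
  | nil => simp [weightAt_height]
  | append_singleton w i ih =>
    rw [isAdapted_append] at hw
    have hh := Q.isHeight.heightAfter hw.1
    rw [wordProd_concat, LinearEquiv.mul_apply, simpleReflection_fundWeight, heightAfter_concat]
    split_ifs with hij
    · subst hij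
      rw [reflectHeight_self, root_eq_fundWeight]
      set p := heightAfter Q.height w i with hp
      have hmesh := Q.weightAt_mesh i (p - 1) (by
        obtain ⟨m, hm⟩ := Q.even_heightAfter_sub w i
        exact ⟨m - 1, by omega⟩)
      rw [sub_add_cancel, sub_sub, one_add_one_eq_two, ← eq_sub_iff_add_eq'] at hmesh
      have e : fundWeight b i - ((2 : ℚ) • fundWeight b i - ∑ k, meshCoeff b i k • fundWeight b k)
          = ∑ k, meshCoeff b i k • fundWeight b k - fundWeight b i := by module
      rw [hmesh, e, map_sub, ih hw.1, map_sum]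
      congr 1
      simp only [map_smul]
      refine sum_meshCoeff_congr i fun k hk => ?_
      rw [ih hw.1]
      congr 1
      have := hw.2.1 k hk
      have := hh.cases hk
      omega
    · rw [sub_zero, ih hw.1, reflectHeight_of_ne _ (Ne.symm hij)]

theorem wordProd_root {w : List b.support} {i : b.support}
    (hw : IsAdapted Q.height (w ++ [i])) :
    wordProd b w (P.root i) = Q.rootAt i (heightAfter Q.height w i) := by
  have h1 := Q.wordProd_fundWeight hw i
  have h2 := Q.wordProd_fundWeight ((isAdapted_append _ _ _).1 hw).1 i
  rw [wordProd_concat, LinearEquiv.mul_apply, simpleReflection_fundWeight, if_pos rfl,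
    heightAfter_concat, reflectHeight_self, map_sub, h2] at h1
  rw [rootAt, ← h1]
  abel

/-- In (1 - τ_Q)ϖ_j the mesh relation cancels the lower neighbours. The result is a recursion
descending from the highest vertices. -/
theorem gamma_eq (j : b.support) :
    Q.gamma j = P.root j +
      ∑ k, meshCoeff b j k • if Q.height k = Q.height j + 1 then Q.gamma k else 0 := by
  have h := Q.fundWeight_add_coxeter j
  rw [← eq_sub_iff_add_eq'] at h
  rw [gamma, h, root_eq_fundWeight]
  have e : ∀ k, (if Q.height k = Q.height j + 1 then Q.gamma k else 0) =
      fundWeight b k - if Q.height k = Q.height j + 1 then Q.coxeter (fundWeight b k)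
        else fundWeight b k := by
    intro k
    split_ifs
    · rfl
    · rw [sub_self]
  simp only [e, smul_sub, Finset.sum_sub_distrib]
  module

theorem gamma_eq_wordProd {u v : List b.support} {j : b.support} (hu : j ∉ u)
    (had : IsAdapted Q.height (u ++ j :: v)) : Q.gamma j = wordProd b u (P.root j) := by
  rw [← List.singleton_append, ← List.append_assoc, isAdapted_append] at had
  rw [Q.wordProd_root had.1, heightAfter_of_notMem _ hu, rootAt_height]

/-- γ_j = u α_j with `j` not in `u`, so the coefficient of α_j is still 1, and one positive
coefficient makes a root positive. -/
theorem gamma_mem_posRoots (j : b.support) : Q.gamma j ∈ posRoots b := by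
  obtain ⟨u, v, hu, -, had, -⟩ := Q.exists_coxeter_eq j
  rw [Q.gamma_eq_wordProd hu had]
  refine mem_posRoots_of_simpleCoord_pos b (wordProd_mem_range b u ⟨(j : ι), rfl⟩) j ?_
  rw [simpleCoord_wordProd_of_notMem b hu, simpleCoord_root, if_pos rfl]
  exact one_pos

theorem rootAt_mem_range (j : b.support) {p : ℤ} (hp : Even (p - Q.height j)) :
    Q.rootAt j p ∈ Set.range P.root := by
  rw [Q.rootAt_eq_zpow_gamma j hp]
  exact Q.coxeter_zpow_mem_range _ (mem_range_of_mem_posRoots b (Q.gamma_mem_posRoots j))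

/-- Here τ_Q⁻¹ γ_j = v⁻¹ s_j α_j = -v⁻¹ α_j with `j` not in `v`, so the coefficient of α_j is -1.
Hence φ_Q leaves level 0 immediately above (j, ξ_j). -/
theorem neg_rootAt_height_add_two (j : b.support) :
    -Q.rootAt j (Q.height j + 2) ∈ posRoots b := by
  obtain ⟨u, v, hu, hv, had, hc⟩ := Q.exists_coxeter_eq j
  have h : Q.rootAt j (Q.height j + 2) = Q.coxeter⁻¹ (Q.gamma j) := by
    rw [← rootAt_height, ← zpow_neg_one, coxeter_zpow_rootAt]
    simp
  rw [h, Q.gamma_eq_wordProd hu had, hc, wordProd_append, wordProd_cons, mul_inv_rev, mul_inv_rev,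
    LinearEquiv.mul_apply, ← LinearEquiv.mul_apply _⁻¹, inv_mul_cancel, simpleReflection_inv,
    LinearEquiv.mul_apply]
  change -((wordProd b v)⁻¹ (simpleReflection b j (P.root j))) ∈ _
  rw [simpleReflection_self, map_neg, neg_neg, wordProd_inv]
  refine mem_posRoots_of_simpleCoord_pos b (wordProd_mem_range b _ ⟨(j : ι), rfl⟩) j ?_
  rw [simpleCoord_wordProd_of_notMem b (by simpa using hv), simpleCoord_root, if_pos rfl]
  exact one_pos

end DynkinQuiver

/-! ## The invariant form -/

section Form

variable {ι M N : Type*} [AddCommGroup M] [Module ℚ M] [AddCommGroup N] [Module ℚ N]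
variable {P : RootPairing ι ℚ M N} (b : P.Base) [Fintype ι]

theorem rootForm_root_pos (k : ι) : 0 < P.RootForm (P.root k) (P.root k) :=
  P.rootForm_pos_of_ne_zero (Submodule.subset_span ⟨k, rfl⟩) (P.ne_zero k)

variable [Nonempty ι]

/-- The normalized invariant form as a bilinear form. -/
def bilinForm (P : RootPairing ι ℚ M N) : LinearMap.BilinForm ℚ M :=
  (2 / minRootNorm P) • P.RootForm

theorem form_eq_bilinForm (x y : M) : form P x y = bilinForm P x y := rfl

theorem minRootNorm_pos : 0 < minRootNorm P :=
  (Finset.lt_inf'_iff _).2 fun k _ => rootForm_root_pos k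

theorem form_comm (x y : M) : form P x y = form P y x := by
  unfold form
  rw [← P.rootForm_symmetric.eq x y]
  rfl

theorem form_wordProd (w : List b.support) (x y : M) :
    form P (wordProd b w x) (wordProd b w y) = form P x y := by
  induction w with
  | nil => rfl
  | cons i w ih =>
    rw [wordProd_cons, LinearEquiv.mul_apply, LinearEquiv.mul_apply, ← ih]
    unfold form simpleReflection
    rw [P.rootForm_reflection_reflection_apply]

theorem halfNorm_pos (i : b.support) : 0 < halfNorm b i := by
  unfold halfNorm form
  have := rootForm_root_pos (P := P) i
  have := minRootNorm_pos (P := P)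
  positivity

/-- Invariance under `s_i` gives (s_i x, α_i) = -(x, α_i), which is solved for (x, α_i). -/
theorem form_root (x : M) (i : b.support) :
    form P x (P.root i) = P.toLinearMap x (P.coroot i) * halfNorm b i := by
  have h := form_wordProd b [i] x (P.root i)
  have e : wordProd b [i] = simpleReflection b i := by simp [wordProd]
  rw [e, simpleReflection_self, simpleReflection_apply, form_eq_bilinForm, form_eq_bilinForm,
    map_neg, map_sub, map_smul, LinearMap.sub_apply, LinearMap.smul_apply, smul_eq_mul] at h
  rw [halfNorm, form_eq_bilinForm, form_eq_bilinForm]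
  linarith

theorem pairing_mul_halfNorm (i j : b.support) :
    P.pairing j i * halfNorm b i = P.pairing i j * halfNorm b j := by
  rw [← P.root_coroot_eq_pairing, ← P.root_coroot_eq_pairing, ← form_root, ← form_root, form_comm]

theorem form_fundWeight [P.IsRootSystem] (i : b.support) (x : M) :
    form P (fundWeight b i) x = halfNorm b i * simpleCoord b i x := by
  classical
  conv_lhs => rw [← sum_simpleCoord_smul b x]
  rw [form_eq_bilinForm, map_sum, Finset.sum_eq_single i]
  · rw [map_smul, ← form_eq_bilinForm, form_root, fundWeight_coroot_self, smul_eq_mul]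
    ring
  · intro j _ hj
    rw [map_smul, ← form_eq_bilinForm, form_root, fundWeight_coroot, if_neg hj]
    simp
  · simp

theorem exists_int_halfNorm [P.IsCrystallographic] [P.IsReduced] [P.IsIrreducible]
    (i : b.support) : ∃ n : ℤ, halfNorm b i = n := by
  obtain ⟨k, -, hk⟩ := Finset.exists_mem_eq_inf' (Finset.univ_nonempty (α := ι))
    fun k => P.RootForm (P.root k) (P.root k)
  have hmin : minRootNorm P = P.RootForm (P.root k) (P.root k) := hk
  have hle : minRootNorm P ≤ P.RootForm (P.root i) (P.root i) :=
    Finset.inf'_le _ (Finset.mem_univ (i : ι))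
  have hpos := minRootNorm_pos (P := P)
  have hhalf : halfNorm b i = P.RootForm (P.root i) (P.root i) / minRootNorm P := by
    unfold halfNorm form
    ring
  -- In an irreducible system the ratio of two squared lengths is 1, 2, 3, 1/2 or 1/3. Comparison
  -- with a shortest root excludes the last two.
  have h := P.toInvariantForm.apply_eq_or (i : ι) k
  simp only [RootPairing.toInvariantForm_form, ← hmin] at h
  rw [hhalf]
  rcases h with h | h | h | h | h
  · exact ⟨1, by rw [h, div_self hpos.ne']; simp⟩
  · exact ⟨2, by rw [h, mul_div_cancel_right₀ _ hpos.ne']; simp⟩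
  · exact ⟨3, by rw [h, mul_div_cancel_right₀ _ hpos.ne']; simp⟩
  · linarith
  · linarith

end Form

/-! ## The inverse of the `t`-quantized Cartan matrix -/

section Inverse

open scoped RatFunc

/-- A coefficient of the Laurent expansion of a rational function. -/
def laurentCoeff (u : ℤ) : RatFunc ℚ →+ ℚ where
  toFun x := (x : LaurentSeries ℚ).coeff u
  map_zero' := by simp
  map_add' x y := by simp

theorem algebraMap_ratFunc_C (a : ℚ) :
    algebraMap (RatFunc ℚ) (LaurentSeries ℚ) (RatFunc.C a) = HahnSeries.single 0 a := by
  rw [← RatFunc.algebraMap_C]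
  refine (RatFunc.coe_coe (Polynomial.C a)).symm.trans ?_
  rw [Polynomial.coe_C, PowerSeries.coe_C]
  rfl

theorem laurentCoeff_C_mul (a : ℚ) (x : RatFunc ℚ) (u : ℤ) :
    laurentCoeff u (RatFunc.C a * x) = a * laurentCoeff u x := by
  change (algebraMap (RatFunc ℚ) (LaurentSeries ℚ) (RatFunc.C a * x)).coeff u = _
  rw [map_mul, algebraMap_ratFunc_C, HahnSeries.coeff_single_zero_mul]
  rfl

theorem laurentCoeff_C (a : ℚ) (u : ℤ) :
    laurentCoeff u (RatFunc.C a) = if u = 0 then a else 0 := by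
  change (algebraMap (RatFunc ℚ) (LaurentSeries ℚ) (RatFunc.C a)).coeff u = _
  rw [algebraMap_ratFunc_C, HahnSeries.coeff_single]
  split_ifs <;> rfl

theorem laurentCoeff_mul_X_add (x : RatFunc ℚ) (u : ℤ) :
    laurentCoeff u (x * (RatFunc.X + RatFunc.X⁻¹)) =
      laurentCoeff (u - 1) x + laurentCoeff (u + 1) x := by
  change (algebraMap (RatFunc ℚ) (LaurentSeries ℚ) (x * (RatFunc.X + RatFunc.X⁻¹))).coeff u = _
  rw [map_mul, map_add, map_inv₀, RatFunc.coe_X, HahnSeries.inv_single, mul_add,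
    HahnSeries.coeff_add, HahnSeries.coeff_mul_single, HahnSeries.coeff_mul_single]
  simp [laurentCoeff]

theorem exists_laurentCoeff_eq_zero {I : Type*} [Finite I] (v : I → RatFunc ℚ) :
    ∃ n : ℤ, ∀ j, ∀ u < n, laurentCoeff u (v j) = 0 := by
  have := Fintype.ofFinite I
  have h (j : I) : ∃ n : ℤ, ∀ u < n, laurentCoeff u (v j) = 0 :=
    ⟨(algebraMap (RatFunc ℚ) (LaurentSeries ℚ) (v j)).order,
      fun u hu => HahnSeries.coeff_eq_zero_of_lt_order hu⟩
  choose n hn using h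
  obtain ⟨m, hm⟩ := (Set.finite_range n).bddBelow
  exact ⟨m, fun j u hu => hn j u (hu.trans_le (hm ⟨j, rfl⟩))⟩

theorem ext_laurentCoeff {x y : RatFunc ℚ} (h : ∀ u, laurentCoeff u x = laurentCoeff u y) :
    x = y := by
  apply (algebraMap (RatFunc ℚ) (LaurentSeries ℚ)).injective
  exact HahnSeries.ext (funext h)

variable {ι M N : Type*} [AddCommGroup M] [Module ℚ M] [AddCommGroup N] [Module ℚ N]
variable {P : RootPairing ι ℚ M N} (b : P.Base)

/-- The mesh relation computes the values at `u` from those at `u - 1` and `u - 2`, so vanishing far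
to the left propagates to the right. -/
theorem eq_zero_of_mesh_of_bddBelow {f : b.support → ℤ → ℚ} (n m : ℤ)
    (hn : ∀ j, ∀ u < n, f j u = 0)
    (hf : ∀ j, ∀ u < m, f j (u + 1) + f j (u - 1) = ∑ k, meshCoeff b j k * f k u)
    (j : b.support) {u : ℤ} (hu : u ≤ m) : f j u = 0 := by
  have key : ∀ l : ℕ, ∀ j, ∀ u ≤ m, u < n + l → f j u = 0 := by
    intro l
    induction l with
    | zero => exact fun j u _ hu => hn j u (by simpa using hu)
    | succ l ih =>
      intro j u hum hul
      have h := hf j (u - 1) (by omega)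
      rw [sub_add_cancel, ih j (u - 1 - 1) (by omega) (by push_cast at hul; omega), add_zero] at h
      rw [h]
      refine Finset.sum_eq_zero fun k _ => ?_
      rw [ih k (u - 1) (by omega) (by push_cast at hul; omega), mul_zero]
  exact key (u - n + 1).toNat j u hu (by omega)

/-- On Laurent coefficients, right multiplication by C(t) is the mesh operator. -/
theorem laurentCoeff_vecMul_tCartan (v : b.support → RatFunc ℚ) (j : b.support) (u : ℤ) :
    laurentCoeff u (Matrix.vecMul v (tCartan b) j) =
      laurentCoeff (u + 1) (v j) + laurentCoeff (u - 1) (v j) -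
        ∑ k, meshCoeff b j k * laurentCoeff u (v k) := by
  classical
  have h (k : b.support) : v k * tCartan b k j =
      (if k = j then v j * (RatFunc.X + RatFunc.X⁻¹) else 0) -
        RatFunc.C (meshCoeff b j k) * v k := by
    unfold tCartan meshCoeff
    split_ifs with h
    · rw [h]; simp
    · simp [mul_comm]
  simp only [Matrix.vecMul, dotProduct, h, Finset.sum_sub_distrib, Finset.sum_ite_eq',
    Finset.mem_univ, if_true, map_sub, map_sum, laurentCoeff_mul_X_add, laurentCoeff_C_mul]
  ring

variable [Fintype ι] [Nonempty ι]

open Classical in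
theorem tSymm_mul_diagonal :
    tSymm b * Matrix.diagonal (fun i => RatFunc.C (halfNorm b i)) = tCartan b := by
  rw [tSymm]
  convert Matrix.nonsing_inv_mul_cancel_right _ _ ?_
  rw [Matrix.det_diagonal, isUnit_iff_ne_zero, Finset.prod_ne_zero_iff]
  intro i _
  rw [ne_eq, map_eq_zero]
  exact (halfNorm_pos b i).ne'

-- A vector in the left kernel would have Laurent coefficients satisfying all mesh relations and
-- vanishing for very negative exponents, hence vanishing altogether.
open Classical in
theorem isUnit_det_tSymm : IsUnit (tSymm b).det := by
  rw [isUnit_iff_ne_zero]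
  intro h
  obtain ⟨v, hv, hv'⟩ := Matrix.exists_vecMul_eq_zero_iff.2 h
  have h0 : Matrix.vecMul v (tCartan b) = 0 := by
    rw [← tSymm_mul_diagonal, ← Matrix.vecMul_vecMul, hv', Matrix.zero_vecMul]
  obtain ⟨n, hn⟩ := exists_laurentCoeff_eq_zero v
  refine hv (funext fun j => ext_laurentCoeff fun u => ?_)
  rw [Pi.zero_apply, map_zero]
  refine eq_zero_of_mesh_of_bddBelow b (f := fun j u => laurentCoeff u (v j)) n u hn
    (fun j u _ => ?_) j le_rfl
  have := laurentCoeff_vecMul_tCartan b v j u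
  rw [h0, Pi.zero_apply, map_zero] at this
  linarith

-- This reads off the coefficient of t^u in B(t)⁻¹ C(t) = D.
open Classical in
theorem bTilde_recursion (i j : b.support) (u : ℤ) :
    bTilde b i j (u + 1) + bTilde b i j (u - 1) =
      (if i = j ∧ u = 0 then halfNorm b j else 0) +
        ∑ k, meshCoeff b j k * bTilde b i k u := by
  have h : (tSymm b)⁻¹ * tCartan b = Matrix.diagonal fun i => RatFunc.C (halfNorm b i) := by
    rw [← tSymm_mul_diagonal, ← Matrix.mul_assoc, Matrix.nonsing_inv_mul _ (isUnit_det_tSymm b),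
      Matrix.one_mul]
  have h' := laurentCoeff_vecMul_tCartan b ((tSymm b)⁻¹ i) j u
  have h2 : Matrix.vecMul ((tSymm b)⁻¹ i) (tCartan b) j =
      if i = j then RatFunc.C (halfNorm b j) else 0 := by
    have := congrFun (congrFun h i) j
    rw [Matrix.diagonal_apply] at this
    split_ifs at this ⊢ with hij
    · subst hij; exact this
    · exact this
  have h3 : laurentCoeff u (if i = j then RatFunc.C (halfNorm b j) else 0) =
      if i = j ∧ u = 0 then halfNorm b j else 0 := by
    by_cases hij : i = j
    · rw [if_pos hij, laurentCoeff_C]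
      simp [hij]
    · simp [hij]
  rw [h2, h3] at h'
  change laurentCoeff (u + 1) ((tSymm b)⁻¹ i j) + laurentCoeff (u - 1) ((tSymm b)⁻¹ i j) =
    _ + ∑ k, meshCoeff b j k * laurentCoeff u ((tSymm b)⁻¹ i k)
  linarith

theorem tSymm_symm (i j : b.support) : tSymm b i j = tSymm b j i := by
  classical
  have h (i j : b.support) : tSymm b i j * RatFunc.C (halfNorm b j) = tCartan b i j := by
    rw [← tSymm_mul_diagonal, Matrix.mul_diagonal]
  have hne (i : b.support) : RatFunc.C (halfNorm b i) ≠ 0 := by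
    rw [ne_eq, map_eq_zero]
    exact (halfNorm_pos b i).ne'
  have e1 := eq_div_of_mul_eq (hne j) (h i j)
  have e2 := eq_div_of_mul_eq (hne i) (h j i)
  rw [e1, e2, div_eq_div_iff (hne j) (hne i)]
  by_cases hij : i = j
  · rw [hij]
  · rw [tCartan, tCartan, if_neg hij, if_neg (Ne.symm hij), ← map_mul, ← map_mul,
      pairing_mul_halfNorm]

theorem bTilde_symm (i j : b.support) (u : ℤ) : bTilde b i j u = bTilde b j i u := by
  classical
  have h : (tSymm b).transpose = tSymm b := by
    ext i j
    exact tSymm_symm b j i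
  have h' := Matrix.transpose_nonsing_inv (tSymm b)
  rw [h] at h'
  have h'' : ((tSymm b)⁻¹) i j = ((tSymm b)⁻¹) j i := by
    conv_lhs => rw [← h']
    rfl
  change laurentCoeff u ((tSymm b)⁻¹ i j) = laurentCoeff u ((tSymm b)⁻¹ j i)
  rw [h'']

theorem bTilde_of_nonpos (i j : b.support) {u : ℤ} (hu : u ≤ 0) : bTilde b i j u = 0 := by
  classical
  obtain ⟨n, hn⟩ := exists_laurentCoeff_eq_zero fun j => (tSymm b)⁻¹ i j
  refine eq_zero_of_mesh_of_bddBelow b (f := bTilde b i) n 0 hn (fun j u hu => ?_) j hu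
  rw [bTilde_recursion, if_neg (fun h => hu.ne h.2), zero_add]

end Inverse

/-! ## The odd extension of the coefficients of the inverse -/

section Odd

variable {ι M N : Type*} [AddCommGroup M] [Module ℚ M] [AddCommGroup N] [Module ℚ N]
variable {P : RootPairing ι ℚ M N} {b : P.Base}

/-- A function on `I × ℤ` satisfying all mesh relations is determined by two consecutive values. -/
theorem eq_zero_of_mesh {f : b.support → ℤ → ℚ} (h0 : ∀ j, f j 0 = 0) (h1 : ∀ j, f j 1 = 0)
    (hf : ∀ j u, f j (u + 1) + f j (u - 1) = ∑ k, meshCoeff b j k * f k u)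
    (j : b.support) (u : ℤ) : f j u = 0 := by
  have hs {u : ℤ} (h : ∀ k, f k u = 0) (j : b.support) : f j (u + 1) + f j (u - 1) = 0 := by
    rw [hf]
    exact Finset.sum_eq_zero fun k _ => by rw [h k, mul_zero]
  have key : ∀ u : ℤ, (∀ j, f j u = 0) ∧ ∀ j, f j (u + 1) = 0 := by
    intro u
    induction u with
    | zero => exact ⟨h0, h1⟩
    | succ n ih =>
      refine ⟨ih.2, fun j => ?_⟩
      have := hs ih.2 j
      rwa [add_sub_cancel_right, ih.1, add_zero] at this
    | pred n ih =>
      refine ⟨fun j => ?_, fun j => by rw [sub_add_cancel]; exact ih.1 j⟩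
      have := hs ih.1 j
      rwa [ih.2, zero_add] at this
  exact (key u).1 j

variable [Finite ι] [P.IsCrystallographic]

/-- Below the slice, the value at (j,p) is determined by those at (j,p+2) and at (k,p+1) for the
neighbours `k`. These are on or below the slice, so one inducts on the distance of p from the
maximum of ξ. -/
theorem eq_zero_of_mesh_of_slice_aux {ξ : b.support → ℤ} (hξ : IsHeight ξ)
    {f : b.support → ℤ → ℚ} (h0 : ∀ j, f j (ξ j) = 0)
    (hf : ∀ j p, Odd (p - ξ j) → f j (p + 1) + f j (p - 1) = ∑ k, meshCoeff b j k * f k p)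
    (j : b.support) {p : ℤ} (hp : Even (p - ξ j)) (hpj : p ≤ ξ j) : f j p = 0 := by
  obtain ⟨m, hm⟩ := (Set.finite_range ξ).bddAbove
  have hm' (j : b.support) : ξ j ≤ m := hm ⟨j, rfl⟩
  have key : ∀ n : ℕ, ∀ j p, Even (p - ξ j) → p ≤ ξ j → m - p < n → f j p = 0 := by
    intro n
    induction n with
    | zero =>
      intro j p _ h1 h2
      have := hm' j
      simp at h2
      omega
    | succ n ih =>
      intro j p hp hpj hn
      obtain ⟨c, hc⟩ := hp
      push_cast at hn
      by_cases hpe : p = ξ j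
      · rw [hpe, h0]
      · have h := hf j (p + 1) ⟨c, by omega⟩
        rw [add_sub_cancel_right, ih j (p + 1 + 1) ⟨c + 1, by omega⟩ (by omega) (by omega),
          zero_add] at h
        rw [h]
        have := sum_meshCoeff_congr (V := ℚ) j (f := fun k => f k (p + 1)) (g := 0)
          fun k hk => by
            have hcs := hξ.cases hk
            refine ih k (p + 1) ?_ (by omega) (by omega)
            rcases hcs with h | h
            · exact ⟨c, by omega⟩
            · exact ⟨c + 1, by omega⟩
        simpa using this
  exact key (m - p + 1).toNat j p hp hpj (by omega)

/-- A function on the vertices of the repetition quiver satisfying all mesh relations is determined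
by its values at the points `(j, ξ_j)`. -/
theorem eq_zero_of_mesh_of_slice {ξ : b.support → ℤ} (hξ : IsHeight ξ)
    {f : b.support → ℤ → ℚ} (h0 : ∀ j, f j (ξ j) = 0)
    (hf : ∀ j p, Odd (p - ξ j) → f j (p + 1) + f j (p - 1) = ∑ k, meshCoeff b j k * f k p)
    (j : b.support) {p : ℤ} (hp : Even (p - ξ j)) : f j p = 0 := by
  rcases le_total p (ξ j) with h | h
  · exact eq_zero_of_mesh_of_slice_aux hξ h0 hf j hp h
  -- The half above the slice becomes the half below it under p ↦ -p, ξ ↦ -ξ.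
  · have := eq_zero_of_mesh_of_slice_aux (ξ := fun j => -ξ j) (f := fun j p => f j (-p))
      (fun i j hij => by
        have := hξ i j hij
        rw [← this, abs_sub_comm]
        congr 1
        ring) (fun j => by simpa using h0 j)
      (fun j p hp => by
        have := hf j (-p) (by
          obtain ⟨c, hc⟩ := hp
          exact ⟨-c - 1, by omega⟩)
        rw [← this, add_comm]
        congr 2 <;> ring) j (p := -p) (by
          obtain ⟨c, hc⟩ := hp
          exact ⟨-c, by omega⟩) (neg_le_neg h)
    simpa using this

end Odd

section Odd

variable {ι M N : Type*} [AddCommGroup M] [Module ℚ M] [AddCommGroup N] [Module ℚ N]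
variable {P : RootPairing ι ℚ M N} (b : P.Base) [Fintype ι] [Nonempty ι]

/-- The odd function `b̃_{i,j}(u) - b̃_{i,j}(-u)`. -/
def bOdd (i j : b.support) (u : ℤ) : ℚ := bTilde b i j u - bTilde b i j (-u)

theorem bOdd_neg (i j : b.support) (u : ℤ) : bOdd b i j (-u) = -bOdd b i j u := by
  simp [bOdd]

theorem bOdd_of_nonneg (i j : b.support) {u : ℤ} (hu : 0 ≤ u) :
    bOdd b i j u = bTilde b i j u := by
  rw [bOdd, bTilde_of_nonpos b i j (neg_nonpos.2 hu), sub_zero]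

theorem bOdd_zero (i j : b.support) : bOdd b i j 0 = 0 := by simp [bOdd]

theorem bOdd_symm (i j : b.support) (u : ℤ) : bOdd b i j u = bOdd b j i u := by
  rw [bOdd, bOdd, bTilde_symm b i j, bTilde_symm b i j]

/-- The source terms at u = 0 of the two summands of `bOdd` cancel. -/
theorem bOdd_mesh (i j : b.support) (u : ℤ) :
    bOdd b i j (u + 1) + bOdd b i j (u - 1) = ∑ k, meshCoeff b j k * bOdd b i k u := by
  have h1 := bTilde_recursion b i j u
  have h2 := bTilde_recursion b i j (-u)
  have e1 : -u + 1 = -(u - 1) := by ring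
  have e2 : -u - 1 = -(u + 1) := by ring
  rw [e1, e2] at h2
  simp only [bOdd, mul_sub, Finset.sum_sub_distrib]
  by_cases h : i = j ∧ u = 0
  · rw [if_pos h] at h1
    rw [if_pos ⟨h.1, neg_eq_zero.2 h.2⟩] at h2
    linarith
  · rw [if_neg h] at h1
    rw [if_neg fun h' => h ⟨h'.1, neg_eq_zero.1 h'.2⟩] at h2
    linarith

theorem bOdd_mesh_left (i j : b.support) (u : ℤ) :
    bOdd b i j (u + 1) + bOdd b i j (u - 1) = ∑ k, meshCoeff b i k * bOdd b k j u := by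
  rw [bOdd_symm b i j, bOdd_symm b i j, bOdd_mesh]
  simp only [bOdd_symm b j]

open Classical in
theorem bOdd_one (i j : b.support) : bOdd b i j 1 = if i = j then halfNorm b j else 0 := by
  have h := bTilde_recursion b i j 0
  rw [bOdd_of_nonneg b i j zero_le_one]
  simp only [zero_add, zero_sub, bTilde_of_nonpos b i _ le_rfl, mul_zero, Finset.sum_const_zero,
    bTilde_of_nonpos b i j (neg_nonpos.2 (zero_le_one (α := ℤ))), add_zero, and_true] at h
  exact h

variable {b} [P.IsCrystallographic]

/-- A light cone bound: by the recursion, a nonzero value at `u` comes from the source at u = 1,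
from the same vertex at `u - 2`, or from a neighbour at `u - 1`, and heights of neighbours differ by
1. It holds for every height function `ξ`, which is later exploited with heights reached in the
middle of a word. -/
theorem bTilde_support {ξ : b.support → ℤ} (hξ : IsHeight ξ) {i j : b.support} {u : ℤ}
    (h : bTilde b i j u ≠ 0) : 1 + |ξ i - ξ j| ≤ u ∧ Even (u - (ξ i - ξ j) - 1) := by
  classical
  have key : ∀ n : ℕ, ∀ j, ∀ u ≤ (n : ℤ), bTilde b i j u ≠ 0 →
      1 + |ξ i - ξ j| ≤ u ∧ Even (u - (ξ i - ξ j) - 1) := by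
    intro n
    induction n with
    | zero => exact fun j u hu h => absurd (bTilde_of_nonpos b i j (by simpa using hu)) h
    | succ n ih =>
      intro j u hu h
      push_cast at hu
      have hr := bTilde_recursion b i j (u - 1)
      rw [sub_add_cancel] at hr
      by_cases h1 : bTilde b i j (u - 1 - 1) = 0
      · rw [h1, add_zero] at hr
        by_cases h2 : i = j ∧ u - 1 = 0
        · obtain ⟨rfl, h2⟩ := h2
          rw [sub_self, abs_zero]
          exact ⟨by omega, ⟨0, by omega⟩⟩
        · rw [if_neg h2, zero_add] at hr
          rw [hr] at h
          obtain ⟨k, -, hk⟩ := Finset.exists_ne_zero_of_sum_ne_zero h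
          obtain ⟨ha, hc⟩ := ih k (u - 1) (by omega) (right_ne_zero_of_mul hk)
          have hadj : Adjacent b j k := by
            by_contra hadj
            exact left_ne_zero_of_mul hk (meshCoeff_eq_zero hadj)
          obtain ⟨c, hc⟩ := hc
          have hcs := hξ.cases hadj
          have h3 := abs_le.1 (show |ξ i - ξ k| ≤ u - 2 by omega)
          refine ⟨?_, ?_⟩
          · have : |ξ i - ξ j| ≤ u - 1 := abs_le.2 ⟨by omega, by omega⟩
            omega
          · rcases hcs with h | h
            · exact ⟨c, by omega⟩
            · exact ⟨c + 1, by omega⟩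
      · obtain ⟨ha, c, hc⟩ := ih j (u - 1 - 1) (by omega) h1
        exact ⟨by omega, c + 1, by omega⟩
  exact key u.toNat j u (by omega) h

theorem bOdd_support {ξ : b.support → ℤ} (hξ : IsHeight ξ) {i j : b.support} {u : ℤ}
    (h : bOdd b i j u ≠ 0) : 1 + |ξ i - ξ j| ≤ |u| ∧ Even (u - (ξ i - ξ j) - 1) := by
  rcases le_total 0 u with hu | hu
  · rw [bOdd_of_nonneg b i j hu] at h
    rw [abs_of_nonneg hu]
    exact bTilde_support hξ h
  · have h' : bOdd b i j (-u) ≠ 0 := by rwa [bOdd_neg, neg_ne_zero]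
    rw [bOdd_of_nonneg b i j (by omega)] at h'
    rw [abs_of_nonpos hu]
    obtain ⟨h1, c, hc⟩ := bTilde_support hξ h'
    exact ⟨h1, -c - (ξ i - ξ j) - 1, by omega⟩

end Odd

/-! ### Pairings of fundamental weights with roots of the repetition quiver. -/

namespace DynkinQuiver

variable {ι M N : Type*} [AddCommGroup M] [Module ℚ M] [AddCommGroup N] [Module ℚ N]
variable {P : RootPairing ι ℚ M N} {b : P.Base} [Fintype ι] [Nonempty ι]
variable [P.IsCrystallographic] [P.IsRootSystem] (Q : DynkinQuiver b)

/-- Both sides satisfy the recursion of `gamma_eq`, descending from the highest vertices: in the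
recursion for b̃, the term two steps earlier and the lower neighbours vanish by `bTilde_support`. -/
theorem form_fundWeight_gamma (i j : b.support) :
    form P (fundWeight b i) (Q.gamma j) = bTilde b i j (Q.height i - Q.height j + 1) := by
  classical
  obtain ⟨m, hm⟩ := (Set.finite_range Q.height).bddAbove
  have hm' (j : b.support) : Q.height j ≤ m := hm ⟨j, rfl⟩
  have key : ∀ n : ℕ, ∀ j, m - Q.height j < n →
      form P (fundWeight b i) (Q.gamma j) = bTilde b i j (Q.height i - Q.height j + 1) := by
    intro n
    induction n with
    | zero =>
      intro j hj
      have := hm' j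
      simp at hj
      omega
    | succ n ih =>
      intro j hj
      push_cast at hj
      have hr := bTilde_recursion b i j (Q.height i - Q.height j)
      have h0 : bTilde b i j (Q.height i - Q.height j - 1) = 0 := by
        by_contra h
        have := (bTilde_support Q.isHeight h).1
        have := le_abs_self (Q.height i - Q.height j)
        omega
      rw [h0, add_zero] at hr
      rw [hr, Q.gamma_eq, form_eq_bilinForm, map_add, map_sum, ← form_eq_bilinForm, form_root,
        fundWeight_coroot]
      congr 1
      · by_cases hij : i = j
        · subst hij; simp
        · rw [if_neg (Ne.symm hij), if_neg (fun h => hij h.1), zero_mul]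
      · simp only [map_smul, ← form_eq_bilinForm, ← smul_eq_mul (a := meshCoeff b _ _)]
        refine sum_meshCoeff_congr j fun k hk => ?_
        rcases Q.isHeight.cases hk with h | h
        · rw [if_pos h, ih k (by omega)]
          congr 1
          omega
        · rw [if_neg (by omega), form_eq_bilinForm, map_zero, eq_comm]
          by_contra h'
          have := (bTilde_support Q.isHeight h').1
          have := le_abs_self (Q.height i - Q.height k)
          omega
  exact key (m - Q.height j + 1).toNat j (by omega)

/-- The coefficients `b̃_{i,j}` express the pairings of fundamental weights with the roots at the
vertices of the repetition quiver. -/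
theorem form_fundWeight_rootAt (i j : b.support) {p : ℤ} (hp : Even (p - Q.height j)) :
    form P (fundWeight b i) (Q.rootAt j p) = bOdd b i j (Q.height i - p + 1) := by
  rw [← sub_eq_zero]
  refine eq_zero_of_mesh_of_slice Q.isHeight
    (f := fun j p => form P (fundWeight b i) (Q.rootAt j p) - bOdd b i j (Q.height i - p + 1))
    (fun j => ?_) (fun j p hp => ?_) j hp
  · rw [Q.rootAt_height, form_fundWeight_gamma, sub_eq_zero, bOdd, eq_comm, sub_eq_self]
    by_contra h
    have := (bTilde_support Q.isHeight h).1
    have := neg_abs_le (Q.height i - Q.height j)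
    omega
  · have h1 := congrArg (bilinForm P (fundWeight b i)) (Q.rootAt_mesh j p hp)
    have h2 := bOdd_mesh b i j (Q.height i - p + 1)
    simp only [map_add, map_sum, map_smul, smul_eq_mul, ← form_eq_bilinForm] at h1
    simp only [mul_sub, Finset.sum_sub_distrib]
    rw [← h1, ← h2]
    have e1 : Q.height i - (p + 1) + 1 = Q.height i - p + 1 - 1 := by ring
    have e2 : Q.height i - (p - 1) + 1 = Q.height i - p + 1 + 1 := by ring
    rw [e1, e2]
    ring

end DynkinQuiver

/-! ## The symmetry of the coefficients -/

section Fixed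

variable {ι M N : Type*} [AddCommGroup M] [Module ℚ M] [AddCommGroup N] [Module ℚ N]
variable {P : RootPairing ι ℚ M N} (b : P.Base) [P.IsRootSystem]

/-- If x = s_j w x with `j` not in `w`, then s_j x = w x. Here `w` does not change the
α_j-coordinate, while s_j lowers it by ⟨h_j, x⟩. So this pairing is zero, and the first letter can
be dropped. -/
theorem coroot_eq_zero_of_wordProd_eq {w : List b.support} (hw : w.Nodup) {x : M}
    (hx : wordProd b w x = x) {i : b.support} (hi : i ∈ w) : P.toLinearMap x (P.coroot i) = 0 := by
  induction w with
  | nil => simp at hi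
  | cons j w ih =>
    rw [List.nodup_cons] at hw
    rw [wordProd_cons, LinearEquiv.mul_apply] at hx
    have hx' := congrArg (simpleReflection b j) hx
    rw [simpleReflection_involutive, simpleReflection_apply] at hx'
    have h0 := congrArg (simpleCoord b j) hx'
    rw [simpleCoord_wordProd_of_notMem b hw.1, map_sub, map_smul, simpleCoord_root, if_pos rfl,
      eq_comm, sub_eq_self, smul_eq_mul, mul_one] at h0
    rw [h0, zero_smul, sub_zero] at hx'
    rcases List.mem_cons.1 hi with rfl | hi
    · exact h0
    · exact ih hw.2 hx' hi

variable {b}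

theorem DynkinQuiver.eq_zero_of_coxeter_eq (Q : DynkinQuiver b) {x : M} (hx : Q.coxeter x = x) :
    x = 0 := by
  obtain ⟨hnd, hmem, -⟩ := Q.exists_isCoxeterWord.choose_spec
  refine ext_coroot b fun i => ?_
  rw [coroot_eq_zero_of_wordProd_eq b hnd hx (hmem i)]
  simp

end Fixed

section Support

variable {ι M N : Type*} [AddCommGroup M] [Module ℚ M] [AddCommGroup N] [Module ℚ N]
variable {P : RootPairing ι ℚ M N} {b : P.Base} [Finite ι] [P.IsCrystallographic] [P.IsReduced]

theorem induction_on_adjacent [P.IsIrreducible] {p : b.support → Prop} {i : b.support} (hi : p i)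
    (hp : ∀ i j, Adjacent b i j → p i → p j) (j : b.support) : p j := by
  refine b.induction_on_cartanMatrix p hi fun i j h hji => ?_
  by_cases hij : i = j
  · exact hij ▸ h
  · refine hp i j (lt_of_le_of_ne (pairing_nonpos_of_ne (Ne.symm hij)) fun h0 => hji ?_) h
    rwa [RootPairing.Base.cartanMatrix_apply_eq_zero_iff_pairing]

/-- A positive root whose support consists of pairwise orthogonal simple roots is simple. -/
theorem exists_eq_root_of_support [P.IsRootSystem] {β : M} (hβ : β ∈ posRoots b)
    (h : ∀ i j, simpleCoord b i β ≠ 0 → simpleCoord b j β ≠ 0 → ¬ Adjacent b i j) :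
    ∃ k : b.support, β = P.root k := by
  obtain ⟨i, hi⟩ : ∃ i, simpleCoord b i β ≠ 0 := by
    by_contra! h0
    exact ne_zero_of_mem_range (mem_range_of_mem_posRoots b hβ)
      (ext_simpleCoord b fun i => by rw [h0 i, map_zero])
  refine ⟨i, by_contra fun hne => ?_⟩
  -- If β ≠ α_i, then s_i β is a positive root. But no neighbour of `i` lies in the support, so its
  -- α_i-coefficient is the negative of that of β.
  have h1 := simpleCoord_nonneg b (simpleReflection_mem_posRoots b i hβ hne) i
  have h2 : P.toLinearMap β (P.coroot i) = 2 * simpleCoord b i β := by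
    conv_lhs => rw [← sum_simpleCoord_smul b β]
    rw [map_sum, LinearMap.sum_apply, Finset.sum_eq_single i]
    · rw [map_smul, LinearMap.smul_apply, P.root_coroot_eq_pairing, P.pairing_same, smul_eq_mul,
        mul_comm]
    · intro j _ hji
      rw [map_smul, LinearMap.smul_apply, P.root_coroot_eq_pairing, smul_eq_mul, mul_eq_zero]
      by_contra! hj
      exact h i j hi hj.1 (lt_of_le_of_ne (pairing_nonpos_of_ne hji) hj.2)
    · simp
  rw [simpleReflection_apply, map_sub, map_smul, simpleCoord_root, if_pos rfl, h2, smul_eq_mul]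
    at h1
  have h3 := (simpleCoord_nonneg b hβ i).lt_of_ne (Ne.symm hi)
  linarith

end Support

/-! ### The first zero slice and the diagram involution. -/

section Symmetry

variable {ι M N : Type*} [AddCommGroup M] [Module ℚ M] [AddCommGroup N] [Module ℚ N]
variable {P : RootPairing ι ℚ M N} {b : P.Base} [Fintype ι] [Nonempty ι]
variable [P.IsRootSystem]

theorem form_fundWeight_sign {β : M} (hβ : β ∈ Set.range P.root) :
    (∀ i, 0 ≤ form P (fundWeight b i) β) ∨ ∀ i, form P (fundWeight b i) β ≤ 0 := by
  refine (mem_posRoots_or_neg_mem b hβ).imp (fun h i => ?_) (fun h i => ?_)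
  · rw [form_fundWeight]
    exact mul_nonneg (halfNorm_pos b i).le (simpleCoord_nonneg b h i)
  · have h' := simpleCoord_nonneg b h i
    rw [map_neg, neg_nonneg] at h'
    rw [form_fundWeight]
    exact mul_nonpos_of_nonneg_of_nonpos (halfNorm_pos b i).le h'

variable [P.IsCrystallographic]

/-- Two consecutive slices of coefficients are the coefficients of a root. -/
theorem exists_root_form_eq {ξ : b.support → ℤ} (hξ : IsHeight ξ) (j : b.support) (u : ℤ) :
    ∃ β ∈ Set.range P.root, ∀ i,
      form P (fundWeight b i) β = bOdd b i j u + bOdd b i j (u + 1) ∧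
        (bOdd b i j u = 0 ∨ bOdd b i j (u + 1) = 0) := by
  classical
  -- By parity, at most one of the values at `u` and `u + 1` is nonzero for each `i`. The two-valued
  -- height η selects that argument: at the vertex (j, 1 - u), the formula `form_fundWeight_rootAt`
  -- reads the coefficient at η_i + u.
  let η : b.support → ℤ := fun i => if Even (ξ i - ξ j - u - 1) then 0 else 1
  have hη : IsHeight η := by
    intro i k hik
    have hcs := hξ.cases hik
    simp only [η]
    split_ifs with h1 h2 h2
    · obtain ⟨c, hc⟩ := h1
      obtain ⟨d, hd⟩ := h2
      omega
    · norm_num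
    · norm_num
    · rw [Int.not_even_iff_odd] at h1 h2
      obtain ⟨c, hc⟩ := h1
      obtain ⟨d, hd⟩ := h2
      omega
  let Q : DynkinQuiver b := ⟨η, hη⟩
  have hp : Even (1 - u - Q.height j) := by
    simp only [Q, η]
    split_ifs with h
    · obtain ⟨c, hc⟩ := h
      exact ⟨c + 1, by omega⟩
    · rw [Int.not_even_iff_odd] at h
      obtain ⟨c, hc⟩ := h
      exact ⟨c + 1, by omega⟩
  refine ⟨Q.rootAt j (1 - u), Q.rootAt_mem_range j hp, fun i => ?_⟩
  rw [Q.form_fundWeight_rootAt i j hp]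
  by_cases h : Even (ξ i - ξ j - u - 1)
  · have h0 : bOdd b i j (u + 1) = 0 := by
      by_contra h'
      obtain ⟨c, hc⟩ := (bOdd_support hξ h').2
      obtain ⟨d, hd⟩ := h
      omega
    have : Q.height i - (1 - u) + 1 = u := by
      simp only [Q, η, if_pos h]; ring
    rw [this, h0, add_zero]
    exact ⟨rfl, Or.inr rfl⟩
  · have h0 : bOdd b i j u = 0 := by
      by_contra h'
      obtain ⟨c, hc⟩ := (bOdd_support hξ h').2
      exact h ⟨-c - 1, by omega⟩
    have : Q.height i - (1 - u) + 1 = u + 1 := by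
      simp only [Q, η, if_neg h]; ring
    rw [this, h0, zero_add]
    exact ⟨rfl, Or.inl rfl⟩

theorem bOdd_sign {ξ : b.support → ℤ} (hξ : IsHeight ξ) (j : b.support) (u : ℤ) :
    (∀ i, 0 ≤ bOdd b i j u ∧ 0 ≤ bOdd b i j (u + 1)) ∨
      ∀ i, bOdd b i j u ≤ 0 ∧ bOdd b i j (u + 1) ≤ 0 := by
  obtain ⟨β, hβ, h⟩ := exists_root_form_eq hξ j u
  refine (form_fundWeight_sign (b := b) hβ).imp (fun hs i => ?_) (fun hs i => ?_) <;>
  · obtain ⟨h1, h2⟩ := h i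
    have := hs i
    rw [h1] at this
    rcases h2 with h2 | h2 <;> simp [h2] at this ⊢ <;> exact this

variable (b) in
theorem exists_bOdd_neg (Q : DynkinQuiver b) : ∃ (n : ℕ) (i j : b.support),
    bOdd b i j (n + 1) < 0 := by
  obtain ⟨i₀⟩ := ‹Nonempty ι›
  obtain ⟨j, hj⟩ := b.support_nonempty
  lift j to b.support using hj
  by_contra! hcon
  have hfin : ¬ Function.Injective fun k : ℕ =>
      (⟨Q.rootAt j (Q.height j - 2 * k), Q.rootAt_mem_range j ⟨-k, by ring⟩⟩ :
        Set.range P.root) := not_injective_infinite_finite _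
  rw [Function.not_injective_iff] at hfin
  obtain ⟨k, l, hkl, hne⟩ := hfin
  have hkl' : Q.rootAt j (Q.height j - 2 * k) = Q.rootAt j (Q.height j - 2 * l) :=
    congrArg Subtype.val hkl
  -- Here `hm` is the period of the orbit of γ_j and `n` is the proof that it is positive.
  obtain ⟨m, hm, n, hmn⟩ : ∃ m n : ℕ, 0 < n ∧
      Q.rootAt j (Q.height j - 2 * (m + n : ℕ)) = Q.rootAt j (Q.height j - 2 * m) := by
    rcases lt_or_gt_of_ne hne with h | h
    · exact ⟨k, l - k, by omega, by rw [hkl', Nat.add_sub_cancel' h.le]⟩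
    · exact ⟨l, k - l, by omega, by rw [← hkl', Nat.add_sub_cancel' h.le]⟩
  have hper : Q.rootAt j (Q.height j - 2 * hm) = Q.rootAt j (Q.height j) := by
    have := congrArg (Q.coxeter ^ (-(m : ℤ))) hmn
    rw [Q.coxeter_zpow_rootAt, Q.coxeter_zpow_rootAt] at this
    rwa [show Q.height j - 2 * ((m + hm : ℕ) : ℤ) - 2 * -(m : ℤ) = Q.height j - 2 * hm by
        push_cast; ring,
      show Q.height j - 2 * (m : ℤ) - 2 * -(m : ℤ) = Q.height j by ring] at this
  -- The sum over a period is fixed by τ_Q, hence zero. Its pairing with ϖ_j is a sum of values of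
  -- `bOdd` whose first term d_j is positive, so not all of them are nonnegative.
  set S := ∑ k ∈ Finset.range hm, Q.rootAt j (Q.height j - 2 * (k : ℤ)) with hS
  have hSτ : Q.coxeter S = S := by
    rw [← sub_eq_zero, hS, map_sum, ← Finset.sum_sub_distrib]
    have e (k : ℕ) : Q.coxeter (Q.rootAt j (Q.height j - 2 * (k : ℤ))) =
        Q.rootAt j (Q.height j - 2 * ((k + 1 : ℕ) : ℤ)) := by
      rw [Q.coxeter_rootAt]
      congr 1
      push_cast
      ring
    simp only [e]
    rw [Finset.sum_range_sub fun k : ℕ => Q.rootAt j (Q.height j - 2 * (k : ℤ)), hper]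
    simp
  have h0 := congrArg (bilinForm P (fundWeight b j)) (Q.eq_zero_of_coxeter_eq hSτ)
  rw [map_zero, hS, map_sum] at h0
  have e (k : ℕ) : bilinForm P (fundWeight b j) (Q.rootAt j (Q.height j - 2 * (k : ℤ))) =
      bOdd b j j ((2 * k : ℕ) + 1) := by
    rw [← form_eq_bilinForm, Q.form_fundWeight_rootAt j j ⟨-k, by ring⟩]
    congr 1
    push_cast
    ring
  simp only [e] at h0
  have := (Finset.sum_eq_zero_iff_of_nonneg fun k _ => hcon (2 * k) j j).1 h0 0
    (Finset.mem_range.2 n)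
  simp only [mul_zero, Nat.cast_zero, zero_add, bOdd_one, if_true] at this
  exact (halfNorm_pos b j).ne' this

variable [P.IsReduced] [P.IsIrreducible]

/-- The Coxeter number as the first positive zero of the coefficients. -/
theorem exists_coxeterNumber (Q : DynkinQuiver b) : ∃ h : ℤ, 0 < h ∧
    (∀ i j u, 0 ≤ u → u ≤ h → 0 ≤ bOdd b i j u) ∧ ∀ i j, bOdd b i j h = 0 := by
  classical
  have hex := exists_bOdd_neg b Q
  set h := Nat.find hex with hh
  obtain ⟨i₀, j₀, hneg⟩ := Nat.find_spec hex
  rw [← hh] at hneg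
  have hpos : 0 < h := by
    rw [Nat.pos_iff_ne_zero]
    intro h0
    rw [h0, Nat.cast_zero, zero_add, bOdd_one] at hneg
    split_ifs at hneg
    · exact absurd hneg (not_lt.2 (halfNorm_pos b j₀).le)
    · exact lt_irrefl _ hneg
  have hnn (i j : b.support) (u : ℤ) (h0 : 0 ≤ u) (hu : u ≤ h) : 0 ≤ bOdd b i j u := by
    rcases h0.eq_or_lt with rfl | h0
    · rw [bOdd_zero]
    · have := Nat.find_min hex (m := (u - 1).toNat) (by omega)
      push Not at this
      have := this i j
      rwa [show (((u - 1).toNat : ℕ) : ℤ) + 1 = u by omega] at this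
  refine ⟨h, by omega, hnn, fun i j => ?_⟩
  revert i
  -- For j₀, a negative value at h + 1 forces the slice at h to be ≤ 0, and it is ≥ 0 by minimality.
  -- If the slice vanishes for `j`, the left and right mesh relations show that a sum of nonnegative
  -- terms over the neighbours of `j` is zero, so the slice vanishes for each neighbour.
  refine induction_on_adjacent (p := fun j => ∀ i, bOdd b i j h = 0) (i := j₀) (fun i => ?_)
    (fun j k hjk hj i => ?_) j
  · rcases bOdd_sign Q.isHeight j₀ h with hs | hs
    · exact absurd hneg (not_lt.2 (hs i₀).2)
    · exact le_antisymm (hs i).1 (hnn i j₀ h (by omega) le_rfl)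
  · have h1 := bOdd_mesh_left b i j h
    rw [Finset.sum_eq_zero fun k _ => by rw [hj k, mul_zero], bOdd_mesh,
      Finset.sum_eq_zero_iff_of_nonneg fun k _ =>
        mul_nonneg (meshCoeff_nonneg j k) (hnn i k h (by omega) le_rfl)] at h1
    exact (mul_eq_zero.1 (h1 k (Finset.mem_univ k))).resolve_left
      ((meshCoeff_pos_iff j k).2 hjk).ne'

open Classical in
/-- The symmetry of the coefficients under translation by the Coxeter number. -/
theorem exists_star (Q : DynkinQuiver b) : ∃ (h : ℤ) (σ : b.support → b.support), 0 < h ∧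
    (∀ i j u, 0 ≤ u → u ≤ h → 0 ≤ bOdd b i j u) ∧
    (∀ i j, bOdd b i j (h - 1) = if i = σ j then halfNorm b i else 0) ∧
    (∀ i j u, bOdd b i j (h + u) = -bOdd b i (σ j) u) ∧
    (∀ j, σ (σ j) = j) ∧ ∀ i j, meshCoeff b (σ i) (σ j) = meshCoeff b i j := by
  obtain ⟨h, hpos, hnn, hzero⟩ := exists_coxeterNumber Q
  have hpm (i j : b.support) : bOdd b i j (h + 1) = -bOdd b i j (h - 1) := by
    have h1 := bOdd_mesh b i j h
    rw [Finset.sum_eq_zero fun k _ => by rw [hzero, mul_zero]] at h1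
    linarith
  have hσ (j : b.support) : ∃ k, ∀ i, bOdd b i j (h - 1) = if i = k then halfNorm b i else 0 := by
    obtain ⟨β, hβ, hform⟩ := exists_root_form_eq Q.isHeight j (h - 1)
    have hf (i : b.support) : halfNorm b i * simpleCoord b i β = bOdd b i j (h - 1) := by
      rw [← form_fundWeight, (hform i).1, sub_add_cancel, hzero, add_zero]
    have hβ' : β ∈ posRoots b := by
      refine mem_posRoots_of_simpleCoord_nonneg b hβ fun i => ?_
      have := hnn i j (h - 1) (by omega) (by omega)
      rw [← hf] at this
      exact nonneg_of_mul_nonneg_right this (halfNorm_pos b i)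
    -- The support of this slice has constant height parity, so it contains no two adjacent vertices
    -- and the root is simple.
    obtain ⟨k, rfl⟩ := exists_eq_root_of_support hβ' fun i k hi hk hik => by
      have hi' : bOdd b i j (h - 1) ≠ 0 := by
        rw [← hf]; exact mul_ne_zero (halfNorm_pos b i).ne' hi
      have hk' : bOdd b k j (h - 1) ≠ 0 := by
        rw [← hf]; exact mul_ne_zero (halfNorm_pos b k).ne' hk
      obtain ⟨c, hc⟩ := (bOdd_support Q.isHeight hi').2
      obtain ⟨d, hd⟩ := (bOdd_support Q.isHeight hk').2
      have := Q.isHeight.cases hik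
      omega
    refine ⟨k, fun i => ?_⟩
    rw [← hf, simpleCoord_root]
    by_cases hik : i = k
    · simp [hik]
    · simp [hik, Ne.symm hik]
  choose σ hσ using hσ
  have hinv (j : b.support) : σ (σ j) = j := by
    have h1 := hσ j (σ j)
    rw [if_pos rfl, bOdd_symm, hσ (σ j) j] at h1
    by_contra hne
    rw [if_neg (Ne.symm hne)] at h1
    exact (halfNorm_pos b (σ j)).ne h1
  have htr (i j : b.support) (u : ℤ) : bOdd b i j (h + u) = -bOdd b i (σ j) u := by
    rw [← sub_eq_zero, sub_neg_eq_add]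
    -- Both terms satisfy the mesh relations in (i,u), and their sum vanishes at u = 0 and u = 1.
    refine eq_zero_of_mesh (f := fun i u => bOdd b i j (h + u) + bOdd b i (σ j) u)
      (fun i => ?_) (fun i => ?_) (fun i u => ?_) i u
    · rw [add_zero, hzero, bOdd_zero, add_zero]
    · rw [hpm, hσ, bOdd_one]
      by_cases hi : i = σ j
      · simp [hi]
      · simp [hi]
    · simp only [mul_add, Finset.sum_add_distrib]
      rw [← bOdd_mesh_left, ← bOdd_mesh_left, show h + (u + 1) = h + u + 1 by ring,
        show h + (u - 1) = h + u - 1 by ring]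
      abel
  refine ⟨h, σ, hpos, hnn, fun i j => hσ j i, htr, hinv, fun j l => ?_⟩
  -- Translating the mesh at h + 1 back by h and comparing it with the mesh at 1, where `bOdd` is
  -- diagonal, shows that σ preserves the Cartan matrix.
  have h1 := bOdd_mesh b (σ l) j (h + 1)
  have h2 := bOdd_mesh b (σ l) (σ j) 1
  rw [add_assoc, add_sub_assoc, htr, htr] at h1
  simp only [htr, mul_neg, Finset.sum_neg_distrib] at h1
  rw [← neg_add, neg_inj, h2] at h1
  simp only [bOdd_one, mul_ite, mul_zero, Finset.sum_ite_eq, Finset.mem_univ, if_true] at h1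
  have hinj : Function.Injective σ := fun x y hxy => by rw [← hinv x, hxy, hinv]
  simp only [hinj.eq_iff, Finset.sum_ite_eq, Finset.mem_univ, if_true] at h1
  exact mul_right_cancel₀ (halfNorm_pos b (σ l)).ne' h1

end Symmetry

/-! ## Existence of adapted reduced words of the longest element -/

section Exists

variable {ι M N : Type*} [AddCommGroup M] [Module ℚ M] [AddCommGroup N] [Module ℚ N]
variable {P : RootPairing ι ℚ M N} {b : P.Base} [Fintype ι] [P.IsCrystallographic]

/-- Induction on the total drop. Among the vertices still above their target, one of maximal height
is a source: a higher neighbour would already be at its target, and then η would differ by more than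
1 along this edge. -/
theorem exists_isAdapted {ξ η : b.support → ℤ} (hξ : IsHeight ξ) (hη : IsHeight η)
    (hle : ∀ j, η j ≤ ξ j) (heven : ∀ j, Even (ξ j - η j)) :
    ∃ w, IsAdapted ξ w ∧ heightAfter ξ w = η := by
  classical
  generalize hn : ∑ j, (ξ j - η j).toNat = n
  induction n using Nat.strong_induction_on generalizing ξ with
  | _ n ih =>
    by_cases heq : ∀ j, ξ j ≤ η j
    · exact ⟨[], trivial, funext fun j => le_antisymm (heq j) (hle j)⟩
    · push Not at heq
      obtain ⟨j₀, hj₀⟩ := heq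
      obtain ⟨i, hi, hmax⟩ := (Finset.univ.filter fun j => η j < ξ j).exists_max_image ξ
        ⟨j₀, by simpa using hj₀⟩
      simp only [Finset.mem_filter, Finset.mem_univ, true_and] at hi hmax
      have hsrc : IsSource ξ i := by
        intro j hij
        by_contra hlt
        have h1 := hξ.cases hij
        have h2 := hη.cases hij
        by_cases hj : η j < ξ j
        · have := hmax j hj
          omega
        · have := hle j
          omega
      have hi2 : η i ≤ ξ i - 2 := by
        obtain ⟨c, hc⟩ := heven i
        omega
      obtain ⟨w, hw, hw'⟩ := ih (∑ j, (reflectHeight ξ i j - η j).toNat) (by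
        rw [← hn]
        refine Finset.sum_lt_sum (fun j _ => ?_) ⟨i, Finset.mem_univ i, ?_⟩
        · by_cases hj : j = i
          · subst hj; rw [reflectHeight_self]; omega
          · rw [reflectHeight_of_ne _ hj]
        · rw [reflectHeight_self]; omega) (hξ.reflectHeight hsrc) (fun j => by
          by_cases hj : j = i
          · subst hj; rw [reflectHeight_self]; exact hi2
          · rw [reflectHeight_of_ne _ hj]; exact hle j) (fun j => by
          by_cases hj : j = i
          · subst hj
            rw [reflectHeight_self]
            obtain ⟨c, hc⟩ := heven j
            exact ⟨c - 1, by omega⟩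
          · rw [reflectHeight_of_ne _ hj]; exact heven j) rfl
      exact ⟨i :: w, ⟨hsrc, hw⟩, hw'⟩

variable [Nonempty ι] [P.IsReduced] [P.IsIrreducible] [P.IsRootSystem]

theorem DynkinQuiver.exists_isLongestAdapted (Q : DynkinQuiver b) :
    ∃ w, Q.IsLongestAdapted w := by
  classical
  obtain ⟨h, σ, hpos, hnn, hσ, htr, hinv, hmesh⟩ := exists_star Q
  have hadj (i j : b.support) (hij : Adjacent b i j) : Adjacent b (σ i) (σ j) := by
    rwa [← meshCoeff_pos_iff, hmesh, meshCoeff_pos_iff]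
  -- The final heights. The nonzero value at h - 1 for the pair (σ j, j) shows through
  -- `bOdd_support` that they lie below ξ and have the right parity.
  let η : b.support → ℤ := fun j => Q.height (σ j) - h
  have hη : IsHeight η := fun i j hij => by
    rw [← Q.isHeight _ _ (hadj i j hij)]
    congr 1
    simp only [η]
    ring
  have hsupp (j : b.support) : 1 + |Q.height (σ j) - Q.height j| ≤ |h - 1| ∧
      Even (h - 1 - (Q.height (σ j) - Q.height j) - 1) := by
    refine bOdd_support Q.isHeight ?_
    rw [hσ, if_pos rfl]
    exact (halfNorm_pos b _).ne'
  obtain ⟨w, hw, hwη⟩ := exists_isAdapted Q.isHeight hη (fun j => by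
    have h1 := (hsupp j).1
    have h2 := le_abs_self (Q.height (σ j) - Q.height j)
    rw [abs_of_nonneg (show 0 ≤ h - 1 by omega)] at h1
    simp only [η]
    omega) (fun j => by
    obtain ⟨c, hc⟩ := (hsupp j).2
    exact ⟨c + 1, by simp only [η]; omega⟩)
  have hroot (j : b.support) (p : ℤ) (hp : Even (p - Q.height j)) :
      Q.rootAt j p = -Q.rootAt (σ j) (p + h) := by
    have hp' : Even (p + h - Q.height (σ j)) := by
      obtain ⟨c, hc⟩ := (hsupp j).2
      obtain ⟨d, hd⟩ := hp
      exact ⟨c + d + 1, by omega⟩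
    refine ext_simpleCoord b fun i => mul_left_cancel₀ (halfNorm_pos b i).ne' ?_
    rw [← form_fundWeight, ← form_fundWeight, Q.form_fundWeight_rootAt i j hp, form_eq_bilinForm,
      map_neg, ← form_eq_bilinForm, Q.form_fundWeight_rootAt i (σ j) hp', ← htr]
    congr 1
    ring
  have hweight (j : b.support) (p : ℤ) (hp : Even (p - Q.height j)) :
      Q.weightAt j p = -Q.weightAt (σ j) (p + h) := by
    rw [← sub_eq_zero, sub_neg_eq_add]
    -- The relation between the roots says that the sum of these two weights is fixed by τ_Q.
    refine Q.eq_zero_of_coxeter_eq ?_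
    have h1 := hroot j p hp
    rw [map_add, Q.coxeter_weightAt, Q.coxeter_weightAt]
    unfold rootAt at h1
    rw [neg_sub, sub_eq_sub_iff_add_eq_add] at h1
    rw [h1]
    abel
  have hpw : IsPosWord b w := by
    rintro x ⟨u, i, v, rfl, rfl⟩
    have had := hw
    rw [← List.singleton_append, ← List.append_assoc, isAdapted_append] at had
    rw [Q.wordProd_root had.1]
    set p := heightAfter Q.height u i with hp
    have hple : p ≤ Q.height i := heightAfter_le _ _ _
    have heven : Even (p - Q.height i) := Q.even_heightAfter_sub u i
    have hpη : η i < p := by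
      rw [← hwη, heightAfter_append, heightAfter_cons]
      refine lt_of_le_of_lt (heightAfter_le _ _ _) ?_
      rw [reflectHeight_self]
      omega
    refine mem_posRoots_of_simpleCoord_nonneg b (Q.rootAt_mem_range i heven) fun k => ?_
    refine nonneg_of_mul_nonneg_right ?_ (halfNorm_pos b k)
    rw [← form_fundWeight, Q.form_fundWeight_rootAt k i heven]
    -- The support bound excludes a nonzero value at an argument ≤ 0. Values up to h are
    -- nonnegative. Beyond h, translation by h brings the argument below the light cone of (k, σ i),
    -- because p > ξ_{σ i} - h.
    by_contra! hneg
    have h1 := (bOdd_support Q.isHeight hneg.ne).1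
    have h2 : 0 < Q.height k - p + 1 := by
      by_contra! h2
      rw [abs_of_nonpos h2] at h1
      have := neg_abs_le (Q.height k - Q.height i)
      omega
    have h3 : h < Q.height k - p + 1 := by
      by_contra! h3
      exact absurd (hnn k i _ h2.le h3) (not_le.2 hneg)
    have h4 := htr k i (Q.height k - p + 1 - h)
    rw [add_sub_cancel] at h4
    rw [h4, neg_lt_zero] at hneg
    have h5 := (bOdd_support Q.isHeight hneg.ne').1
    rw [abs_of_pos (show 0 < Q.height k - p + 1 - h by omega)] at h5
    have h6 := le_abs_self (Q.height k - Q.height (σ i))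
    simp only [η] at hpη
    omega
  refine ⟨w, hpw.isLongestWord b fun j => ?_, hw⟩
  have hfund (j : b.support) : wordProd b w (fundWeight b j) = -fundWeight b (σ j) := by
    rw [Q.wordProd_fundWeight hw, hweight j _ (Q.even_heightAfter_sub w j), hwη, ← Q.weightAt_height]
    simp [η]
  have hneg : -wordProd b w (P.root j) = P.root (σ j) := by
    rw [root_eq_fundWeight, root_eq_fundWeight, map_sub, map_smul, map_sum, hfund]
    simp only [map_smul, hfund, smul_neg, Finset.sum_neg_distrib, sub_neg_eq_add, neg_add, neg_neg]
    rw [sub_eq_add_neg]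
    congr 2
    have hinv' : Function.Involutive σ := hinv
    exact Fintype.sum_equiv (hinv'.toPerm σ) _ _ fun k => by
      simp only [Function.Involutive.coe_toPerm, hmesh]
  rw [hneg]
  exact simpleRoot_mem_posRoots b _

end Exists

/-! ## Commutation classes -/

section Comm

variable {ι M N : Type*} [AddCommGroup M] [Module ℚ M] [AddCommGroup N] [Module ℚ N]
variable {P : RootPairing ι ℚ M N} {b : P.Base}

theorem reflectHeight_comm (ξ : b.support → ℤ) (i j : b.support) :
    reflectHeight (reflectHeight ξ i) j = reflectHeight (reflectHeight ξ j) i := by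
  funext k
  unfold reflectHeight
  split_ifs <;> rfl

theorem isSource_reflectHeight_iff {ξ : b.support → ℤ} {i j : b.support} (hij : j ≠ i)
    (h : ¬ Adjacent b j i) : IsSource (reflectHeight ξ i) j ↔ IsSource ξ j := by
  refine forall₂_congr fun k hk => ?_
  rw [reflectHeight_of_ne _ hij, reflectHeight_of_ne]
  rintro rfl
  exact h hk

/-- The two letters are non-adjacent: their reflections commute, and reflecting at one does not
affect whether the other is a source. -/
theorem CommMove.properties {w w' : List b.support} (h : CommMove b w w') :
    wordProd b w = wordProd b w' ∧ w.length = w'.length ∧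
      ∀ ξ : b.support → ℤ, IsAdapted ξ w ↔ IsAdapted ξ w' := by
  obtain ⟨u, v, i, j, h0, rfl, rfl⟩ := h
  have h0' : P.pairing i j = 0 := P.pairing_eq_zero_iff'.1 h0
  have hne : i ≠ j := by
    rintro rfl
    rw [P.pairing_same] at h0
    norm_num at h0
  have h1 : ¬ Adjacent b i j := by unfold Adjacent; rw [h0]; exact lt_irrefl _
  have h2 : ¬ Adjacent b j i := by unfold Adjacent; rw [h0']; exact lt_irrefl _
  refine ⟨?_, by simp, fun ξ => ?_⟩
  · simp only [wordProd_append, wordProd_cons, ← mul_assoc]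
    congr 1
    rw [mul_assoc, mul_assoc]
    congr 1
    exact (P.isOrthogonal_comm i j ⟨h0', h0⟩)
  · rw [isAdapted_append, isAdapted_append]
    simp only [IsAdapted, isSource_reflectHeight_iff hne.symm h2, isSource_reflectHeight_iff hne h1,
      reflectHeight_comm _ i j]
    tauto

theorem CommEquiv.properties {w w' : List b.support} (h : CommEquiv b w w') :
    wordProd b w = wordProd b w' ∧ w.length = w'.length ∧
      ∀ ξ : b.support → ℤ, IsAdapted ξ w ↔ IsAdapted ξ w' := by
  induction h with
  | rel x y h => exact h.properties
  | refl x => exact ⟨rfl, rfl, fun _ => Iff.rfl⟩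
  | symm x y _ ih => exact ⟨ih.1.symm, ih.2.1.symm, fun ξ => (ih.2.2 ξ).symm⟩
  | trans x y z _ _ ih ih' =>
    exact ⟨ih.1.trans ih'.1, ih.2.1.trans ih'.2.1, fun ξ => (ih.2.2 ξ).trans (ih'.2.2 ξ)⟩

theorem DynkinQuiver.IsLongestAdapted.of_commEquiv {Q : DynkinQuiver b} {w w' : List b.support}
    (hw : Q.IsLongestAdapted w) (h : CommEquiv b w w') : Q.IsLongestAdapted w' := by
  obtain ⟨h1, h2, h3⟩ := h.properties
  refine ⟨⟨fun v hv => ?_, fun v hv => ?_⟩, (h3 _).1 hw.2⟩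
  · rw [← h2]; exact hw.1.1 v (hv.trans h1.symm)
  · rw [← h2]; exact hw.1.2 v hv

end Comm

/-! ## The labelling of the repetition quiver -/

namespace DynkinQuiver

variable {ι M N : Type*} [AddCommGroup M] [Module ℚ M] [AddCommGroup N] [Module ℚ N]
variable {P : RootPairing ι ℚ M N} {b : P.Base} (Q : DynkinQuiver b)

/-- The height of `j` descends in steps of two, so each level of the right parity above the final
one is the height at which some occurrence of `j` is reflected. -/
theorem exists_eq_append_of_lt (w : List b.support) {j : b.support} {p : ℤ}
    (hp : Even (p - Q.height j)) (h1 : heightAfter Q.height w j < p) (h2 : p ≤ Q.height j) :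
    ∃ u v, w = u ++ j :: v ∧ heightAfter Q.height u j = p := by
  induction w using List.reverseRecOn with
  | nil => simp at h1; omega
  | append_singleton w i ih =>
    by_cases h : heightAfter Q.height w j < p
    · obtain ⟨u, v, rfl, hu⟩ := ih h
      exact ⟨u, v ++ [i], by simp, hu⟩
    · rw [heightAfter_concat] at h1
      by_cases hij : j = i
      · subst hij
        rw [reflectHeight_self] at h1
        obtain ⟨c, hc⟩ := hp
        obtain ⟨d, hd⟩ := Q.even_heightAfter_sub w j
        exact ⟨w, [], rfl, by omega⟩
      · rw [reflectHeight_of_ne _ hij] at h1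
        exact absurd h1 h

theorem isAdapted_of_eq_append {ξ : b.support → ℤ} {u v : List b.support} {i : b.support}
    (h : IsAdapted ξ (u ++ i :: v)) : IsAdapted ξ (u ++ [i]) := by
  rw [← List.singleton_append, ← List.append_assoc, isAdapted_append] at h
  exact h.1

theorem stepDown_level_le (x : M × ℤ) : (Q.stepDown x).2 ≤ x.2 := by
  unfold stepDown
  split_ifs <;> simp

theorem le_stepUp_level (x : M × ℤ) : x.2 ≤ (Q.stepUp x).2 := by
  unfold stepUp
  split_ifs <;> simp

theorem iterate_stepDown_level_le (n : ℕ) (x : M × ℤ) : (Q.stepDown^[n] x).2 ≤ x.2 := by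
  induction n with
  | zero => exact le_rfl
  | succ n ih =>
    rw [Function.iterate_succ_apply']
    exact (Q.stepDown_level_le _).trans ih

theorem le_iterate_stepUp_level (n : ℕ) (x : M × ℤ) : x.2 ≤ (Q.stepUp^[n] x).2 := by
  induction n with
  | zero => exact le_rfl
  | succ n ih =>
    rw [Function.iterate_succ_apply']
    exact ih.trans (Q.le_stepUp_level _)

/-- The vertex of the repetition quiver at which a letter of an adapted word is reflected. -/
def letterVertex (w : List b.support) (k : Fin w.length) : Q.Vertex :=
  ⟨(w.get k, heightAfter Q.height (w.take k) (w.get k)), Q.even_heightAfter_sub _ _⟩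

theorem heightAfter_lt_letterVertex (w : List b.support) (k : Fin w.length) :
    heightAfter Q.height w (Q.letterVertex w k).1.1 < (Q.letterVertex w k).1.2 := by
  have h : w = w.take k ++ w.get k :: w.drop (k + 1) := by simp
  calc heightAfter Q.height w (w.get k)
      = heightAfter (reflectHeight (heightAfter Q.height (w.take k)) (w.get k))
          (w.drop (k + 1)) (w.get k) := by
        rw [← heightAfter_cons, ← heightAfter_append, ← h]
    _ ≤ reflectHeight (heightAfter Q.height (w.take k)) (w.get k) (w.get k) :=
        heightAfter_le _ _ _
    _ < heightAfter Q.height (w.take k) (w.get k) := by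
        rw [reflectHeight_self]
        omega

variable [P.IsRootSystem]

theorem iterate_stepDown (j : b.support) (n : ℕ)
    (h : ∀ m ≤ n, Q.rootAt j (Q.height j - 2 * (m : ℤ)) ∈ posRoots b) :
    Q.stepDown^[n] (Q.gamma j, 0) = (Q.rootAt j (Q.height j - 2 * (n : ℤ)), 0) := by
  induction n with
  | zero => simp [rootAt_height]
  | succ n ih =>
    have h' := h (n + 1) le_rfl
    have e : Q.height j - 2 * ((n + 1 : ℕ) : ℤ) = Q.height j - 2 * (n : ℤ) - 2 := by
      push_cast; ring
    rw [e] at h' ⊢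
    rw [Function.iterate_succ_apply', ih fun m hm => h m (by omega), stepDown]
    simp only [Q.coxeter_rootAt, h', if_true]

variable [Finite ι] [P.IsCrystallographic]

/-- The first step up from γ_j leaves the positive roots, and the level never decreases on further
steps up. -/
theorem phi_level_pos (v : Q.Vertex) (h : Q.height v.1.1 < v.1.2) : 0 < (Q.phi v).2 := by
  obtain ⟨⟨j, p⟩, hp⟩ := v
  simp only at h hp ⊢
  obtain ⟨d, hd⟩ := hp
  unfold phi
  simp only
  rw [if_pos h.le]
  obtain ⟨n, hn⟩ : ∃ n : ℕ, ((p - Q.height j) / 2).toNat = n + 1 :=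
    ⟨((p - Q.height j) / 2).toNat - 1, by omega⟩
  rw [hn, Function.iterate_succ_apply]
  refine lt_of_lt_of_le ?_ (Q.le_iterate_stepUp_level _ _)
  have e : Q.coxeter.symm (Q.gamma j) = Q.rootAt j (Q.height j + 2) := by
    rw [LinearEquiv.symm_apply_eq, coxeter_rootAt, add_sub_cancel_right, rootAt_height]
  have hn : Q.coxeter.symm (Q.gamma j) ∉ posRoots b := by
    rw [e]
    exact fun h' => neg_notMem_posRoots b h' (Q.neg_rootAt_height_add_two j)
  simp [stepUp, hn]

variable {Q} {w : List b.support}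

theorem wordRoot_eq_rootAt (hw : IsAdapted Q.height w) (k : Fin w.length) :
    wordRoot b w k = Q.rootAt (Q.letterVertex w k).1.1 (Q.letterVertex w k).1.2 := by
  have h : w = w.take k ++ w.get k :: w.drop (k + 1) := by simp
  rw [h] at hw
  exact Q.wordProd_root (isAdapted_of_eq_append hw)

variable [P.IsReduced]

theorem IsLongestAdapted.rootAt_mem_posRoots (hw : Q.IsLongestAdapted w) {j : b.support} {p : ℤ}
    (hp : Even (p - Q.height j)) (h1 : heightAfter Q.height w j < p) (h2 : p ≤ Q.height j) :
    Q.rootAt j p ∈ posRoots b := by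
  obtain ⟨u, v, rfl, rfl⟩ := Q.exists_eq_append_of_lt w hp h1 h2
  rw [← hw.1.isWordRoot_iff, ← Q.wordProd_root (isAdapted_of_eq_append hw.2)]
  exact ⟨u, j, v, rfl, rfl⟩

/-- The root at the final height is w γ'_j, where γ'_j is the positive root of the quiver with the
final heights, and w = w_0 makes positive roots negative. -/
theorem IsLongestAdapted.neg_rootAt_mem_posRoots (hw : Q.IsLongestAdapted w) (j : b.support) :
    -Q.rootAt j (heightAfter Q.height w j) ∈ posRoots b := by
  let Q' : DynkinQuiver b := ⟨heightAfter Q.height w, Q.isHeight.heightAfter hw.2⟩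
  obtain ⟨u, v, hu, -, had, -⟩ := Q'.exists_coxeter_eq j
  have h1 : IsAdapted Q.height (w ++ u ++ [j]) := by
    rw [List.append_assoc, isAdapted_append]
    exact ⟨hw.2, isAdapted_of_eq_append had⟩
  have h2 := Q.wordProd_root h1
  rw [heightAfter_append, heightAfter_of_notMem _ hu, wordProd_append, LinearEquiv.mul_apply,
    ← Q'.gamma_eq_wordProd hu had] at h2
  rw [← h2]
  exact neg_wordProd_mem_posRoots b w hw.1.neg_simpleRoot (Q'.gamma_mem_posRoots j)

theorem IsLongestAdapted.heightAfter_lt (hw : Q.IsLongestAdapted w) (j : b.support) :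
    heightAfter Q.height w j < Q.height j := by
  refine lt_of_le_of_ne (heightAfter_le _ _ _) fun h => ?_
  have h1 := hw.neg_rootAt_mem_posRoots j
  rw [h, rootAt_height] at h1
  exact neg_notMem_posRoots b (Q.gamma_mem_posRoots j) h1

theorem IsLongestAdapted.phi_of_mem (hw : Q.IsLongestAdapted w) (v : Q.Vertex)
    (h1 : heightAfter Q.height w v.1.1 < v.1.2) (h2 : v.1.2 ≤ Q.height v.1.1) :
    Q.phi v = (Q.rootAt v.1.1 v.1.2, 0) := by
  obtain ⟨⟨j, p⟩, hp⟩ := v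
  simp only at h1 h2 hp ⊢
  unfold phi
  simp only
  split_ifs with h
  · obtain rfl : p = Q.height j := le_antisymm h2 h
    simp [rootAt_height]
  · obtain ⟨c, hc⟩ := hp
    have e : Q.height j - 2 * (((Q.height j - p) / 2).toNat : ℤ) = p := by omega
    rw [Q.iterate_stepDown, e]
    intro m hm
    exact hw.rootAt_mem_posRoots ⟨-m, by ring⟩ (by omega) (by omega)

theorem IsLongestAdapted.phi_level_neg (hw : Q.IsLongestAdapted w) (v : Q.Vertex)
    (h : v.1.2 ≤ heightAfter Q.height w v.1.1) : (Q.phi v).2 < 0 := by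
  obtain ⟨⟨j, p⟩, hp⟩ := v
  simp only at h hp ⊢
  have hlt := hw.heightAfter_lt j
  obtain ⟨c, hc⟩ := Q.even_heightAfter_sub w j
  obtain ⟨d, hd⟩ := hp
  have hneg := hw.neg_rootAt_mem_posRoots j
  set q := heightAfter Q.height w j with hq
  unfold phi
  simp only
  rw [if_neg (by omega)]
  -- With q = ξ_j + 2c, the first -c - 1 steps down end at q + 2, still at level 0. The next step
  -- reaches the negative root at q and drops the level, and the remaining n steps cannot raise it.
  obtain ⟨n, hn⟩ : ∃ n : ℕ, ((Q.height j - p) / 2).toNat = n + 1 + (-c - 1).toNat :=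
    ⟨((Q.height j - p) / 2).toNat - 1 - (-c - 1).toNat, by omega⟩
  rw [hn, Function.iterate_add_apply, Q.iterate_stepDown, Function.iterate_succ_apply]
  · refine lt_of_le_of_lt (Q.iterate_stepDown_level_le _ _) ?_
    have e : Q.height j - 2 * ((-c - 1).toNat : ℤ) - 2 = q := by omega
    have hn' : Q.coxeter (Q.rootAt j (Q.height j - 2 * ((-c - 1).toNat : ℤ))) ∉ posRoots b := by
      rw [Q.coxeter_rootAt, e]
      exact fun h' => neg_notMem_posRoots b h' hneg
    unfold stepDown
    rw [if_neg hn']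
    norm_num
  · intro m hm
    exact hw.rootAt_mem_posRoots ⟨-m, by ring⟩ (by omega) (by omega)

theorem IsLongestAdapted.phi_level_eq_zero_iff (hw : Q.IsLongestAdapted w) (v : Q.Vertex) :
    (Q.phi v).2 = 0 ↔ heightAfter Q.height w v.1.1 < v.1.2 ∧ v.1.2 ≤ Q.height v.1.1 := by
  constructor
  · intro h
    constructor
    · by_contra! h1
      exact (hw.phi_level_neg v h1).ne h
    · by_contra! h1
      exact (Q.phi_level_pos v h1).ne' h
  · rintro ⟨h1, h2⟩
    rw [hw.phi_of_mem v h1 h2]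

theorem IsLongestAdapted.mem_gammaVertices_iff (hw : Q.IsLongestAdapted w) (v : Q.Vertex) :
    v ∈ Q.gammaVertices ↔ heightAfter Q.height w v.1.1 < v.1.2 ∧ v.1.2 ≤ Q.height v.1.1 := by
  rw [← hw.phi_level_eq_zero_iff]
  refine ⟨fun h => h.2, fun h => ⟨?_, h⟩⟩
  obtain ⟨h1, h2⟩ := (hw.phi_level_eq_zero_iff v).1 h
  rw [hw.phi_of_mem v h1 h2]
  exact hw.rootAt_mem_posRoots v.2 h1 h2

/-- Level 0 confines the vertex to the range swept out by the word, where it belongs to some letter.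
Distinct letters have distinct roots. -/
theorem IsLongestAdapted.phi_eq_iff (hw : Q.IsLongestAdapted w) (k : Fin w.length)
    (v : Q.Vertex) : Q.phi v = (wordRoot b w k, 0) ↔ v = Q.letterVertex w k := by
  constructor
  · intro h
    obtain ⟨h1, h2⟩ := (hw.phi_level_eq_zero_iff v).1 (by rw [h])
    have h3 := hw.phi_of_mem v h1 h2
    rw [h, Prod.mk.injEq] at h3
    obtain ⟨⟨j, p⟩, hp⟩ := v
    obtain ⟨u, v, hu, hup⟩ := Q.exists_eq_append_of_lt w hp h1 h2
    subst hu
    have h4 : wordRoot b (u ++ j :: v) ⟨u.length, by simp⟩ = wordRoot b (u ++ j :: v) k := by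
      rw [wordRoot_of_eq_append b u j v _ rfl, h3.1,
        Q.wordProd_root (isAdapted_of_eq_append hw.2), hup]
    have h5 := hw.1.isPosWord.wordRoot_injective b h4
    subst h5
    refine Subtype.ext ?_
    simp [letterVertex, hup]
  · rintro rfl
    rw [hw.phi_of_mem _ (Q.heightAfter_lt_letterVertex w k) (heightAfter_le _ _ _),
      wordRoot_eq_rootAt hw.2]

end DynkinQuiver

/-! ## Monomials in quantum tori -/

section Monomials

open LaurentPolynomial

theorem qpow_intCast (n : ℤ) : qpow (n : ℚ) = T (2 * n) := by
  rw [qpow]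
  congr 1
  exact_mod_cast Int.floor_intCast (2 * n)

/-- The `n`-th power of the variable of the coefficient ring, as a unit. -/
def unitT (n : ℤ) : Coeffˣ where
  val := T n
  inv := T (-n)
  val_inv := by rw [← T_add, add_neg_cancel, T_zero]
  inv_val := by rw [← T_add, neg_add_cancel, T_zero]

/-! ### Units commuting up to a power of `q` -/

section QuasiCommute

variable {A : Type*} [Ring A] [Algebra Coeff A]

/-- The elements `x` and `y` commute up to a power of the variable. -/
def QuasiCommute (x y : A) : Prop := ∃ n : ℤ, x * y = (T n : Coeff) • (y * x)

theorem QuasiCommute.symm {x y : A} (h : QuasiCommute x y) : QuasiCommute y x := by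
  obtain ⟨n, hn⟩ := h
  exact ⟨-n, by rw [hn, smul_smul, ← T_add, neg_add_cancel, T_zero, one_smul]⟩

theorem QuasiCommute.mul_right {x y z : A} (h : QuasiCommute x y) (h' : QuasiCommute x z) :
    QuasiCommute x (y * z) := by
  obtain ⟨n, hn⟩ := h
  obtain ⟨n', hn'⟩ := h'
  exact ⟨n + n', by
    rw [← mul_assoc, hn, smul_mul_assoc, mul_assoc, hn', mul_smul_comm, smul_smul, ← T_add,
      mul_assoc]⟩

theorem QuasiCommute.one_right (x : A) : QuasiCommute x 1 :=
  ⟨0, by rw [T_zero, one_smul, mul_one, one_mul]⟩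

theorem QuasiCommute.inv_right {x : A} {u : Aˣ} (h : QuasiCommute x u) :
    QuasiCommute x ↑u⁻¹ := by
  obtain ⟨n, hn⟩ := h.symm
  refine ⟨n, ?_⟩
  have h1 : (↑u⁻¹ : A) * (u * x) * ↑u⁻¹ = (↑u⁻¹ : A) * ((T n : Coeff) • (x * u)) * ↑u⁻¹ := by
    rw [hn]
  rw [mul_smul_comm, smul_mul_assoc] at h1
  simpa [← mul_assoc, mul_assoc x] using h1

theorem QuasiCommute.zpow_right {x : A} {u : Aˣ} (h : QuasiCommute x u) (n : ℤ) :
    QuasiCommute x ↑(u ^ n) := by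
  induction n with
  | zero => simpa using QuasiCommute.one_right x
  | succ n ih =>
    rw [zpow_add_one, Units.val_mul]
    exact ih.mul_right h
  | pred n ih =>
    rw [zpow_sub_one, Units.val_mul]
    exact ih.mul_right h.inv_right

theorem exists_zpow_mul_prod {S : Type*} [DecidableEq S] {u : S → Aˣ}
    (hu : ∀ s t, QuasiCommute (u s : A) (u t)) (s : S) (m : ℤ) (a : S → ℤ) (l : List S)
    (hl : l.Nodup) (hs : s ∈ l) :
    ∃ n : ℤ, (↑(u s ^ m) : A) * ↑(l.map fun t => u t ^ a t).prod =
      (T n : Coeff) • ↑(l.map fun t => u t ^ Function.update a s (a s + m) t).prod := by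
  induction l with
  | nil => simp at hs
  | cons t l ih =>
    rw [List.nodup_cons] at hl
    simp only [List.map_cons, List.prod_cons, Units.val_mul]
    by_cases hst : s = t
    · subst hst
      refine ⟨0, ?_⟩
      have h : (l.map fun t => u t ^ Function.update a s (a s + m) t) =
          l.map fun t => u t ^ a t := by
        refine List.map_congr_left fun r hr => ?_
        rw [Function.update_of_ne]
        rintro rfl
        exact hl.1 hr
      rw [h, Function.update_self, T_zero, one_smul, ← mul_assoc, ← Units.val_mul, ← zpow_add,
        add_comm]
    · obtain ⟨n, hn⟩ := ih hl.2 (by simpa [hst] using hs)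
      obtain ⟨n', hn'⟩ := (((hu s t).zpow_right (a t)).symm.zpow_right m).symm
      refine ⟨n' + n, ?_⟩
      rw [Function.update_of_ne (Ne.symm hst), ← mul_assoc, hn', smul_mul_assoc, mul_assoc, hn,
        mul_smul_comm, smul_smul, T_add]

end QuasiCommute

variable {S : Type*} (e : S → S → ℚ)

/-- The generator `X_a`, as a unit. -/
def genUnit (a : S) : (QuantumTorus e)ˣ where
  val := gen e a
  inv := genInv e a
  val_inv := gen_mul_genInv e a
  inv_val := genInv_mul_gen e a

theorem quasiCommute_genUnit (a b : S) :
    QuasiCommute (genUnit e a : QuantumTorus e) (genUnit e b) :=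
  ⟨⌊2 * e a b⌋, gen_mul_gen e a b⟩

theorem adjoin_gen : Algebra.adjoin Coeff (Set.range (gen e) ∪ Set.range (genInv e)) = ⊤ := by
  have h1 : (RingQuot.mkAlgHom Coeff (TorusRel e)).range = ⊤ :=
    (AlgHom.range_eq_top _).2 (RingQuot.mkAlgHom_surjective Coeff (TorusRel e))
  rw [← h1, ← Algebra.map_top, ← FreeAlgebra.adjoin_range_ι, AlgHom.map_adjoin]
  congr 1
  ext x
  simp only [Set.mem_union, Set.mem_range, Set.mem_image, gen, genInv, Sum.exists]
  constructor
  · rintro (⟨y, h⟩ | ⟨y, h⟩)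
    · exact ⟨_, Or.inl ⟨y, rfl⟩, h⟩
    · exact ⟨_, Or.inr ⟨y, rfl⟩, h⟩
  · rintro ⟨z, ⟨y, rfl⟩ | ⟨y, rfl⟩, h⟩
    · exact Or.inl ⟨y, h⟩
    · exact Or.inr ⟨y, h⟩

/-- The ordered monomial with the given exponents. -/
def orderedMonomial [Fintype S] (a : S → ℤ) : (QuantumTorus e)ˣ :=
  ((Finset.univ : Finset S).toList.map fun s => genUnit e s ^ a s).prod

/-- The span contains 1 and is stable under left multiplication by the generators and their
inverses: moving a factor to its own place costs only a power of the variable. -/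
theorem span_orderedMonomial [Fintype S] :
    Submodule.span Coeff (Set.range fun a => (orderedMonomial e a : QuantumTorus e)) = ⊤ := by
  classical
  set V := Submodule.span Coeff (Set.range fun a => (orderedMonomial e a : QuantumTorus e))
  have hmul : ∀ (s : S) (m : ℤ), ∀ x ∈ V, ↑(genUnit e s ^ m) * x ∈ V := by
    intro s m x hx
    induction hx using Submodule.span_induction with
    | mem x hx =>
      obtain ⟨a, rfl⟩ := hx
      obtain ⟨n, hn⟩ := exists_zpow_mul_prod (quasiCommute_genUnit e) s m a
        (Finset.univ : Finset S).toList (Finset.nodup_toList _) (by simp)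
      simp only [orderedMonomial]
      rw [hn]
      exact V.smul_mem _ (Submodule.subset_span ⟨_, rfl⟩)
    | zero => simp
    | add x y _ _ hx hy => rw [mul_add]; exact V.add_mem hx hy
    | smul c x _ hx => rw [mul_smul_comm]; exact V.smul_mem _ hx
  have h1 : (1 : QuantumTorus e) ∈ V := Submodule.subset_span ⟨0, by simp [orderedMonomial]⟩
  have key : ∀ x ∈ Algebra.adjoin Coeff (Set.range (gen e) ∪ Set.range (genInv e)),
      ∀ y ∈ V, x * y ∈ V := by
    intro x hx
    induction hx using Algebra.adjoin_induction with
    | mem x hx =>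
      rcases hx with ⟨s, rfl⟩ | ⟨s, rfl⟩
      · have h := hmul s 1
        rwa [zpow_one] at h
      · have h := hmul s (-1)
        rwa [zpow_neg_one] at h
    | algebraMap c =>
      intro y hy
      rw [← Algebra.smul_def]
      exact V.smul_mem _ hy
    | add x x' _ _ hx hx' =>
      intro y hy
      rw [add_mul]
      exact V.add_mem (hx y hy) (hx' y hy)
    | mul x x' _ _ hx hx' =>
      intro y hy
      rw [mul_assoc]
      exact hx _ (hx' y hy)
  rw [eq_top_iff]
  intro x _
  simpa using key x (by rw [adjoin_gen]; trivial) 1 h1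

/-! ### Homomorphisms out of a quantum torus -/

section Lift

variable {B : Type*} [Ring B] [Algebra Coeff B] (y : S → Bˣ)
  (hy : ∀ a b, (y a * y b : B) = qpow (e a b) • (y b * y a : B))

/-- The homomorphism from a quantum torus given by the images of the generators. -/
def torusLift : QuantumTorus e →ₐ[Coeff] B :=
  RingQuot.liftAlgHom Coeff
    ⟨FreeAlgebra.lift Coeff (Sum.elim (fun a => (y a : B)) fun a => ↑(y a)⁻¹), by
      intro x x' h
      induction h with
      | mul_inv a => simp
      | inv_mul a => simp
      | comm a b => simpa using hy a b⟩

theorem torusLift_gen (a : S) : torusLift e y hy (gen e a) = y a := by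
  rw [torusLift, gen, RingQuot.liftAlgHom_mkAlgHom_apply, FreeAlgebra.lift_ι_apply]
  rfl

theorem torusLift_genInv (a : S) : torusLift e y hy (genInv e a) = ↑(y a)⁻¹ := by
  rw [torusLift, genInv, RingQuot.liftAlgHom_mkAlgHom_apply, FreeAlgebra.lift_ι_apply]
  rfl

theorem map_torusLift_genUnit (a : S) :
    Units.map (torusLift e y hy : QuantumTorus e →* B) (genUnit e a) = y a :=
  Units.ext (torusLift_gen e y hy a)

theorem torusLift_orderedMonomial [Fintype S] (a : S → ℤ) :
    torusLift e y hy (orderedMonomial e a) =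
      ((Finset.univ : Finset S).toList.map fun s => y s ^ a s).prod := by
  have h := map_list_prod (Units.map (torusLift e y hy : QuantumTorus e →* B))
    ((Finset.univ : Finset S).toList.map fun s => genUnit e s ^ a s)
  rw [List.map_map] at h
  refine (congrArg Units.val h).trans ?_
  congr 2
  refine List.map_congr_left fun s _ => ?_
  rw [Function.comp_apply, map_zpow, map_torusLift_genUnit]

theorem range_torusLift : (torusLift e y hy).range =
    Algebra.adjoin Coeff (Set.range (fun a => (y a : B)) ∪ Set.range fun a => (↑(y a)⁻¹ : B)) := by
  rw [← Algebra.map_top, ← adjoin_gen, AlgHom.map_adjoin, Set.image_union, ← Set.range_comp,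
    ← Set.range_comp]
  congr 2
  · exact congrArg Set.range (funext (torusLift_gen e y hy))
  · exact congrArg Set.range (funext (torusLift_genInv e y hy))

end Lift

/-! ### The regular representation -/

/-- An operator which is homogeneous of degree `d` and maps monomials to monomials. -/
def IsMonomialOp (d : S →₀ ℤ) (f : Module.End Coeff ((S →₀ ℤ) →₀ Coeff)) : Prop :=
  ∀ c, ∃ n : ℤ, f (Finsupp.single c 1) = Finsupp.single (c + d) (T n)

theorem single_T (c : S →₀ ℤ) (n : ℤ) :
    (Finsupp.single c (T n) : (S →₀ ℤ) →₀ Coeff) = (T n : Coeff) • Finsupp.single c 1 := by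
  simp

theorem IsMonomialOp.one : IsMonomialOp (0 : S →₀ ℤ) 1 := fun c => ⟨0, by simp⟩

theorem IsMonomialOp.mul {d d' : S →₀ ℤ} {f g : Module.End Coeff ((S →₀ ℤ) →₀ Coeff)}
    (hf : IsMonomialOp d f) (hg : IsMonomialOp d' g) : IsMonomialOp (d + d') (f * g) := by
  intro c
  obtain ⟨n, hn⟩ := hg c
  obtain ⟨m, hm⟩ := hf (c + d')
  refine ⟨n + m, ?_⟩
  rw [Module.End.mul_apply, hn, single_T, map_smul, hm, Finsupp.smul_single, smul_eq_mul, ← T_add,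
    add_assoc, add_comm d' d]

theorem IsMonomialOp.inv {d : S →₀ ℤ} {u : (Module.End Coeff ((S →₀ ℤ) →₀ Coeff))ˣ}
    (hu : IsMonomialOp d u) : IsMonomialOp (-d) (↑u⁻¹ : Module.End Coeff _) := by
  intro c
  obtain ⟨n, hn⟩ := hu (c + -d)
  refine ⟨-n, ?_⟩
  rw [neg_add_cancel_right, single_T] at hn
  have h := congrArg (↑u⁻¹ : Module.End Coeff _) hn
  rw [← Module.End.mul_apply, Units.inv_mul, map_smul, Module.End.one_apply] at h
  rw [single_T, h, smul_smul, ← T_add, neg_add_cancel, T_zero, one_smul]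

theorem IsMonomialOp.zpow {d : S →₀ ℤ} {u : (Module.End Coeff ((S →₀ ℤ) →₀ Coeff))ˣ}
    (hu : IsMonomialOp d u) (n : ℤ) : IsMonomialOp (n • d) (↑(u ^ n) : Module.End Coeff _) := by
  induction n with
  | zero => simpa using IsMonomialOp.one
  | succ n ih =>
    rw [zpow_add_one, Units.val_mul, add_smul, one_smul]
    exact ih.mul hu
  | pred n ih =>
    rw [zpow_sub_one, Units.val_mul, sub_smul, one_smul, sub_eq_add_neg]
    exact ih.mul hu.inv

theorem IsMonomialOp.list_prod {R : Type*} (l : List R) (d : R → S →₀ ℤ)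
    (u : R → (Module.End Coeff ((S →₀ ℤ) →₀ Coeff))ˣ) (hu : ∀ r ∈ l, IsMonomialOp (d r) (u r)) :
    IsMonomialOp (l.map d).sum (↑(l.map u).prod : Module.End Coeff _) := by
  induction l with
  | nil => simpa using IsMonomialOp.one
  | cons r l ih =>
    simp only [List.map_cons, List.sum_cons, List.prod_cons, Units.val_mul]
    exact (hu r (by simp)).mul (ih fun s hs => hu s (by simp [hs]))

/-- The operator sending the basis vector `c` to the multiple of `c + d` by `T (f c)`. -/
def shiftOp (f : (S →₀ ℤ) → ℤ) (d : S →₀ ℤ) : Module.End Coeff ((S →₀ ℤ) →₀ Coeff) :=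
  Finsupp.linearCombination Coeff fun c => Finsupp.single (c + d) (T (f c))

theorem shiftOp_single (f : (S →₀ ℤ) → ℤ) (d c : S →₀ ℤ) :
    shiftOp f d (Finsupp.single c 1) = Finsupp.single (c + d) (T (f c)) := by
  simp [shiftOp]

theorem shiftOp_mul_single (f f' : (S →₀ ℤ) → ℤ) (d d' c : S →₀ ℤ) :
    (shiftOp f d * shiftOp f' d') (Finsupp.single c 1) =
      Finsupp.single (c + d' + d) (T (f' c + f (c + d'))) := by
  rw [Module.End.mul_apply, shiftOp_single, single_T, map_smul, shiftOp_single,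
    Finsupp.smul_single, smul_eq_mul, ← T_add]

theorem end_ext {f g : Module.End Coeff ((S →₀ ℤ) →₀ Coeff)}
    (h : ∀ c, f (Finsupp.single c 1) = g (Finsupp.single c 1)) : f = g :=
  Finsupp.lhom_ext' fun c => LinearMap.ext_ring (h c)

-- Integral exponents are used because `qpow` involves a floor and is additive only on
-- half-integers.
variable {e} {E : S → S → ℤ} (hE : ∀ a b, e a b = E a b) (hs : ∀ a b, E a b = -E b a)

/-- The action of the generator `X_a` on the regular representation. -/
def genOp (hs : ∀ a b, E a b = -E b a) (a : S) : (Module.End Coeff ((S →₀ ℤ) →₀ Coeff))ˣ where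
  val := shiftOp (fun c => Finsupp.linearCombination ℤ (E a) c) (Finsupp.single a 1)
  inv := shiftOp (fun c => -Finsupp.linearCombination ℤ (E a) c) (-Finsupp.single a 1)
  val_inv := end_ext fun c => by
    have : E a a = 0 := by have := hs a a; omega
    rw [shiftOp_mul_single]
    simp [this]
  inv_val := end_ext fun c => by
    have : E a a = 0 := by have := hs a a; omega
    rw [shiftOp_mul_single]
    simp [this]

/-- The regular representation of a quantum torus. -/
def regularRep : QuantumTorus e →ₐ[Coeff] Module.End Coeff ((S →₀ ℤ) →₀ Coeff) :=
  torusLift e (genOp hs) fun a b => end_ext fun c => by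
    rw [hE, qpow_intCast, LinearMap.smul_apply]
    simp only [genOp]
    rw [shiftOp_mul_single, shiftOp_mul_single, Finsupp.smul_single, smul_eq_mul, ← T_add,
      add_right_comm c]
    congr 2
    simp only [map_add, Finsupp.linearCombination_single, smul_eq_mul, one_mul]
    -- The generator X_a twists the basis vector c only by the power E(a,c) of q^{1/2}. The two
    -- orders then differ by E(a,b) - E(b,a) = 2E(a,b), which is the exponent of q^{1/2} in
    -- q^{E(a,b)}.
    have := hs b a
    omega

theorem isMonomialOp_regularRep (a : S) :
    IsMonomialOp (Finsupp.single a 1) (regularRep hE hs (genUnit e a)) := by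
  intro c
  have h : regularRep hE hs (genUnit e a) = genOp hs a := torusLift_gen e _ _ a
  rw [h]
  exact ⟨_, shiftOp_single _ _ _⟩

/-- Applied to the basis vector 0 of the regular representation, the images of the ordered monomials
are unit multiples of distinct basis vectors. So no nontrivial combination of them is killed. -/
theorem torusLift_injective {R : Type*} [Fintype R] {e' : R → R → ℚ}
    (y : R → (QuantumTorus e)ˣ)
    (hy : ∀ a b, (y a * y b : QuantumTorus e) = qpow (e' a b) • (y b * y a : QuantumTorus e))
    (D : R → S →₀ ℤ) (hD : ∀ r, IsMonomialOp (D r) (regularRep hE hs (y r)))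
    (hinj : ∀ a : R → ℤ, ∑ r, a r • D r = 0 → a = 0) :
    Function.Injective (torusLift e' (B := QuantumTorus e) y hy) := by
  classical
  let ρ := regularRep hE hs
  have hD1 (r : R) : IsMonomialOp (D r) (↑(Units.map
      (ρ : QuantumTorus e →* Module.End Coeff ((S →₀ ℤ) →₀ Coeff)) (y r)) :
      Module.End Coeff ((S →₀ ℤ) →₀ Coeff)) := hD r
  have h1 : ∀ a : R → ℤ, ∃ n : ℤ, ρ (torusLift e' y hy (orderedMonomial e' a))
      (Finsupp.single 0 1) = Finsupp.single (∑ r, a r • D r) (T n) := by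
    intro a
    have h2 := IsMonomialOp.list_prod (Finset.univ : Finset R).toList (fun r => a r • D r)
      (fun r => Units.map (ρ : QuantumTorus e →* _) (y r) ^ a r)
      (fun r _ => by exact (hD1 r).zpow (a r))
    obtain ⟨n, hn⟩ := h2 0
    refine ⟨n, ?_⟩
    rw [zero_add, Finset.sum_map_toList] at hn
    rw [← hn, torusLift_orderedMonomial]
    have h3 := map_list_prod (Units.map
      (ρ : QuantumTorus e →* Module.End Coeff ((S →₀ ℤ) →₀ Coeff)))
      ((Finset.univ : Finset R).toList.map fun s => y s ^ a s)
    rw [List.map_map] at h3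
    refine congrArg (fun f : Module.End Coeff ((S →₀ ℤ) →₀ Coeff) => f (Finsupp.single 0 1))
      ((congrArg Units.val h3).trans ?_)
    congr 2
    exact List.map_congr_left fun s _ => by rw [Function.comp_apply, map_zpow]
  choose n hn using h1
  have hD' : Function.Injective fun a : R → ℤ => ∑ r, a r • D r := by
    intro a a' h
    refine sub_eq_zero.1 (hinj (a - a') ?_)
    simpa [sub_smul, sub_eq_zero] using h
  rw [injective_iff_map_eq_zero]
  intro x hx
  have hx' : x ∈ Submodule.span Coeff
      (Set.range fun a => (orderedMonomial e' a : QuantumTorus e')) := by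
    rw [span_orderedMonomial]; trivial
  obtain ⟨c, rfl⟩ := (Finsupp.mem_span_range_iff_exists_finsupp).1 hx'
  have h2 : (c.sum fun a k => Finsupp.single (∑ r, a r • D r) (k * T (n a)) :
      (S →₀ ℤ) →₀ Coeff) = 0 := by
    have h3 := congrArg (fun z => ρ z (Finsupp.single 0 1)) hx
    simp only [map_finsuppSum, map_smul, map_zero, LinearMap.zero_apply] at h3
    rw [← h3, Finsupp.sum, Finsupp.sum, LinearMap.sum_apply]
    refine Finset.sum_congr rfl fun a _ => ?_
    rw [LinearMap.smul_apply, hn, Finsupp.smul_single, smul_eq_mul]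
  have h3 : c = 0 := by
    ext1 a
    have h4 := DFunLike.congr_fun h2 (∑ r, a r • D r)
    rw [Finsupp.sum, Finsupp.finsetSum_apply, Finset.sum_eq_single a] at h4
    · rw [Finsupp.single_eq_same] at h4
      have h5 := (unitT (n a)).isUnit.mul_left_eq_zero.1 h4
      exact h5
    · intro a' _ ha'
      exact Finsupp.single_eq_of_ne fun h => ha' (hD' h).symm
    · intro ha
      rw [Finsupp.notMem_support_iff.1 ha, zero_mul, Finsupp.single_zero, Finsupp.zero_apply]
  rw [h3, Finsupp.sum_zero_index]

/-! ### Products of generators -/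

variable (e) in
/-- The multiple by `T n` of the product of the generators in a list. -/
def monomialUnit (n : ℤ) (l : List S) : (QuantumTorus e)ˣ :=
  Units.map (algebraMap Coeff (QuantumTorus e) : Coeff →* QuantumTorus e) (unitT n) *
    (l.map (genUnit e)).prod

theorem val_prod_genUnit (l : List S) :
    ((l.map (genUnit e)).prod : QuantumTorus e) = (l.map (gen e)).prod := by
  induction l with
  | nil => rfl
  | cons a l ih =>
    rw [List.map_cons, List.prod_cons, Units.val_mul, ih, List.map_cons, List.prod_cons]
    rfl

theorem val_monomialUnit (n : ℤ) (l : List S) :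
    (monomialUnit e n l : QuantumTorus e) = (T n : Coeff) • (l.map (gen e)).prod := by
  rw [monomialUnit, Units.val_mul, val_prod_genUnit, Algebra.smul_def]
  rfl

include hE in
theorem gen_mul_prod_gen (a : S) (l : List S) : gen e a * (l.map (gen e)).prod =
    (T (2 * (l.map (E a)).sum) : Coeff) • ((l.map (gen e)).prod * gen e a) := by
  induction l with
  | nil => simp
  | cons b l ih =>
    simp only [List.map_cons, List.prod_cons, List.sum_cons]
    rw [← mul_assoc, gen_mul_gen, hE, qpow_intCast, smul_mul_assoc, mul_assoc, ih, mul_smul_comm,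
      smul_smul, ← T_add, mul_assoc, mul_add]

include hE in
theorem prod_gen_mul_prod_gen (l l' : List S) : (l.map (gen e)).prod * (l'.map (gen e)).prod =
    (T (2 * (l.map fun a => (l'.map (E a)).sum).sum) : Coeff) •
      ((l'.map (gen e)).prod * (l.map (gen e)).prod) := by
  induction l with
  | nil => simp
  | cons a l ih =>
    simp only [List.map_cons, List.prod_cons, List.sum_cons]
    rw [mul_assoc, ih, mul_smul_comm, ← mul_assoc, gen_mul_prod_gen hE, smul_mul_assoc, smul_smul,
      ← T_add, mul_assoc, mul_add, add_comm]

include hE in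
theorem monomialUnit_mul_monomialUnit (n n' : ℤ) (l l' : List S) :
    (monomialUnit e n l * monomialUnit e n' l' : QuantumTorus e) =
      qpow ((l.map fun a => (l'.map (E a)).sum).sum : ℤ) •
        (monomialUnit e n' l' * monomialUnit e n l : QuantumTorus e) := by
  rw [val_monomialUnit, val_monomialUnit, smul_mul_smul_comm, smul_mul_smul_comm,
    prod_gen_mul_prod_gen hE, qpow_intCast, smul_smul, smul_smul]
  congr 1
  ring

include hE in
theorem exists_bar_prod_gen {d : S → ℚ} (hd : ∀ a, ∃ n : ℤ, d a = n) (l : List S) :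
    ∃ n : ℤ, bar e d (l.map (gen e)).prod = (T (2 * n) : Coeff) • (l.map (gen e)).prod := by
  induction l with
  | nil => exact ⟨0, by simp [bar_one]⟩
  | cons a l ih =>
    obtain ⟨n, hn⟩ := ih
    obtain ⟨m, hm⟩ := hd a
    refine ⟨n + m - (l.map (E a)).sum, ?_⟩
    rw [List.map_cons, List.prod_cons, bar_mul, bar_gen, hn, hm, qpow_intCast, gen_mul_prod_gen hE,
      smul_mul_smul_comm, smul_smul, ← T_add, ← T_add]
    congr 2
    ring

-- The bar map multiplies the product of generators by an even power of q^{1/2}, since all exponents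
-- and all d_a are integers. Half of that power is the required normalization.
include hE in
theorem exists_bar_monomialUnit {d : S → ℚ} (hd : ∀ a, ∃ n : ℤ, d a = n) (l : List S) :
    ∃ n : ℤ, bar e d (monomialUnit e n l) = monomialUnit e n l := by
  obtain ⟨n, hn⟩ := exists_bar_prod_gen hE hd l
  refine ⟨n, ?_⟩
  rw [val_monomialUnit, bar_smul, invert_T, hn, smul_smul, ← T_add]
  congr 2
  ring

theorem isMonomialOp_monomialUnit (n : ℤ) (l : List S) :
    IsMonomialOp (l.map fun a => Finsupp.single a 1).sum
      (regularRep hE hs (monomialUnit e n l)) := by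
  have h : ∀ l : List S, IsMonomialOp (l.map fun a => Finsupp.single a 1).sum
      (regularRep hE hs (l.map (gen e)).prod) := by
    intro l
    induction l with
    | nil => simpa using IsMonomialOp.one
    | cons a l ih =>
      simp only [List.map_cons, List.sum_cons, List.prod_cons, map_mul]
      exact (isMonomialOp_regularRep hE hs a).mul ih
  intro c
  obtain ⟨m, hm⟩ := h l c
  refine ⟨n + m, ?_⟩
  rw [val_monomialUnit, map_smul, LinearMap.smul_apply, hm, Finsupp.smul_single, smul_eq_mul,
    T_add]

theorem monomialUnit_mem_units {R : Subalgebra Coeff (QuantumTorus e)} (n : ℤ) {l : List S}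
    (hl : ∀ a ∈ l, genUnit e a ∈ R.toSubmonoid.units) :
    monomialUnit e n l ∈ R.toSubmonoid.units := by
  refine mul_mem ((Submonoid.mem_units_iff _ _).2 ⟨R.algebraMap_mem _, R.algebraMap_mem _⟩)
    (Subgroup.list_prod_mem _ ?_)
  simpa using hl

/-- Up to scalars, the generator is the quotient of two monomials whose lists differ by its letter.
-/
theorem genUnit_mem_units {R : Subalgebra Coeff (QuantumTorus e)} {n n' : ℤ} {a : S} {l : List S}
    (h : monomialUnit e n (a :: l) ∈ R.toSubmonoid.units)
    (h' : monomialUnit e n' l ∈ R.toSubmonoid.units) : genUnit e a ∈ R.toSubmonoid.units := by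
  have h0 (m : ℤ) : Units.map (algebraMap Coeff (QuantumTorus e) : Coeff →* QuantumTorus e)
      (unitT m) ∈ R.toSubmonoid.units :=
    (Submonoid.mem_units_iff _ _).2 ⟨R.algebraMap_mem _, R.algebraMap_mem _⟩
  rw [monomialUnit, Subgroup.mul_mem_cancel_left _ (h0 _)] at h h'
  rwa [List.map_cons, List.prod_cons, Subgroup.mul_mem_cancel_right _ h'] at h

/-- A family of units generating the subtorus on a set of generators, with independent degrees,
identifies that subtorus with the quantum torus given by the commutation relations of the family. -/
theorem exists_algEquiv_adjoin {R : Type*} {e' : R → R → ℚ} (G : Set S) (y : R → (QuantumTorus e)ˣ)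
    (hy : ∀ a b, (y a * y b : QuantumTorus e) = qpow (e' a b) • (y b * y a : QuantumTorus e))
    (hinj : Function.Injective (torusLift e' (B := QuantumTorus e) y hy))
    (h1 : ∀ A : Subalgebra Coeff (QuantumTorus e),
      (∀ a ∈ G, genUnit e a ∈ A.toSubmonoid.units) → ∀ r, y r ∈ A.toSubmonoid.units)
    (h2 : ∀ A : Subalgebra Coeff (QuantumTorus e),
      (∀ r, y r ∈ A.toSubmonoid.units) → ∀ a ∈ G, genUnit e a ∈ A.toSubmonoid.units) :
    ∃ Ψ : QuantumTorus e' ≃ₐ[Coeff] Algebra.adjoin Coeff (gen e '' G ∪ genInv e '' G),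
      ∀ r, (Ψ (gen e' r) : QuantumTorus e) = y r := by
  have hrange : (torusLift e' (B := QuantumTorus e) y hy).range =
      Algebra.adjoin Coeff (gen e '' G ∪ genInv e '' G) := by
    refine (range_torusLift e' (B := QuantumTorus e) y hy).trans (le_antisymm ?_ ?_)
    · have h3 (r : R) := (Submonoid.mem_units_iff _ _).1 (h1
        (Algebra.adjoin Coeff (gen e '' G ∪ genInv e '' G)) (fun a ha =>
          (Submonoid.mem_units_iff _ _).2 ⟨Algebra.subset_adjoin (Or.inl ⟨a, ha, rfl⟩),
            Algebra.subset_adjoin (Or.inr ⟨a, ha, rfl⟩)⟩) r)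
      refine Algebra.adjoin_le (Set.union_subset ?_ ?_)
      · rintro _ ⟨r, rfl⟩
        exact (h3 r).1
      · rintro _ ⟨r, rfl⟩
        exact (h3 r).2
    · have h3 (a : S) (ha : a ∈ G) := (Submonoid.mem_units_iff _ _).1 (h2
        (Algebra.adjoin Coeff (Set.range (fun r => (y r : QuantumTorus e)) ∪
          Set.range fun r => (↑(y r)⁻¹ : QuantumTorus e))) (fun r =>
          (Submonoid.mem_units_iff _ _).2 ⟨Algebra.subset_adjoin (Or.inl ⟨r, rfl⟩),
            Algebra.subset_adjoin (Or.inr ⟨r, rfl⟩)⟩) a ha)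
      refine Algebra.adjoin_le (Set.union_subset ?_ ?_)
      · rintro _ ⟨a, ha, rfl⟩
        exact (h3 a ha).1
      · rintro _ ⟨a, ha, rfl⟩
        exact (h3 a ha).2
  refine ⟨(AlgEquiv.ofInjective _ hinj).trans (Subalgebra.equivOfEq _ _ hrange), fun r => ?_⟩
  exact torusLift_gen e' (B := QuantumTorus e) y hy r

end Monomials

namespace DynkinQuiver

variable {ι M N : Type*} [AddCommGroup M] [Module ℚ M] [AddCommGroup N] [Module ℚ N]
variable {P : RootPairing ι ℚ M N} {b : P.Base} (Q : DynkinQuiver b)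

/-! ## Rows of the repetition quiver -/

variable {Q} in
/-- The vertices `(i,t)` with `t = p, p + 2, …`, `t ≤ ξ_i`, for a vertex `(i,p)`. -/
def row (v : Q.Vertex) : List Q.Vertex :=
  (List.range ((Q.height v.1.1 - v.1.2) / 2 + 1).toNat).map (shift v)

theorem shift_shift (v : Q.Vertex) (k l : ℕ) : shift (shift v k) l = shift v (k + l) := by
  refine Subtype.ext (Prod.ext rfl ?_)
  change v.1.2 + 2 * (k : ℤ) + 2 * (l : ℤ) = v.1.2 + 2 * ((k + l : ℕ) : ℤ)
  push_cast
  ring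

theorem shift_zero (v : Q.Vertex) : shift v 0 = v :=
  Subtype.ext (Prod.ext rfl (by simp [shift]))

theorem row_eq_cons (v : Q.Vertex) (hv : v.1.2 ≤ Q.height v.1.1) :
    row v = v :: row (shift v 1) := by
  have h : ((Q.height v.1.1 - v.1.2) / 2 + 1).toNat =
      ((Q.height (shift v 1).1.1 - (shift v 1).1.2) / 2 + 1).toNat + 1 := by
    change _ = ((Q.height v.1.1 - (v.1.2 + 2 * ((1 : ℕ) : ℤ))) / 2 + 1).toNat + 1
    omega
  rw [row, row, h, List.range_succ_eq_map, List.map_cons, List.map_map, shift_zero]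
  congr 1
  refine List.map_congr_left fun k _ => ?_
  rw [Function.comp_apply, shift_shift, add_comm]

theorem row_eq_nil (v : Q.Vertex) (hv : Q.height v.1.1 < v.1.2) : row v = [] := by
  have h : ((Q.height v.1.1 - v.1.2) / 2 + 1).toNat = 0 := by omega
  rw [row, h]
  rfl

theorem mem_row {v v' : Q.Vertex} (h : v' ∈ row v) :
    v'.1.1 = v.1.1 ∧ v.1.2 ≤ v'.1.2 ∧ v'.1.2 ≤ Q.height v.1.1 := by
  obtain ⟨k, hk, rfl⟩ := List.mem_map.1 h
  rw [List.mem_range] at hk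
  refine ⟨rfl, ?_⟩
  change v.1.2 ≤ v.1.2 + 2 * (k : ℤ) ∧ v.1.2 + 2 * (k : ℤ) ≤ _
  omega

variable {Q} in
/-- The linear map sending the basis vector at `(i,p)` to its difference with that at `(i,p+2)`. -/
def differenceMap : (Q.Vertex →₀ ℤ) →ₗ[ℤ] (Q.Vertex →₀ ℤ) :=
  Finsupp.linearCombination ℤ fun v => Finsupp.single v 1 - Finsupp.single (shift v 1) 1

theorem differenceMap_row (v : Q.Vertex) :
    differenceMap ((row v).map fun a => (Finsupp.single a 1 : Q.Vertex →₀ ℤ)).sum =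
      Finsupp.single v 1 -
        Finsupp.single (shift v ((Q.height v.1.1 - v.1.2) / 2 + 1).toNat) 1 := by
  rw [row]
  generalize ((Q.height v.1.1 - v.1.2) / 2 + 1).toNat = n
  induction n with
  | zero => simp [shift_zero]
  | succ n ih =>
    rw [List.range_succ, List.map_append, List.map_append, List.sum_append, map_add, ih]
    simp [differenceMap, shift_shift]

/-- Under `differenceMap` the degree of a row collapses to its lowest vertex minus a vertex above
ξ_i. The latter never equals any `y s`, so the coefficient at `y s` is exactly `a s`. -/
theorem eq_zero_of_sum_row {R : Type*} [Fintype R] {y : R → Q.Vertex}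
    (hy : Function.Injective y) (hle : ∀ r, (y r).1.2 ≤ Q.height (y r).1.1) (a : R → ℤ)
    (h : ∑ r, a r • ((row (y r)).map fun c => (Finsupp.single c 1 : Q.Vertex →₀ ℤ)).sum = 0) :
    a = 0 := by
  classical
  funext s
  have h1 := DFunLike.congr_fun (congrArg differenceMap h) (y s)
  rw [map_sum, Finsupp.finsetSum_apply, Finset.sum_eq_single s] at h1
  · rw [map_smul, differenceMap_row, Finsupp.smul_apply, Finsupp.sub_apply, Finsupp.single_eq_same,
      Finsupp.single_eq_of_ne, sub_zero, smul_eq_mul, mul_one] at h1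
    · simpa using h1
    · intro h2
      have h3 := congrArg (fun v : Q.Vertex => v.1.2) h2
      have h4 := hle s
      simp only [shift] at h3
      omega
  · intro r _ hr
    rw [map_smul, differenceMap_row, Finsupp.smul_apply, Finsupp.sub_apply,
      Finsupp.single_eq_of_ne (fun h => hr (hy h).symm), Finsupp.single_eq_of_ne, sub_zero,
      smul_zero]
    intro h2
    have h3 := congrArg (fun v : Q.Vertex => v.1.2) h2
    have h5 := congrArg (fun v : Q.Vertex => v.1.1) h2
    have h4 := hle s
    have h6 := hle r
    simp only [shift] at h3 h5
    rw [h5] at h4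
    omega
  · simp

/-! ## Heights after prefixes of a word -/

theorem heightAfter_take_succ (w : List b.support) (k : Fin w.length) :
    heightAfter Q.height (w.take (k + 1)) (w.get k) = (Q.letterVertex w k).1.2 - 2 := by
  rw [List.take_succ_eq_append_getElem k.2, heightAfter_concat]
  exact reflectHeight_self _ _

theorem letterVertex_le_heightAfter_take (w : List b.support) {k l : Fin w.length} (h : k < l) :
    (Q.letterVertex w l).1.2 ≤ heightAfter Q.height (w.take (k + 1)) (w.get l) := by
  have h1 : w.take l = w.take (k + 1) ++ (w.take l).drop (k + 1) := by
    conv_lhs => rw [← List.take_append_drop (k + 1) (w.take l)]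
    rw [List.take_take, min_eq_left]
    exact h
  change heightAfter Q.height (w.take l) (w.get l) ≤ _
  rw [h1, heightAfter_append]
  exact heightAfter_le _ _ _

theorem isAdapted_take {w : List b.support} {ξ : b.support → ℤ} (hw : IsAdapted ξ w) (n : ℕ) :
    IsAdapted ξ (w.take n) := by
  rw [← List.take_append_drop n w, isAdapted_append] at hw
  exact hw.1

/-! ## The commutation exponents -/

section Weights

variable [Finite ι] [P.IsCrystallographic] [P.IsReduced] [P.IsRootSystem]
variable {Q} {w : List b.support}

theorem resWeight_wordRoot (hw : IsLongestWord b w) (k : Fin w.length) :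
    resWeight b w (wordRoot b w k) = fundWeight b (w.get k) := by
  have h : ∃ l, wordRoot b w l = wordRoot b w k := ⟨k, rfl⟩
  rw [resWeight, dif_pos h, hw.isPosWord.wordRoot_injective b h.choose_spec]

theorem lamWeight_wordRoot (hw : Q.IsLongestAdapted w) (k : Fin w.length) :
    lamWeight b w (wordRoot b w k) =
      Q.weightAt (w.get k) ((Q.letterVertex w k).1.2 - 2) := by
  have h : ∃ l, wordRoot b w l = wordRoot b w k := ⟨k, rfl⟩
  rw [lamWeight, dif_pos h, hw.1.isPosWord.wordRoot_injective b h.choose_spec,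
    Q.wordProd_fundWeight (isAdapted_take hw.2 _), heightAfter_take_succ]

theorem IsLongestAdapted.exists_wordRoot_eq (hw : Q.IsLongestAdapted w) {x : M}
    (hx : x ∈ posRoots b) : ∃ k, wordRoot b w k = x :=
  (exists_wordRoot_eq_iff b w x).2 ((hw.1.isWordRoot_iff b x).2 hx)

end Weights

variable [Fintype ι] [Nonempty ι]

theorem monomial_eq_prod_row (v : Q.Vertex) :
    Q.monomial v = ((row v).map (gen Q.commExp)).prod := by
  rw [monomial, row, List.map_map]
  rfl

/-- The exponent of the commutation relation between the monomials of two rows. -/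
def rowExp (v v' : Q.Vertex) : ℚ :=
  ((row v).map fun a => ((row v').map (Q.commExp a)).sum).sum

theorem rowExp_eq_sum (v v' : Q.Vertex) : Q.rowExp v v' =
    ∑ k ∈ Finset.range ((Q.height v.1.1 - v.1.2) / 2 + 1).toNat,
      ∑ l ∈ Finset.range ((Q.height v'.1.1 - v'.1.2) / 2 + 1).toNat,
        Q.commExp (shift v k) (shift v' l) := by
  rw [rowExp, row, row, List.map_map]
  simp only [List.map_map]
  rfl

theorem form_coxeter_zpow (n : ℤ) (x y : M) :
    form P ((Q.coxeter ^ n) x) ((Q.coxeter ^ n) y) = form P x y := by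
  have h (x y : M) : form P (Q.coxeter x) (Q.coxeter y) = form P x y := form_wordProd b _ x y
  induction n with
  | zero => rfl
  | succ n ih => rw [add_comm, zpow_one_add, LinearEquiv.mul_apply, LinearEquiv.mul_apply, h, ih]
  | pred n ih =>
    rw [← ih, ← h]
    simp only [← LinearEquiv.mul_apply, ← zpow_one_add]
    congr 3 <;> ring

theorem rowExp_eq_intCast {E : Q.Vertex → Q.Vertex → ℤ} (hE : ∀ v v', Q.commExp v v' = E v v')
    (v v' : Q.Vertex) :
    Q.rowExp v v' = (((row v).map fun a => ((row v').map (E a)).sum).sum : ℤ) := by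
  simp only [rowExp, funext₂ hE, Int.cast_list_sum, List.map_map]
  congr 2
  funext a
  simp only [Function.comp_apply, Int.cast_list_sum, List.map_map]
  rfl

theorem commExp_skew (v v' : Q.Vertex) : Q.commExp v v' = -Q.commExp v' v := by
  have h (i j : b.support) (u : ℤ) : etaTilde b i j u = etaTilde b j i (-u) := by
    rw [etaTilde, etaTilde, neg_neg, bTilde_symm b i j, bTilde_symm b i j, add_comm]
  rw [commExp, commExp, h, h v.1.1]
  ring_nf

theorem rowExp_skew (v v' : Q.Vertex) : Q.rowExp v v' = -Q.rowExp v' v := by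
  rw [rowExp_eq_sum, rowExp_eq_sum, Finset.sum_comm]
  simp only [← Finset.sum_neg_distrib]
  exact Finset.sum_congr rfl fun l _ => Finset.sum_congr rfl fun k _ => Q.commExp_skew _ _

variable [P.IsCrystallographic] [P.IsRootSystem]

theorem form_weightAt_rootAt (i j : b.support) {p r : ℤ} (hp : Even (p - Q.height i))
    (hr : Even (r - Q.height j)) :
    form P (Q.weightAt i p) (Q.rootAt j r) = bOdd b i j (p - r + 1) := by
  obtain ⟨n, hn⟩ := hp
  have h1 : Q.weightAt i p = (Q.coxeter ^ (-n)) (fundWeight b i) := by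
    rw [← weightAt_height, coxeter_zpow_weightAt]
    congr 1
    omega
  have h2 : Q.rootAt j r = (Q.coxeter ^ (-n)) (Q.rootAt j (r - 2 * n)) := by
    rw [coxeter_zpow_rootAt]
    congr 1
    omega
  rw [h1, h2, form_coxeter_zpow, form_fundWeight_rootAt]
  · congr 1
    omega
  · obtain ⟨m, hm⟩ := hr
    exact ⟨m - n, by omega⟩

include Q in
-- A nonzero value is d_i times the α_i-coefficient of a root, and both are integers.
theorem exists_int_bTilde [P.IsReduced] [P.IsIrreducible] (i j : b.support) (u : ℤ) :
    ∃ n : ℤ, bTilde b i j u = n := by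
  by_cases h : bTilde b i j u = 0
  · exact ⟨0, by simp [h]⟩
  have h0 : 0 ≤ u := by
    by_contra! hu
    exact h (bTilde_of_nonpos b i j hu.le)
  obtain ⟨c, hc⟩ := (bTilde_support Q.isHeight h).2
  have hp : Even (Q.height i - u + 1 - Q.height j) := ⟨-c, by omega⟩
  have h1 := Q.form_fundWeight_rootAt i j hp
  rw [form_fundWeight, show Q.height i - (Q.height i - u + 1) + 1 = u by ring,
    bOdd_of_nonneg b i j h0] at h1
  obtain ⟨d, hd⟩ := exists_int_halfNorm b i
  rcases mem_posRoots_or_neg_mem b (Q.rootAt_mem_range j hp) with h2 | h2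
  · obtain ⟨n, hn⟩ := exists_nat_simpleCoord b h2 i
    exact ⟨d * n, by rw [← h1, hd, hn]; push_cast; ring⟩
  · obtain ⟨n, hn⟩ := exists_nat_simpleCoord b h2 i
    rw [map_neg, neg_eq_iff_eq_neg] at hn
    exact ⟨-(d * n), by rw [← h1, hd, hn]; push_cast; ring⟩

theorem exists_int_commExp [P.IsReduced] [P.IsIrreducible] (v v' : Q.Vertex) :
    ∃ n : ℤ, Q.commExp v v' = n := by
  obtain ⟨n1, h1⟩ := Q.exists_int_bTilde v.1.1 v'.1.1 (v.1.2 - v'.1.2 - 1)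
  obtain ⟨n2, h2⟩ := Q.exists_int_bTilde v.1.1 v'.1.1 (-(v.1.2 - v'.1.2 - 1))
  obtain ⟨n3, h3⟩ := Q.exists_int_bTilde v.1.1 v'.1.1 (v.1.2 - v'.1.2 + 1)
  obtain ⟨n4, h4⟩ := Q.exists_int_bTilde v.1.1 v'.1.1 (-(v.1.2 - v'.1.2 + 1))
  refine ⟨n1 + n2 - (n3 + n4), ?_⟩
  rw [commExp, etaTilde, etaTilde, h1, h2, h3, h4]
  push_cast
  rfl

/-- The sum along the row telescopes to η̃(p-r-1) - η̃(ξ_i-r+1). In each of these terms one of the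
two summands of η̃ vanishes, so up to sign it is a value of `bOdd`, that is, a pairing of a weight
at `i` with the root at (j,r). -/
theorem sum_commExp_shift (v v' : Q.Vertex) (hv : v.1.2 ≤ Q.height v.1.1)
    (hv' : v'.1.2 ≤ Q.height v'.1.1)
    (h : bTilde b v.1.1 v'.1.1 (v.1.2 - v'.1.2 - 1) = 0) :
    ∑ k ∈ Finset.range ((Q.height v.1.1 - v.1.2) / 2 + 1).toNat, Q.commExp (shift v k) v' =
      -form P (fundWeight b v.1.1 + Q.weightAt v.1.1 (v.1.2 - 2))
        (Q.rootAt v'.1.1 v'.1.2) := by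
  obtain ⟨⟨i, p⟩, hp⟩ := v
  obtain ⟨⟨j, r⟩, hr⟩ := v'
  simp only at hv hv' h hp hr ⊢
  have h1 (k : ℕ) : Q.commExp (shift ⟨(i, p), hp⟩ k) ⟨(j, r), hr⟩ =
      etaTilde b i j (p + 2 * (k : ℤ) - r - 1) -
        etaTilde b i j (p + 2 * ((k + 1 : ℕ) : ℤ) - r - 1) := by
    change etaTilde b i j (p + 2 * (k : ℤ) - r - 1) - etaTilde b i j (p + 2 * (k : ℤ) - r + 1) = _
    congr 2
    push_cast
    ring
  simp only [h1]
  rw [Finset.sum_range_sub' fun k : ℕ => etaTilde b i j (p + 2 * (k : ℤ) - r - 1)]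
  obtain ⟨c, hc⟩ := hp
  have e : p + 2 * ((((Q.height i - p) / 2 + 1).toNat : ℕ) : ℤ) - r - 1 =
      Q.height i - r + 1 := by omega
  have h2 : bTilde b i j (-(Q.height i - r + 1)) = 0 := by
    by_contra h2
    have := (bTilde_support Q.isHeight h2).1
    have := neg_le_abs (Q.height i - Q.height j)
    omega
  have h3 := Q.form_fundWeight_rootAt i j hr
  have h4 := Q.form_weightAt_rootAt i j (p := p - 2) (r := r) ⟨c - 1, by omega⟩ hr
  rw [show p - 2 - r + 1 = p - r - 1 by ring] at h4
  rw [e, form_eq_bilinForm, map_add, LinearMap.add_apply, ← form_eq_bilinForm,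
    ← form_eq_bilinForm, h3, h4]
  simp only [etaTilde, bOdd, h2, Nat.cast_zero, mul_zero, add_zero, h]
  ring

/-- The summation over the second row telescopes too, since roots are differences of consecutive
weights. -/
theorem rowExp_eq_neg_form (v v' : Q.Vertex) (hv : v.1.2 ≤ Q.height v.1.1)
    (hv' : v'.1.2 ≤ Q.height v'.1.1)
    (h : ∀ r, v'.1.2 ≤ r → bTilde b v.1.1 v'.1.1 (v.1.2 - r - 1) = 0) :
    Q.rowExp v v' = -form P (fundWeight b v.1.1 + Q.weightAt v.1.1 (v.1.2 - 2))
      (fundWeight b v'.1.1 - Q.weightAt v'.1.1 (v'.1.2 - 2)) := by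
  rw [rowExp_eq_sum, Finset.sum_comm]
  have h1 : ∀ l ∈ Finset.range ((Q.height v'.1.1 - v'.1.2) / 2 + 1).toNat,
      ∑ k ∈ Finset.range ((Q.height v.1.1 - v.1.2) / 2 + 1).toNat,
        Q.commExp (shift v k) (shift v' l) =
      -form P (fundWeight b v.1.1 + Q.weightAt v.1.1 (v.1.2 - 2))
        (Q.weightAt v'.1.1 (v'.1.2 + 2 * ((l + 1 : ℕ) : ℤ) - 2) -
          Q.weightAt v'.1.1 (v'.1.2 + 2 * (l : ℤ) - 2)) := by
    intro l hl
    rw [Finset.mem_range] at hl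
    rw [Q.sum_commExp_shift v (shift v' l) hv]
    · congr 2
      rw [rootAt]
      congr 2
      simp only [shift]
      push_cast
      ring
    · change v'.1.2 + 2 * (l : ℤ) ≤ Q.height v'.1.1
      omega
    · exact h _ (by change v'.1.2 ≤ v'.1.2 + 2 * (l : ℤ); omega)
  rw [Finset.sum_congr rfl h1, Finset.sum_neg_distrib]
  simp only [form_eq_bilinForm]
  rw [← map_sum, Finset.sum_range_sub fun l : ℕ =>
    Q.weightAt v'.1.1 (v'.1.2 + 2 * (l : ℤ) - 2), ← Q.weightAt_height v'.1.1]
  obtain ⟨c, hc⟩ := v'.2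
  congr 4
  · omega
  · simp

/-! ## Comparison with the weights attached to a longest adapted word -/

variable {Q} {w : List b.support}

theorem rowExp_letterVertex (hw : IsAdapted Q.height w) {k l : Fin w.length} (hkl : k ≤ l) :
    Q.rowExp (Q.letterVertex w k) (Q.letterVertex w l) =
      form P (fundWeight b (w.get k) - Q.weightAt (w.get k) ((Q.letterVertex w k).1.2 - 2))
        (fundWeight b (w.get l) + Q.weightAt (w.get l) ((Q.letterVertex w l).1.2 - 2)) := by
  rw [rowExp_skew, rowExp_eq_neg_form _ _ _ (heightAfter_le _ _ _) (heightAfter_le _ _ _), neg_neg,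
    form_comm]
  · rfl
  · intro r hr
    rcases hkl.eq_or_lt with rfl | hlt
    · exact bTilde_of_nonpos b _ _ (by omega)
    · by_contra h
      -- The support bound is taken for the heights just after letter k. There i_k has height two
      -- below its vertex, while i_l is still at least as high as its own vertex, which puts the
      -- argument outside the light cone.
      have h1 := (bTilde_support (Q.isHeight.heightAfter (isAdapted_take hw (k + 1))) h).1
      have h2 := le_abs_self (heightAfter Q.height (w.take (k + 1)) (w.get l) -
        heightAfter Q.height (w.take (k + 1)) (w.get k))
      have h3 := Q.letterVertex_le_heightAfter_take w hlt
      have h4 := Q.heightAfter_take_succ w k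
      change 1 + |heightAfter Q.height (w.take (k + 1)) (w.get l) -
        heightAfter Q.height (w.take (k + 1)) (w.get k)| ≤ _ at h1
      omega

variable [P.IsReduced]

/-- If β does not precede α in the convex order, some word of the commutation class has α before β.
The formula is applied in that word, and φ_Q shows that the vertices of α and β do not depend on the
word. -/
theorem IsLongestAdapted.lambdaMatrix_eq_rowExp (hw : Q.IsLongestAdapted w) (α β : posRoots b)
    (k l : Fin w.length) (hk : wordRoot b w k = α) (hl : wordRoot b w l = β) :
    lambdaMatrix b w α β = Q.rowExp (Q.letterVertex w k) (Q.letterVertex w l) := by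
  have hinj := hw.1.isPosWord.wordRoot_injective b
  rw [lambdaMatrix, ← hk, ← hl]
  simp only [resWeight_wordRoot hw.1, lamWeight_wordRoot hw]
  split_ifs with h
  · obtain ⟨l', k', hl', hk', hle⟩ := h.1 w (Relation.EqvGen.refl w)
    rw [hinj hl', hinj hk'] at hle
    rw [rowExp_skew, rowExp_letterVertex hw.2 hle]
  · by_cases hkl : k = l
    · subst hkl
      rw [rowExp_letterVertex hw.2 le_rfl]
    · have h1 : ¬ ConvexLE b w (wordRoot b w l) (wordRoot b w k) := fun h1 =>
        h ⟨h1, fun h2 => hkl (hinj h2).symm⟩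
      unfold ConvexLE at h1
      push Not at h1
      obtain ⟨w', hw', h2⟩ := h1
      have hlw' := hw.of_commEquiv hw'
      obtain ⟨k', hk'⟩ := hlw'.exists_wordRoot_eq α.2
      obtain ⟨l', hl'⟩ := hlw'.exists_wordRoot_eq β.2
      have hlt := h2 l' k' (hl'.trans hl.symm) (hk'.trans hk.symm)
      have e1 : Q.letterVertex w' k' = Q.letterVertex w k := by
        rw [← hw.phi_eq_iff, hk, ← hk', hlw'.phi_eq_iff]
      have e2 : Q.letterVertex w' l' = Q.letterVertex w l := by
        rw [← hw.phi_eq_iff, hl, ← hl', hlw'.phi_eq_iff]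
      have f1 : w'.get k' = w.get k := congrArg (fun v : Q.Vertex => v.1.1) e1
      have f2 : w'.get l' = w.get l := congrArg (fun v : Q.Vertex => v.1.1) e2
      have h3 := rowExp_letterVertex hlw'.2 hlt.le
      rw [e1, e2, f1, f2] at h3
      exact h3.symm

end DynkinQuiver

end DynkinTorus

end

/-! ### The isomorphism of quantum tori. -/

open DynkinTorus in
theorem mainTheorem9 {ι M N : Type*} [Fintype ι] [Nonempty ι]
    [AddCommGroup M] [Module ℚ M] [AddCommGroup N] [Module ℚ N]
    (P : RootPairing ι ℚ M N) [P.IsRootSystem] [P.IsCrystallographic] [P.IsReduced]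
    [P.IsIrreducible] (b : P.Base) (Q : DynkinQuiver b) :
    (∃ w : List b.support, Q.IsLongestAdapted w) ∧
    ∀ w : List b.support, Q.IsLongestAdapted w →
      ∃ Ψ : TorusT b w ≃ₐ[Coeff] Q.subtorus,
        (∀ n : ℤ, Ψ (algebraMap Coeff _ (LaurentPolynomial.T n)) =
          algebraMap Coeff _ (LaurentPolynomial.T n)) ∧
        ∀ α : posRoots b, ∃ v : Q.Vertex, (∀ v' : Q.Vertex, Q.phi v' = ((α : M), 0) ↔ v' = v) ∧
          Q.IsBarMonomial v (Ψ (gen (lambdaMatrix b w) α) : Q.TorusX) := by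
  classical
  refine ⟨Q.exists_isLongestAdapted, fun w hw => ?_⟩
  have : Finite (posRoots b) := (Set.toFinite {k | b.IsPos k}).image P.root
  have := Fintype.ofFinite (posRoots b)
  choose k hk using fun α : posRoots b => hw.exists_wordRoot_eq α.2
  choose E hE using Q.exists_int_commExp
  have hs (v v' : Q.Vertex) : E v v' = -E v' v := by
    have h := Q.commExp_skew v v'
    rw [hE, hE] at h
    exact_mod_cast h
  let y (α : posRoots b) : Q.Vertex := Q.letterVertex w (k α)
  have hphi (α : posRoots b) (v : Q.Vertex) : Q.phi v = ((α : M), 0) ↔ v = y α := by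
    rw [← hk α]
    exact hw.phi_eq_iff (k α) v
  have hy : Function.Injective y := by
    intro α β h
    have h1 := ((hphi α (y α)).2 rfl).symm.trans ((hphi β (y α)).2 h)
    exact Subtype.ext (Prod.ext_iff.1 h1).1
  have hyle (α : posRoots b) : (y α).1.2 ≤ Q.height (y α).1.1 := heightAfter_le _ _ _
  have hΓ (v : Q.Vertex) (hv : v ∈ Q.gammaVertices) : ∃ α, y α = v :=
    ⟨⟨_, hv.1⟩, ((hphi ⟨_, hv.1⟩ v).1 (Prod.ext rfl hv.2)).symm⟩
  -- The bar-invariant normalization is chosen for every vertex, not only those of Γ_Q: the row of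
  -- (i,p+2) used below may be empty.
  choose n hn using fun v : Q.Vertex => exists_bar_monomialUnit hE
    (d := fun v : Q.Vertex => halfNorm b v.1.1) (fun v => exists_int_halfNorm b v.1.1)
    (DynkinQuiver.row v)
  let m (α : posRoots b) : (Q.TorusX)ˣ :=
    monomialUnit Q.commExp (n (y α)) (DynkinQuiver.row (y α))
  have hm (α β : posRoots b) : (m α * m β : Q.TorusX) =
      qpow (lambdaMatrix b w α β) • (m β * m α : Q.TorusX) := by
    rw [hw.lambdaMatrix_eq_rowExp α β (k α) (k β) (hk α) (hk β)]
    refine (monomialUnit_mul_monomialUnit hE _ _ _ _).trans ?_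
    congr 2
    exact (Q.rowExp_eq_intCast hE _ _).symm
  have hF : Function.Injective (torusLift (B := Q.TorusX) (lambdaMatrix b w) m hm) :=
    torusLift_injective hE hs m hm _ (fun α => isMonomialOp_monomialUnit hE hs _ _)
      (Q.eq_zero_of_sum_row hy hyle)
  obtain ⟨Ψ, hΨ⟩ := exists_algEquiv_adjoin Q.gammaVertices m hm hF
    (fun A hA α => monomialUnit_mem_units _ fun v hv => hA v (by
      obtain ⟨hi, hp, hle⟩ := Q.mem_row hv
      rw [hw.mem_gammaVertices_iff, hi]
      exact ⟨(Q.heightAfter_lt_letterVertex w (k α)).trans_le hp, hle⟩))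
    (fun A hA v hv => by
      have h1 (v : Q.Vertex) (hv : v ∈ Q.gammaVertices) :
          monomialUnit Q.commExp (n v) (DynkinQuiver.row v) ∈ A.toSubmonoid.units := by
        obtain ⟨α, rfl⟩ := hΓ v hv
        exact hA α
      have h3 := h1 v hv
      rw [hw.mem_gammaVertices_iff] at hv
      rw [Q.row_eq_cons v hv.2] at h3
      -- The generator at (i,p) is recovered from the rows starting at (i,p) and (i,p+2). The latter
      -- starts in Γ_Q or is empty, in which case its monomial is a scalar.
      refine genUnit_mem_units (n' := n (DynkinQuiver.shift v 1)) h3 ?_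
      by_cases hle : (DynkinQuiver.shift v 1).1.2 ≤ Q.height (DynkinQuiver.shift v 1).1.1
      · refine h1 _ ((hw.mem_gammaVertices_iff _).2 ⟨hv.1.trans ?_, hle⟩)
        change v.1.2 < v.1.2 + 2 * ((1 : ℕ) : ℤ)
        omega
      · rw [Q.row_eq_nil _ (not_le.1 hle)]
        exact monomialUnit_mem_units _ (by simp))
  refine ⟨Ψ, fun n => Ψ.commutes _, fun α => ⟨y α, hphi α, ?_⟩⟩
  refine (congrArg (Q.IsBarMonomial (y α)) (hΨ α)).mpr ⟨⟨n (y α), ?_⟩, hn (y α)⟩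
  rw [Q.monomial_eq_prod_row]
  exact val_monomialUnit _ _
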